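/- Let $\ell,T,F_1,F_2,\nu>0$ and $\beta,r\in\mathbb R$, let $D=(0,\ell)\times(0,\ell)$, and let $f\in L^2(0,T;L^2(D))$. Put $\mathbb H=L^2(D)\times L^2(D)$ and $\mathbb H^1_0=H^1_0(D)\times H^1_0(D)$, and let $$X=C([0,T];\mathbb H)\cap L^2((0,T);\mathbb H^1_0),\qquad \|q\|_X=\Big(\sup_{0\le s\le T}\|q(s)\|^2+\int_0^T\|\nabla q(s)\|^2\,ds\Big)^{1/2}.$$ Let $Q$ be a positive self-adjoint trace class operator on $\mathbb H$, and let $\mathbb H_0=Q^{1/2}\mathbb H$ with $|h|_0=\|Q^{-1/2}h\|$, where $Q^{-1/2}h$ is the solution $u\perp\ker Q^{1/2}$ of $Q^{1/2}u=h$. Let $L_Q(\mathbb H_0;\mathbb H)$ be the space of the linear operators $S:\mathbb H_0\to\mathbb H$ for which $SQ^{1/2}$ is Hilbert–Schmidt on $\mathbb H$, with $\|S\|_{L_Q}^2=\operatorname{tr}(SQS^*)=\|SQ^{1/2}\|_{HS}^2$. Let $\sigma:\mathbb H\to L_Q(\mathbb H_0;\mathbb H)$ be continuous, and assume that there are constants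 $K,L>0$ with $\|\sigma(q)\|_{L_Q}^2\le K(1+\|q\|^2)$ and $\|\sigma(q)-\sigma(\hat q)\|_{L_Q}^2\le L\|q-\hat q\|^2$ for all $q,\hat q\in\mathbb H$. Let $\xi\in\mathbb H$. For $q=(q_1,q_2)\in\mathbb H$, the stream functions $\psi_1,\psi_2\in H^2(D)\cap H^1_0(D)$ are given by $q_1=\Delta\psi_1-F_1(\psi_1-\psi_2)$ and $q_2=\Delta\psi_2-F_2(\psi_2-\psi_1)$. Let $J(u,v)=u_xv_y-u_yv_x$. For $h\in L^2(0,T;\mathbb H_0)$ consider the controlled two-layer quasi-geostrophic equation $$\partial_tq_1+J(\psi_1,q_1+\beta y)=\nu\Delta^2\psi_1+f+(\sigma(q)h)_1,\qquad \partial_tq_2+J(\psi_2,q_2+\beta y)=\nu\Delta^2\psi_2-r\Delta\psi_2+(\sigma(q)h)_2,\qquad q(0)=\xi .$$ A weak solution is a $q\in X$ such that, for all $\varphi_1,\varphi_2\in H^2(D)\cap H^1_0(D)$, $\varphi=(\varphi_1,\varphi_2)$, and all $t\in[0,T]$, $$(q(t),\varphi)-(\xi,\varphi)+\int_0^t\Big[\sum_{i=1}^2\big\{(J(\psi_i,q_i+\beta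 y),\varphi_i)-\nu(\Delta\psi_i,\Delta\varphi_i)\big\}-(f,\varphi_1)+r(\Delta\psi_2,\varphi_2)\Big]ds=\int_0^t(\sigma(q)h,\varphi)\,ds .$$ Let $0<M<\infty$, let $S_M=\{h\in L^2(0,T;\mathbb H_0):\int_0^T|h(s)|_0^2\,ds\le M\}$, and let $K_M$ be the set of all $q_h\in X$ that are a weak solution of this equation for some $h\in S_M$. Then $K_M$ is a compact subset of $X$. -/

import Mathlib

open MeasureTheory Set Filter Topology
open scoped ENNReal

noncomputable section

namespace TwoLayerQG

/-! ### The square `D = (0, ℓ) × (0, ℓ)` and its Lebesgue and Sobolev spaces -/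

/-- The open square `D = (0, ℓ) × (0, ℓ)`. -/
def square (ℓ : ℝ) : TopologicalSpace.Opens (ℝ × ℝ) :=
  ⟨Ioo 0 ℓ ×ˢ Ioo 0 ℓ, isOpen_Ioo.prod isOpen_Ioo⟩

/-- The space `L²(D)`. -/
abbrev L2 (ℓ : ℝ) : Type :=
  Lp ℝ 2 ((volume : Measure (ℝ × ℝ)).restrict (square ℓ : Set (ℝ × ℝ)))

/-- `L²` vector fields on `D`: index `0` is the `x`-component, index `1` the `y`-component. -/
abbrev L2Vec (ℓ : ℝ) : Type := PiLp 2 (fun _ : Fin 2 => L2 ℓ)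

/-- The Hilbert space `ℍ = L²(D) × L²(D)`: index `0` is the top layer, `1` the bottom layer. -/
abbrev HH (ℓ : ℝ) : Type := PiLp 2 (fun _ : Fin 2 => L2 ℓ)

/-- Gradients of the two layers, `(∇q₁, ∇q₂)`, normed by `(‖∇q₁‖² + ‖∇q₂‖²)^(1/2)`. -/
abbrev GradHH (ℓ : ℝ) : Type := PiLp 2 (fun _ : Fin 2 => L2Vec ℓ)

/-- Smooth real functions with compact support in `D`. -/
abbrev TestFn (ℓ : ℝ) : Type := TestFunction (square ℓ) ℝ ⊤

/-- The coordinate directions, `x` for the index `0` and `y` for the index `1`. -/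
def dir (j : Fin 2) : ℝ × ℝ := if j = 0 then (1, 0) else (0, 1)

/-- The partial derivative `∂_j φ` of a test function. -/
def pd {ℓ : ℝ} (j : Fin 2) (φ : TestFn ℓ) (z : ℝ × ℝ) : ℝ := fderiv ℝ φ z (dir j)

/-- `v ∈ L²(D)` is the weak partial derivative `∂_j u` of `u ∈ L²(D)`. -/
def HasWeakDeriv {ℓ : ℝ} (j : Fin 2) (u v : L2 ℓ) : Prop :=
  ∀ φ : TestFn ℓ,
    ∫ z in (square ℓ : Set (ℝ × ℝ)), u z * pd j φ z =
      - ∫ z in (square ℓ : Set (ℝ × ℝ)), v z * φ z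

/-- The pairs `(φ, ∇φ)` with `φ` a test function on `D`. -/
def testGraph (ℓ : ℝ) : Submodule ℝ (L2 ℓ × L2Vec ℓ) where
  carrier := {p | ∃ φ : TestFn ℓ,
    p.1 =ᵐ[volume.restrict (square ℓ : Set (ℝ × ℝ))] φ ∧
    ∀ j, p.2 j =ᵐ[volume.restrict (square ℓ : Set (ℝ × ℝ))] pd j φ}
  add_mem' := by
    rintro p q ⟨φ, hφ, hφ'⟩ ⟨χ, hχ, hχ'⟩
    refine ⟨φ + χ, ?_, fun j => ?_⟩
    · filter_upwards [Lp.coeFn_add p.1 q.1, hφ, hχ] with z h1 h2 h3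
      simp only [Prod.fst_add, h1, Pi.add_apply, h2, h3]
      rfl
    · filter_upwards [Lp.coeFn_add (p.2 j) (q.2 j), hφ' j, hχ' j] with z h1 h2 h3
      have d1 : DifferentiableAt ℝ φ z := (φ.contDiff.differentiable (by simp)) z
      have d2 : DifferentiableAt ℝ χ z := (χ.contDiff.differentiable (by simp)) z
      have e : (((φ + χ : TestFn ℓ)) : ℝ × ℝ → ℝ) = (φ : ℝ × ℝ → ℝ) + χ := rfl
      simp only [Prod.snd_add, PiLp.add_apply, h1, Pi.add_apply, h2, h3, pd, e]
      rw [fderiv_add d1 d2]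
      rfl
  zero_mem' := by
    refine ⟨0, ?_, fun j => ?_⟩
    · filter_upwards [Lp.coeFn_zero ℝ 2 (volume.restrict (square ℓ : Set (ℝ × ℝ)))] with z h
      simp only [Prod.fst_zero, h]
      rfl
    · filter_upwards [Lp.coeFn_zero ℝ 2 (volume.restrict (square ℓ : Set (ℝ × ℝ)))] with z h
      have e : (((0 : TestFn ℓ)) : ℝ × ℝ → ℝ) = 0 := rfl
      simp only [Prod.snd_zero, PiLp.zero_apply, h, pd, e]
      simp
  smul_mem' := by
    rintro c p ⟨φ, hφ, hφ'⟩
    refine ⟨c • φ, ?_, fun j => ?_⟩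
    · filter_upwards [Lp.coeFn_smul c p.1, hφ] with z h1 h2
      simp only [Prod.smul_fst, h1, Pi.smul_apply, h2]
      rfl
    · filter_upwards [Lp.coeFn_smul c (p.2 j), hφ' j] with z h1 h2
      have d1 : DifferentiableAt ℝ φ z := (φ.contDiff.differentiable (by simp)) z
      have e : (((c • φ : TestFn ℓ)) : ℝ × ℝ → ℝ) = c • (φ : ℝ × ℝ → ℝ) := rfl
      simp only [Prod.smul_snd, PiLp.smul_apply, h1, Pi.smul_apply, h2, pd, e]
      rw [fderiv_const_smul d1]
      rfl

/-- The graph `{(u, ∇u) : u ∈ H¹₀(D)}`, where `H¹₀(D)` is the closure of the test functions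
in the `H¹` norm. -/
def H10Graph (ℓ : ℝ) : Submodule ℝ (L2 ℓ × L2Vec ℓ) := (testGraph ℓ).topologicalClosure

/-- A function in `H²(D) ∩ H¹₀(D)`, together with its (unique) weak derivatives of order at most
two, all of them in `L²(D)`. -/
structure H2H10 (ℓ : ℝ) where
  /-- the function -/
  toL2 : L2 ℓ
  /-- its weak gradient -/
  grad : L2Vec ℓ
  /-- its second weak derivatives, `hess i j = ∂_j ∂_i` -/
  hess : Fin 2 → Fin 2 → L2 ℓ
  mem_H10 : (toL2, grad) ∈ H10Graph ℓ
  hess_spec : ∀ i j, HasWeakDeriv j (grad i) (hess i j)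

/-- The Laplacian of a function in `H²(D) ∩ H¹₀(D)`. -/
def H2H10.lap {ℓ : ℝ} (u : H2H10 ℓ) : L2 ℓ := u.hess 0 0 + u.hess 1 1

/-! ### The path space `X` -/

/-- Lebesgue measure on the time interval `[0,T]`. -/
def timeMeasure (T : ℝ) : Measure (Icc (0 : ℝ) T) := (volume : Measure ℝ).comap Subtype.val

/-- The space `X = C([0,T]; ℍ) ∩ L²((0,T); ℍ¹₀)`, an element being given as the pair `(q, ∇q)` of
a path `q ∈ C([0,T]; ℍ)` with `q(t) ∈ ℍ¹₀` for almost every `t` and its (unique) spatial gradient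
`∇q ∈ L²((0,T); L²)`. The norm is `(sup_t ‖q(t)‖² + ∫₀ᵀ ‖∇q(t)‖² dt)^(1/2)`. -/
def X (ℓ T : ℝ) : Submodule ℝ
    (WithLp 2 (C(Icc (0 : ℝ) T, HH ℓ) × Lp (GradHH ℓ) 2 (timeMeasure T))) where
  carrier := {p | ∀ᵐ t ∂(timeMeasure T), ∀ i, (p.fst t i, p.snd t i) ∈ H10Graph ℓ}
  add_mem' := by
    intro p q hp hq
    change ∀ᵐ t ∂(timeMeasure T), _
    change ∀ᵐ t ∂(timeMeasure T), _ at hp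
    change ∀ᵐ t ∂(timeMeasure T), _ at hq
    filter_upwards [hp, hq, Lp.coeFn_add p.snd q.snd] with t h1 h2 h3 i
    change ((p.fst t + q.fst t) i, (p.snd + q.snd : Lp (GradHH ℓ) 2 (timeMeasure T)) t i) ∈ _
    rw [h3]
    exact (H10Graph ℓ).add_mem (h1 i) (h2 i)
  zero_mem' := by
    change ∀ᵐ t ∂(timeMeasure T), _
    filter_upwards [Lp.coeFn_zero (GradHH ℓ) 2 (timeMeasure T)] with t h i
    change ((0 : HH ℓ) i, (0 : Lp (GradHH ℓ) 2 (timeMeasure T)) t i) ∈ _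
    rw [h]
    exact (H10Graph ℓ).zero_mem
  smul_mem' := by
    intro c p hp
    change ∀ᵐ t ∂(timeMeasure T), _ at hp
    change ∀ᵐ t ∂(timeMeasure T), _
    filter_upwards [hp, Lp.coeFn_smul c p.snd] with t h1 h3 i
    change ((c • p.fst t) i, (c • p.snd : Lp (GradHH ℓ) 2 (timeMeasure T)) t i) ∈ _
    rw [h3]
    exact (H10Graph ℓ).smul_mem c (h1 i)

/-- The value `q(t) ∈ ℍ` of a path in `X`. -/
def X.val {ℓ T : ℝ} (q : X ℓ T) (t : Icc (0 : ℝ) T) : HH ℓ :=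
  (q : WithLp 2 (C(Icc (0 : ℝ) T, HH ℓ) × Lp (GradHH ℓ) 2 (timeMeasure T))).fst t

/-- The spatial gradient of a path in `X`: `q.grad t i j` is `∂_j q_i(t)`, for a.e. `t`. -/
def X.grad {ℓ T : ℝ} (q : X ℓ T) (t : Icc (0 : ℝ) T) : GradHH ℓ :=
  (q : WithLp 2 (C(Icc (0 : ℝ) T, HH ℓ) × Lp (GradHH ℓ) 2 (timeMeasure T))).snd t

/-! ### The space `H₀ = Q^{1/2} H` and the space `L_Q(H₀; H)` -/

section Noise

variable {H : Type} [NormedAddCommGroup H] [InnerProductSpace ℝ H] [CompleteSpace H]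

/-- The index set of an orthonormal basis of `H`. -/
def stdIndex (H : Type) [NormedAddCommGroup H] [InnerProductSpace ℝ H] [CompleteSpace H] : Set H :=
  (exists_hilbertBasis ℝ H).choose

/-- An orthonormal basis of `H`. The sums over it that are used below do not depend on it. -/
def stdBasis (H : Type) [NormedAddCommGroup H] [InnerProductSpace ℝ H] [CompleteSpace H] :
    HilbertBasis (stdIndex H) ℝ H :=
  (exists_hilbertBasis ℝ H).choose_spec.choose

/-- A positive operator `Q` on `H` is of trace class: `tr Q = ∑ᵢ (Q eᵢ, eᵢ) < ∞`. -/
def FiniteTrace (Q : H →L[ℝ] H) : Prop :=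
  Summable fun i => inner ℝ (Q (stdBasis H i)) (stdBasis H i)

/-- The vector space `H₀ = Q^{1/2} H`, where `R = Q^{1/2}`. -/
def H0 (R : H →L[ℝ] H) : Type := LinearMap.range (R : H →ₗ[ℝ] H)

instance (R : H →L[ℝ] H) : AddCommGroup (H0 R) :=
  inferInstanceAs (AddCommGroup (LinearMap.range (R : H →ₗ[ℝ] H)))

instance (R : H →L[ℝ] H) : Module ℝ (H0 R) :=
  inferInstanceAs (Module ℝ (LinearMap.range (R : H →ₗ[ℝ] H)))

/-- The surjection `Q^{1/2} : H → H₀`. -/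
def H0.ofH (R : H →L[ℝ] H) : H →ₗ[ℝ] H0 R := (R : H →ₗ[ℝ] H).rangeRestrict

theorem H0.bijective (R : H →L[ℝ] H) :
    Function.Bijective (H0.ofH R ∘ₗ (LinearMap.ker (R : H →ₗ[ℝ] H))ᗮ.subtype) := by
  have hc : IsClosed ((LinearMap.ker (R : H →ₗ[ℝ] H)) : Set H) := R.isClosed_ker
  have : CompleteSpace (LinearMap.ker (R : H →ₗ[ℝ] H)) := hc.completeSpace_coe
  constructor
  · rw [← LinearMap.ker_eq_bot, LinearMap.ker_eq_bot']
    intro u hu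
    have h1 : (u : H) ∈ LinearMap.ker (R : H →ₗ[ℝ] H) := congrArg Subtype.val hu
    have h2 := (Submodule.mem_orthogonal _ _).1 u.2 u h1
    exact Subtype.ext (inner_self_eq_zero.1 h2)
  · rintro ⟨_, u, rfl⟩
    obtain ⟨v, hv, w, hw, rfl⟩ :=
      (LinearMap.ker (R : H →ₗ[ℝ] H)).exists_add_mem_mem_orthogonal u
    refine ⟨⟨w, hw⟩, Subtype.ext ?_⟩
    have hv' : R v = 0 := hv
    change R w = R (v + w)
    rw [map_add, hv', zero_add]

/-- The inverse `Q^{-1/2} : H₀ → H`, which maps `h` to the solution `u` of `Q^{1/2} u = h` that is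
orthogonal to the kernel of `Q^{1/2}`, i.e. the one of least norm. -/
def H0.inv (R : H →L[ℝ] H) : H0 R →ₗ[ℝ] H :=
  (LinearMap.ker (R : H →ₗ[ℝ] H))ᗮ.subtype ∘ₗ
    (LinearEquiv.ofBijective _ (H0.bijective R)).symm.toLinearMap

theorem H0.inv_injective (R : H →L[ℝ] H) : Function.Injective (H0.inv R) :=
  Subtype.val_injective.comp (LinearEquiv.injective _)

/-- The norm `|h|₀ = ‖Q^{-1/2} h‖` of `H₀`. -/
instance (R : H →L[ℝ] H) : NormedAddCommGroup (H0 R) :=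
  NormedAddCommGroup.induced (H0 R) H (H0.inv R) (H0.inv_injective R)

/-- The scalar product `(g, h)₀ = (Q^{-1/2} g, Q^{-1/2} h)` of `H₀`. -/
instance (R : H →L[ℝ] H) : InnerProductSpace ℝ (H0 R) :=
  InnerProductSpace.induced (H0.inv R)

/-- The squared norm `tr (S Q S*) = ∑ᵢ ‖S Q^{1/2} eᵢ‖²` of `L_Q(H₀; H)`, with the value `∞` if the
operator `S Q^{1/2}` is not Hilbert-Schmidt; here `R = Q^{1/2}`. -/
def lqNormSq (R : H →L[ℝ] H) (S : H0 R →L[ℝ] H) : ℝ≥0∞ :=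
  ∑' i, ‖S (H0.ofH R (stdBasis H i))‖ₑ ^ 2

/-- The assumptions on the noise intensity `σ : H → L_Q(H₀; H)`: it is continuous, has linear growth,
and is Lipschitz continuous, for the norm of `L_Q(H₀; H)`. -/
structure NoiseAssumption (R : H →L[ℝ] H) (σ : H → H0 R →L[ℝ] H) : Prop where
  mem_LQ : ∀ q, lqNormSq R (σ q) < ∞
  continuous : ∀ q, Tendsto (fun p => lqNormSq R (σ p - σ q)) (𝓝 q) (𝓝 0)
  growth : ∃ K : ℝ, 0 < K ∧ ∀ q, lqNormSq R (σ q) ≤ ENNReal.ofReal (K * (1 + ‖q‖ ^ 2))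
  lipschitz : ∃ L : ℝ, 0 < L ∧
    ∀ p q, lqNormSq R (σ p - σ q) ≤ ENNReal.ofReal (L * ‖p - q‖ ^ 2)

/-- The ball `S_M` of controls `h ∈ L²(0,T; H₀)` with `∫₀ᵀ |h(s)|₀² ds ≤ M`. -/
def controlBall (R : H →L[ℝ] H) (T M : ℝ) :
    Set (Lp (H0 R) 2 (timeMeasure T)) :=
  {h | ∫ s, ‖h s‖ ^ 2 ∂(timeMeasure T) ≤ M}

end Noise

/-! ### The controlled equation -/

/-- `ψ = (ψ₁, ψ₂)` are the stream functions of the potential vorticities `q = (q₁, q₂)`: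
`q₁ = Δψ₁ - F₁ (ψ₁ - ψ₂)` and `q₂ = Δψ₂ - F₂ (ψ₂ - ψ₁)` with `ψ₁, ψ₂ ∈ H²(D) ∩ H¹₀(D)`. -/
def IsStream {ℓ : ℝ} (F₁ F₂ : ℝ) (q : HH ℓ) (ψ : Fin 2 → H2H10 ℓ) : Prop :=
  q 0 = (ψ 0).lap - F₁ • ((ψ 0).toL2 - (ψ 1).toL2) ∧
  q 1 = (ψ 1).lap - F₂ • ((ψ 1).toL2 - (ψ 0).toL2)

/-- `(J(ψ, q + β y), φ) = ∫_D (∂ₓψ (∂_y q + β) - ∂_yψ ∂ₓq) φ`, where `g = ∇q`. -/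
def jacobi {ℓ : ℝ} (β : ℝ) (ψ : H2H10 ℓ) (g : L2Vec ℓ) (φ : H2H10 ℓ) : ℝ :=
  ∫ z in (square ℓ : Set (ℝ × ℝ)),
    (ψ.grad 0 z * (g 1 z + β) - ψ.grad 1 z * g 0 z) * φ.toL2 z

/-- A pair of functions in `H²(D) ∩ H¹₀(D)` as an element of `ℍ`. -/
def toHH {ℓ : ℝ} (φ : Fin 2 → H2H10 ℓ) : HH ℓ := WithLp.toLp 2 fun i => (φ i).toL2

/-- `q ∈ X` is a weak solution on `[0,T]` of the controlled equation
`∂ₜq₁ + J(ψ₁, q₁ + βy) = ν Δ²ψ₁ + f + (σ(q)h)₁`,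
`∂ₜq₂ + J(ψ₂, q₂ + βy) = ν Δ²ψ₂ - r Δψ₂ + (σ(q)h)₂`, `q(0) = ξ`,
tested with all pairs `φ = (φ₁, φ₂)` in `H²(D) ∩ H¹₀(D)`; the term `(Δ²ψᵢ, φᵢ)` is written as
`(Δψᵢ, Δφᵢ)`. -/
def IsWeakSolution {ℓ T : ℝ} (F₁ F₂ ν β r : ℝ) (f : Lp (L2 ℓ) 2 (timeMeasure T))
    (R : HH ℓ →L[ℝ] HH ℓ) (σ : HH ℓ → H0 R →L[ℝ] HH ℓ) (ξ : HH ℓ)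
    (h : Lp (H0 R) 2 (timeMeasure T)) (q : X ℓ T) : Prop :=
  ∃ ψ : Icc (0 : ℝ) T → Fin 2 → H2H10 ℓ,
    (∀ t, IsStream F₁ F₂ (X.val q t) (ψ t)) ∧
    ∀ (φ : Fin 2 → H2H10 ℓ) (t : Icc (0 : ℝ) T),
      inner ℝ (X.val q t) (toHH φ) - inner ℝ ξ (toHH φ)
        + ∫ s in Iic t, (∑ i, (jacobi β (ψ s i) (X.grad q s i) (φ i)
              - ν * inner ℝ (ψ s i).lap (φ i).lap)
            - inner ℝ (f s) (φ 0).toL2 + r * inner ℝ (ψ s 1).lap (φ 1).toL2)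
            ∂(timeMeasure T)
      = ∫ s in Iic t, inner ℝ (σ (X.val q s) (h s)) (toHH φ) ∂(timeMeasure T)

/-- The set `K_M` of the solutions `q_h` with controls `h ∈ S_M`. -/
def solutionSet {ℓ : ℝ} (T M F₁ F₂ ν β r : ℝ)
    (f : Lp (L2 ℓ) 2 (timeMeasure T))
    (R : HH ℓ →L[ℝ] HH ℓ) (σ : HH ℓ → H0 R →L[ℝ] HH ℓ) (ξ : HH ℓ) : Set (X ℓ T) :=
  {q | ∃ h ∈ controlBall R T M, IsWeakSolution F₁ F₂ ν β r f R σ ξ h q}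

end TwoLayerQG

end

/-!
The proof avoids Sobolev embeddings and the Aubin-Lions lemma by expanding in the eigenfunctions
`e_k = (2/ℓ) sin (π m x / ℓ) sin (π n y / ℓ)` of the Dirichlet Laplacian, which form an orthonormal
basis of `L²(D)`. With eigenvalues `λ_k`, the squared norm of `∇u` is `∑ λ_k u_k²` for
`u ∈ H¹₀(D)` (`hasSum_norm_grad_sq`), and `∑ λ_k⁻² < ∞` (`summable_inv_eig_sq`). Hence a function in
`H²(D) ∩ H¹₀(D)` is bounded on `D`, the system for the stream functions is solved mode by mode
(`exists_isStream`), and the maximum of the stream functions of `q ∈ ℍ` is at most `weakSup q`, a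
weighted `ℓ¹` norm of the coefficients of `q` to which high modes contribute little (`weakSup_le`).

For a bounded `ψ`, the form `(g, d) ↦ ∫_D ψ (g × d)` is continuous and antisymmetric on `L²`; it
represents `(J(ψ, u), v)` in terms of `g = ∇u` and `d = ∇v`. Each layer of a weak solution solves
`∂ₜq + J(ψ, q) = ν Δq + z` with a source `z` of order zero (`layerEq_of_weak`), and satisfies the
energy identity, in which the nonlinear term vanishes (`LayerEq.energy`). Gronwall's inequality
bounds the solutions in `X` for all controls of the ball (`exists_boundedSolution`).

For the difference `w` of two such solutions, the energy identity leaves a nonlinear term of the size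
of the maximum of the difference of the stream functions, so that `‖w‖_X²` is at most a constant
times `sup_t weakSup (w t) + (∫ ‖w‖²)^(1/2)`. Both terms are small as soon as finitely many modes of
`w` are small, uniformly in time (`exists_modes_norm_sub_le`). The modes of the solutions are
uniformly bounded and equicontinuous in time, so by the theorem of Arzelà and Ascoli they converge
uniformly along any ultrafilter of solutions; the ultrafilter is then Cauchy in the complete space
`X` (`cauchy_of_boundedSolution`). The controls converge weakly along the ultrafilter, and the weak
formulation passes to the limit, since `σ` is Lipschitz continuous
(`mem_solutionSet_of_le_nhds`).
-/

open MeasureTheory Set Filter Topology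
open scoped ENNReal

noncomputable section

namespace TwoLayerQG

/-! ### Continuous functions and weak derivatives in `L²(D)` -/

section Square

variable {ℓ : ℝ}

theorem measurableSet_square (ℓ : ℝ) : MeasurableSet (square ℓ : Set (ℝ × ℝ)) :=
  (square ℓ).isOpen.measurableSet

theorem square_subset_Icc (ℓ : ℝ) : (square ℓ : Set (ℝ × ℝ)) ⊆ Icc 0 ℓ ×ˢ Icc 0 ℓ :=
  prod_mono Ioo_subset_Icc_self Ioo_subset_Icc_self

theorem isCompact_closedSquare (ℓ : ℝ) : IsCompact (Icc (0 : ℝ) ℓ ×ˢ Icc (0 : ℝ) ℓ) :=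
  isCompact_Icc.prod isCompact_Icc

instance isFiniteMeasure_square (ℓ : ℝ) :
    IsFiniteMeasure ((volume : Measure (ℝ × ℝ)).restrict (square ℓ : Set (ℝ × ℝ))) := by
  refine ⟨?_⟩
  rw [Measure.restrict_apply_univ]
  exact (measure_mono (square_subset_Icc ℓ)).trans_lt (isCompact_closedSquare ℓ).measure_lt_top

theorem exists_bound_on_square (χ : C(ℝ × ℝ, ℝ)) :
    ∃ C, ∀ z ∈ (square ℓ : Set (ℝ × ℝ)), |χ z| ≤ C := by
  obtain ⟨C, hC⟩ := (isCompact_closedSquare ℓ).exists_bound_of_continuousOn χ.continuous.continuousOn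
  exact ⟨C, fun z hz => hC z (square_subset_Icc ℓ hz)⟩

theorem ae_square {p : ℝ × ℝ → Prop} (h : ∀ z ∈ (square ℓ : Set (ℝ × ℝ)), p z) :
    ∀ᵐ z ∂(volume.restrict (square ℓ : Set (ℝ × ℝ))), p z :=
  (ae_restrict_iff' (measurableSet_square ℓ)).2 (Eventually.of_forall h)

theorem memLp_continuousMap (ℓ : ℝ) (χ : C(ℝ × ℝ, ℝ)) :
    MemLp χ 2 ((volume : Measure (ℝ × ℝ)).restrict (square ℓ : Set (ℝ × ℝ))) := by
  obtain ⟨C, hC⟩ := exists_bound_on_square (ℓ := ℓ) χ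
  exact MemLp.of_bound χ.continuous.aestronglyMeasurable C (ae_square hC)

/-- The class in `L²(D)` of a continuous function on the plane. -/
def contL2 (ℓ : ℝ) (χ : C(ℝ × ℝ, ℝ)) : L2 ℓ := (memLp_continuousMap ℓ χ).toLp χ

theorem coeFn_contL2 (χ : C(ℝ × ℝ, ℝ)) :
    contL2 ℓ χ =ᵐ[volume.restrict (square ℓ : Set (ℝ × ℝ))] χ :=
  MemLp.coeFn_toLp _

theorem contL2_smul (c : ℝ) (χ : C(ℝ × ℝ, ℝ)) : contL2 ℓ (c • χ) = c • contL2 ℓ χ := rfl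

theorem contL2_add (χ η : C(ℝ × ℝ, ℝ)) : contL2 ℓ (χ + η) = contL2 ℓ χ + contL2 ℓ η := rfl

theorem inner_L2 (u v : L2 ℓ) :
    inner ℝ u v = ∫ z in (square ℓ : Set (ℝ × ℝ)), u z * v z := by
  rw [L2.inner_def]
  refine integral_congr_ae (Eventually.of_forall fun z => ?_)
  simp [mul_comm]

theorem inner_contL2 (u : L2 ℓ) (χ : C(ℝ × ℝ, ℝ)) :
    inner ℝ u (contL2 ℓ χ) = ∫ z in (square ℓ : Set (ℝ × ℝ)), u z * χ z := by
  rw [inner_L2]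
  refine integral_congr_ae ?_
  filter_upwards [coeFn_contL2 (ℓ := ℓ) χ] with z hz
  rw [hz]

theorem integrable_L2_mul (u v : L2 ℓ) :
    Integrable (fun z => u z * v z) (volume.restrict (square ℓ : Set (ℝ × ℝ))) :=
  (Lp.memLp u).integrable_mul (Lp.memLp v)

/-- A test function as a continuous function. -/
def TestFn.toC (φ : TestFn ℓ) : C(ℝ × ℝ, ℝ) := ⟨φ, φ.continuous⟩

theorem TestFn.continuous_pd (j : Fin 2) (φ : TestFn ℓ) : Continuous (pd j φ) :=
  (φ.contDiff.continuous_fderiv (by simp)).clm_apply continuous_const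

/-- The partial derivative of a test function as a continuous function. -/
def TestFn.pdC (j : Fin 2) (φ : TestFn ℓ) : C(ℝ × ℝ, ℝ) := ⟨pd j φ, φ.continuous_pd j⟩

theorem hasWeakDeriv_iff {j : Fin 2} {u v : L2 ℓ} :
    HasWeakDeriv j u v ↔
      ∀ φ : TestFn ℓ, inner ℝ u (contL2 ℓ (φ.pdC j)) = - inner ℝ v (contL2 ℓ φ.toC) := by
  simp only [inner_contL2]
  rfl

theorem setIntegral_square_eq_integral {g : ℝ × ℝ → ℝ} (h : ∀ z ∉ (square ℓ : Set (ℝ × ℝ)), g z = 0) :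
    ∫ z in (square ℓ : Set (ℝ × ℝ)), g z = ∫ z, g z :=
  setIntegral_eq_integral_of_forall_compl_eq_zero h

theorem TestFn.eq_zero (φ : TestFn ℓ) {z : ℝ × ℝ} (hz : z ∉ (square ℓ : Set (ℝ × ℝ))) :
    φ z = 0 :=
  image_eq_zero_of_notMem_tsupport fun h => hz (φ.tsupport_subset h)

theorem TestFn.pd_eq_zero (j : Fin 2) (φ : TestFn ℓ) {z : ℝ × ℝ}
    (hz : z ∉ (square ℓ : Set (ℝ × ℝ))) : pd j φ z = 0 := by
  have h : z ∉ tsupport (fderiv ℝ φ) := fun h =>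
    hz (φ.tsupport_subset (tsupport_fderiv_subset ℝ h))
  simp [pd, image_eq_zero_of_notMem_tsupport h]

theorem TestFn.hasCompactSupport_pd (j : Fin 2) (φ : TestFn ℓ) : HasCompactSupport (pd j φ) :=
  φ.hasCompactSupport.fderiv_apply ℝ (dir j)

/-- `χ'` is the partial derivative `∂_j χ` of the smooth function `χ` on the plane. -/
structure IsPartial (j : Fin 2) (χ χ' : C(ℝ × ℝ, ℝ)) : Prop where
  contDiff : ContDiff ℝ 1 χ
  eq : ∀ z, fderiv ℝ χ z (dir j) = χ' z

theorem integral_pd_mul {j : Fin 2} (φ : TestFn ℓ) {χ χ' : C(ℝ × ℝ, ℝ)} (h : IsPartial j χ χ') :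
    ∫ z in (square ℓ : Set (ℝ × ℝ)), pd j φ z * χ z =
      - ∫ z in (square ℓ : Set (ℝ × ℝ)), φ z * χ' z := by
  rw [setIntegral_square_eq_integral fun z hz => by rw [φ.pd_eq_zero j hz, zero_mul],
    setIntegral_square_eq_integral fun z hz => by rw [φ.eq_zero hz, zero_mul], eq_comm,
    neg_eq_iff_eq_neg]
  have e : ∀ z, χ' z = fderiv ℝ χ z (dir j) := fun z => (h.eq z).symm
  simp only [e]
  refine integral_mul_fderiv_eq_neg_fderiv_mul_of_integrable ?_ ?_ ?_ ?_ ?_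
  · exact ((φ.continuous_pd j).mul χ.continuous).integrable_of_hasCompactSupport
      (φ.hasCompactSupport_pd j).mul_right
  · simp only [h.eq]
    exact (φ.continuous.mul χ'.continuous).integrable_of_hasCompactSupport
      φ.hasCompactSupport.mul_right
  · exact (φ.continuous.mul χ.continuous).integrable_of_hasCompactSupport
      φ.hasCompactSupport.mul_right
  · exact fun z _ => (φ.contDiff.differentiable (by simp)) z
  · exact fun z _ => (h.contDiff.differentiable (by simp)) z

/-- Green's formula against a smooth function `χ` without boundary condition: there is no boundary
term because `u ∈ H¹₀(D)`. -/
theorem inner_grad_contL2 {u : L2 ℓ} {g : L2Vec ℓ} (hu : (u, g) ∈ H10Graph ℓ) {j : Fin 2}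
    {χ χ' : C(ℝ × ℝ, ℝ)} (h : IsPartial j χ χ') :
    inner ℝ (g j) (contL2 ℓ χ) = - inner ℝ u (contL2 ℓ χ') := by
  have hc : IsClosed {p : L2 ℓ × L2Vec ℓ |
      inner ℝ (p.2 j) (contL2 ℓ χ) = - inner ℝ p.1 (contL2 ℓ χ')} := by
    refine isClosed_eq ?_ ?_ <;> fun_prop
  refine hc.closure_subset_iff.2 ?_ hu
  rintro p ⟨φ, h1, h2⟩
  change inner ℝ (p.2 j) (contL2 ℓ χ) = - inner ℝ p.1 (contL2 ℓ χ')
  rw [inner_contL2, inner_contL2, integral_congr_ae (g := fun z => pd j φ z * χ z),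
    integral_pd_mul φ h, integral_congr_ae (f := fun z => p.1 z * χ' z)]
  · filter_upwards [h1] with z hz; rw [hz]
  · filter_upwards [h2 j] with z hz; rw [hz]

theorem TestFn.isPartial (φ : TestFn ℓ) (j : Fin 2) : IsPartial j φ.toC (φ.pdC j) where
  contDiff := φ.contDiff.of_le (by exact_mod_cast le_top)
  eq _ := rfl

theorem hasWeakDeriv_of_mem_H10Graph {u : L2 ℓ} {g : L2Vec ℓ} (hu : (u, g) ∈ H10Graph ℓ)
    (j : Fin 2) : HasWeakDeriv j u (g j) :=
  hasWeakDeriv_iff.2 fun φ => by rw [inner_grad_contL2 hu (φ.isPartial j), neg_neg]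

/-- A classical derivative is a weak one. -/
theorem hasWeakDeriv_contL2 {j : Fin 2} {χ χ' : C(ℝ × ℝ, ℝ)} (h : IsPartial j χ χ') :
    HasWeakDeriv j (contL2 ℓ χ) (contL2 ℓ χ') := by
  refine hasWeakDeriv_iff.2 fun φ => ?_
  rw [real_inner_comm, real_inner_comm (contL2 ℓ φ.toC), inner_contL2, inner_contL2,
    integral_congr_ae (g := fun z => pd j φ z * χ z), integral_pd_mul φ h,
    integral_congr_ae (f := fun z => contL2 ℓ φ.toC z * χ' z)]
  · filter_upwards [coeFn_contL2 (ℓ := ℓ) φ.toC] with z hz; rw [hz]; rfl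
  · filter_upwards [coeFn_contL2 (ℓ := ℓ) (φ.pdC j)] with z hz; rw [hz]; rfl

/-- Green's formula for a weakly differentiable `u` against an element `w` of `H¹₀(D)`. -/
theorem inner_grad_eq_neg_inner {j : Fin 2} {u v : L2 ℓ} (h : HasWeakDeriv j u v) {w : L2 ℓ}
    {gw : L2Vec ℓ} (hw : (w, gw) ∈ H10Graph ℓ) : inner ℝ u (gw j) = - inner ℝ v w := by
  have hc : IsClosed {p : L2 ℓ × L2Vec ℓ | inner ℝ u (p.2 j) = - inner ℝ v p.1} := by
    refine isClosed_eq ?_ ?_ <;> fun_prop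
  refine hc.closure_subset_iff.2 ?_ hw
  rintro p ⟨φ, h1, h2⟩
  have e1 : p.1 = contL2 ℓ φ.toC := Lp.ext (h1.trans (coeFn_contL2 φ.toC).symm)
  have e2 : p.2 j = contL2 ℓ (φ.pdC j) := Lp.ext ((h2 j).trans (coeFn_contL2 (φ.pdC j)).symm)
  change inner ℝ u (p.2 j) = - inner ℝ v p.1
  rw [e1, e2]
  exact hasWeakDeriv_iff.1 h φ

theorem HasWeakDeriv.sub {j : Fin 2} {u v u' v' : L2 ℓ} (h : HasWeakDeriv j u v)
    (h' : HasWeakDeriv j u' v') : HasWeakDeriv j (u - u') (v - v') := by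
  rw [hasWeakDeriv_iff] at *
  intro φ
  rw [inner_sub_left, inner_sub_left, h, h']
  ring

theorem HasWeakDeriv.smul {j : Fin 2} {u v : L2 ℓ} (c : ℝ) (h : HasWeakDeriv j u v) :
    HasWeakDeriv j (c • u) (c • v) := by
  rw [hasWeakDeriv_iff] at *
  intro φ
  rw [real_inner_smul_left, real_inner_smul_left, h]
  ring

theorem HasWeakDeriv.hasSum {ι : Type*} {j : Fin 2} {u v : ι → L2 ℓ} {U V : L2 ℓ}
    (h : ∀ i, HasWeakDeriv j (u i) (v i)) (hu : HasSum u U) (hv : HasSum v V) :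
    HasWeakDeriv j U V := by
  simp only [hasWeakDeriv_iff] at *
  intro φ
  have h1 := (hu.mapL (innerSL ℝ (contL2 ℓ (φ.pdC j))))
  have h2 := (hv.mapL (innerSL ℝ (contL2 ℓ φ.toC))).neg
  simp only [innerSL_apply_apply, real_inner_comm] at h1 h2
  simp only [h] at h1
  exact h1.unique h2

/-- A function in `L²(D)` that is orthogonal to all test functions vanishes. -/
theorem eq_zero_of_inner_testFn {v : L2 ℓ} (h : ∀ φ : TestFn ℓ, inner ℝ v (contL2 ℓ φ.toC) = 0) :
    v = 0 := by
  have hl : LocallyIntegrableOn v (square ℓ : Set (ℝ × ℝ)) volume := by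
    refine IntegrableOn.locallyIntegrableOn ?_
    exact (Lp.memLp v).integrable (by norm_num)
  have := (square ℓ).isOpen.ae_eq_zero_of_integral_contDiff_smul_eq_zero (μ := volume) hl ?_
  · refine Lp.ext ?_
    filter_upwards [(ae_restrict_iff' (measurableSet_square ℓ)).2 this,
      Lp.coeFn_zero ℝ 2 (volume.restrict (square ℓ : Set (ℝ × ℝ)))] with z h1 h2
    rw [h1, h2]; rfl
  · intro g hg1 hg2 hg3
    have := h ⟨g, hg1, hg2, hg3⟩
    rw [inner_contL2, setIntegral_square_eq_integral fun z hz => ?_] at this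
    · rw [← this]
      refine integral_congr_ae (Eventually.of_forall fun z => ?_)
      exact mul_comm _ _
    · exact mul_eq_zero_of_right _ (TestFn.eq_zero (⟨g, hg1, hg2, hg3⟩ : TestFn ℓ) hz)

theorem HasWeakDeriv.unique {j : Fin 2} {u v v' : L2 ℓ} (h : HasWeakDeriv j u v)
    (h' : HasWeakDeriv j u v') : v = v' := by
  rw [← sub_eq_zero]
  refine eq_zero_of_inner_testFn fun φ => ?_
  have := hasWeakDeriv_iff.1 (h.sub h') φ
  rw [sub_self, inner_zero_left] at this
  linarith

end Square

/-! ### The trigonometric system of the square -/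

section Trig

/-- The frequency `(m + 1) π / ℓ`. -/
def freq (ℓ : ℝ) (m : ℕ) : ℝ := (m + 1) * Real.pi / ℓ

/-- The function `x ↦ sin ((m + 1) π x / ℓ)`. -/
def sinC (ℓ : ℝ) (m : ℕ) : C(ℝ, ℝ) := ⟨fun x => Real.sin (freq ℓ m * x), by fun_prop⟩

/-- The function `x ↦ cos ((m + 1) π x / ℓ)`. -/
def cosC (ℓ : ℝ) (m : ℕ) : C(ℝ, ℝ) := ⟨fun x => Real.cos (freq ℓ m * x), by fun_prop⟩

/-- The function `(x, y) ↦ (2 / ℓ) f(x) g(y)`; the factor `2 / ℓ` normalizes products of sines and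
cosines in `L²(D)`. -/
def prodC (ℓ : ℝ) (f g : C(ℝ, ℝ)) : C(ℝ × ℝ, ℝ) :=
  ⟨fun z => 2 / ℓ * (f z.1 * g z.2), by fun_prop⟩

variable {ℓ : ℝ}

theorem freq_pos (hℓ : 0 < ℓ) (m : ℕ) : 0 < freq ℓ m := by
  have := Real.pi_pos
  unfold freq
  positivity

theorem integral_cos_int_mul (hℓ : 0 < ℓ) (n : ℤ) :
    ∫ x in (0 : ℝ)..ℓ, Real.cos (n * Real.pi / ℓ * x) = if n = 0 then ℓ else 0 := by
  split_ifs with h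
  · simp [h]
  · have hn : (n : ℝ) * Real.pi / ℓ ≠ 0 := by
      have : (n : ℝ) ≠ 0 := by exact_mod_cast h
      have := Real.pi_ne_zero
      positivity
    rw [intervalIntegral.integral_comp_mul_left (fun x => Real.cos x) hn, integral_cos,
      div_mul_cancel₀ _ hℓ.ne', Real.sin_int_mul_pi]
    simp

theorem integral_sinC_mul_sinC (hℓ : 0 < ℓ) (m n : ℕ) :
    ∫ x in Ioo 0 ℓ, sinC ℓ m x * sinC ℓ n x = if m = n then ℓ / 2 else 0 := by
  rw [← integral_Ioc_eq_integral_Ioo, ← intervalIntegral.integral_of_le hℓ.le]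
  have e : ∀ x, sinC ℓ m x * sinC ℓ n x =
      (Real.cos (((m - n : ℤ) : ℝ) * Real.pi / ℓ * x)
        - Real.cos (((m + n + 2 : ℤ) : ℝ) * Real.pi / ℓ * x)) / 2 := by
    intro x
    have h1 : ((m - n : ℤ) : ℝ) * Real.pi / ℓ * x = freq ℓ m * x - freq ℓ n * x := by
      simp only [freq]; push_cast; ring
    have h2 : ((m + n + 2 : ℤ) : ℝ) * Real.pi / ℓ * x = freq ℓ m * x + freq ℓ n * x := by
      simp only [freq]; push_cast; ring
    rw [h1, h2, Real.cos_sub, Real.cos_add]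
    simp only [sinC, ContinuousMap.coe_mk]
    ring
  simp only [e]
  rw [intervalIntegral.integral_div, intervalIntegral.integral_sub, integral_cos_int_mul hℓ,
    integral_cos_int_mul hℓ, if_neg (by omega : ¬ ((m : ℤ) + n + 2 = 0))]
  · rcases eq_or_ne m n with h | h
    · simp [h]
    · rw [if_neg (by omega), if_neg h]; simp
  all_goals exact Continuous.intervalIntegrable (by fun_prop) _ _

theorem integral_cosC_mul_cosC (hℓ : 0 < ℓ) (m n : ℕ) :
    ∫ x in Ioo 0 ℓ, cosC ℓ m x * cosC ℓ n x = if m = n then ℓ / 2 else 0 := by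
  rw [← integral_Ioc_eq_integral_Ioo, ← intervalIntegral.integral_of_le hℓ.le]
  have e : ∀ x, cosC ℓ m x * cosC ℓ n x =
      (Real.cos (((m - n : ℤ) : ℝ) * Real.pi / ℓ * x)
        + Real.cos (((m + n + 2 : ℤ) : ℝ) * Real.pi / ℓ * x)) / 2 := by
    intro x
    have h1 : ((m - n : ℤ) : ℝ) * Real.pi / ℓ * x = freq ℓ m * x - freq ℓ n * x := by
      simp only [freq]; push_cast; ring
    have h2 : ((m + n + 2 : ℤ) : ℝ) * Real.pi / ℓ * x = freq ℓ m * x + freq ℓ n * x := by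
      simp only [freq]; push_cast; ring
    rw [h1, h2, Real.cos_sub, Real.cos_add]
    simp only [cosC, ContinuousMap.coe_mk]
    ring
  simp only [e]
  rw [intervalIntegral.integral_div, intervalIntegral.integral_add, integral_cos_int_mul hℓ,
    integral_cos_int_mul hℓ, if_neg (by omega : ¬ ((m : ℤ) + n + 2 = 0))]
  · rcases eq_or_ne m n with h | h
    · simp [h]
    · rw [if_neg (by omega), if_neg h]; simp
  all_goals exact Continuous.intervalIntegrable (by fun_prop) _ _

theorem orthonormal_prodC (hℓ : 0 < ℓ) {f g : ℕ → C(ℝ, ℝ)}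
    (hf : ∀ m n, ∫ x in Ioo 0 ℓ, f m x * f n x = if m = n then ℓ / 2 else 0)
    (hg : ∀ m n, ∫ x in Ioo 0 ℓ, g m x * g n x = if m = n then ℓ / 2 else 0) :
    Orthonormal ℝ (fun k : ℕ × ℕ => contL2 ℓ (prodC ℓ (f k.1) (g k.2))) := by
  rw [orthonormal_iff_ite]
  rintro ⟨m, n⟩ ⟨m', n'⟩
  rw [inner_contL2, integral_congr_ae
    (g := fun z => (4 / ℓ ^ 2 * (f m z.1 * f m' z.1)) * (g n z.2 * g n' z.2))]
  · change ∫ z in (Ioo 0 ℓ ×ˢ Ioo 0 ℓ : Set (ℝ × ℝ)), _ = _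
    rw [Measure.volume_eq_prod, ← Measure.prod_restrict,
      integral_prod_mul (fun x => 4 / ℓ ^ 2 * (f m x * f m' x)) (fun y => g n y * g n' y),
      integral_const_mul, hf, hg]
    by_cases h1 : m = m' <;> by_cases h2 : n = n' <;> simp [h1, h2]
    field_simp
    norm_num
  · filter_upwards [coeFn_contL2 (ℓ := ℓ) (prodC ℓ (f m) (g n))] with z hz
    rw [hz]
    simp only [prodC, ContinuousMap.coe_mk]
    ring

/-- The eigenfunction `(2/ℓ) sin ((m+1)πx/ℓ) sin ((n+1)πy/ℓ)` of the Dirichlet Laplacian, for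
`k = (m, n)`. -/
def eC (ℓ : ℝ) (k : ℕ × ℕ) : C(ℝ × ℝ, ℝ) := prodC ℓ (sinC ℓ k.1) (sinC ℓ k.2)

/-- The normalized partial derivative `∂_j` of the eigenfunction `eC ℓ k`. -/
def gC (ℓ : ℝ) (j : Fin 2) (k : ℕ × ℕ) : C(ℝ × ℝ, ℝ) :=
  if j = 0 then prodC ℓ (cosC ℓ k.1) (sinC ℓ k.2) else prodC ℓ (sinC ℓ k.1) (cosC ℓ k.2)

/-- The normalized mixed derivative of the eigenfunction `eC ℓ k`. -/
def ccC (ℓ : ℝ) (k : ℕ × ℕ) : C(ℝ × ℝ, ℝ) := prodC ℓ (cosC ℓ k.1) (cosC ℓ k.2)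

/-- The frequency of the eigenfunction `eC ℓ k` in the direction `j`. -/
def kfreq (ℓ : ℝ) (j : Fin 2) (k : ℕ × ℕ) : ℝ := if j = 0 then freq ℓ k.1 else freq ℓ k.2

/-- The eigenvalue of the Dirichlet Laplacian `-Δ` for the eigenfunction `eC ℓ k`. -/
def eig (ℓ : ℝ) (k : ℕ × ℕ) : ℝ := kfreq ℓ 0 k ^ 2 + kfreq ℓ 1 k ^ 2

theorem kfreq_pos (hℓ : 0 < ℓ) (j : Fin 2) (k : ℕ × ℕ) : 0 < kfreq ℓ j k := by
  unfold kfreq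
  split_ifs <;> exact freq_pos hℓ _

theorem eig_pos (hℓ : 0 < ℓ) (k : ℕ × ℕ) : 0 < eig ℓ k := by
  have := kfreq_pos hℓ 0 k
  unfold eig
  positivity

theorem orthonormal_e (hℓ : 0 < ℓ) : Orthonormal ℝ (fun k => contL2 ℓ (eC ℓ k)) :=
  orthonormal_prodC hℓ (integral_sinC_mul_sinC hℓ) (integral_sinC_mul_sinC hℓ)

theorem orthonormal_g (hℓ : 0 < ℓ) (j : Fin 2) : Orthonormal ℝ (fun k => contL2 ℓ (gC ℓ j k)) := by
  unfold gC
  split_ifs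
  · exact orthonormal_prodC hℓ (integral_cosC_mul_cosC hℓ) (integral_sinC_mul_sinC hℓ)
  · exact orthonormal_prodC hℓ (integral_sinC_mul_sinC hℓ) (integral_cosC_mul_cosC hℓ)

theorem orthonormal_cc (hℓ : 0 < ℓ) : Orthonormal ℝ (fun k => contL2 ℓ (ccC ℓ k)) :=
  orthonormal_prodC hℓ (integral_cosC_mul_cosC hℓ) (integral_cosC_mul_cosC hℓ)

theorem abs_eC_le (hℓ : 0 < ℓ) (k : ℕ × ℕ) (z : ℝ × ℝ) : |eC ℓ k z| ≤ 2 / ℓ := by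
  simp only [eC, prodC, sinC, ContinuousMap.coe_mk]
  rw [abs_mul, abs_mul, abs_of_pos (by positivity)]
  refine mul_le_of_le_one_right (by positivity) ?_
  exact mul_le_one₀ (Real.abs_sin_le_one _) (abs_nonneg _) (Real.abs_sin_le_one _)

/-! #### Partial derivatives of the trigonometric functions -/

theorem contDiff_sinC (m : ℕ) {n : WithTop ℕ∞} : ContDiff ℝ n (sinC ℓ m) := by
  change ContDiff ℝ n fun x => Real.sin (freq ℓ m * x)
  fun_prop

theorem contDiff_cosC (m : ℕ) {n : WithTop ℕ∞} : ContDiff ℝ n (cosC ℓ m) := by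
  change ContDiff ℝ n fun x => Real.cos (freq ℓ m * x)
  fun_prop

theorem contDiff_prodC {n : WithTop ℕ∞} {f g : C(ℝ, ℝ)} (hf : ContDiff ℝ n f)
    (hg : ContDiff ℝ n g) : ContDiff ℝ n (prodC ℓ f g) := by
  change ContDiff ℝ n fun z : ℝ × ℝ => 2 / ℓ * (f z.1 * g z.2)
  exact contDiff_const.mul ((hf.comp contDiff_fst).mul (hg.comp contDiff_snd))

theorem contDiff_eC {n : WithTop ℕ∞} (k : ℕ × ℕ) : ContDiff ℝ n (eC ℓ k) :=
  contDiff_prodC (contDiff_sinC _) (contDiff_sinC _)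

theorem hasDerivAt_sinC (m : ℕ) (x : ℝ) : HasDerivAt (sinC ℓ m) (freq ℓ m * cosC ℓ m x) x := by
  have h := ((hasDerivAt_id x).const_mul (freq ℓ m)).sin
  have e : freq ℓ m * cosC ℓ m x = Real.cos (freq ℓ m * id x) * (freq ℓ m * 1) := by
    simp only [cosC, ContinuousMap.coe_mk, id]
    ring
  rw [e]
  exact h

theorem hasDerivAt_cosC (m : ℕ) (x : ℝ) : HasDerivAt (cosC ℓ m) (-freq ℓ m * sinC ℓ m x) x := by
  have h := ((hasDerivAt_id x).const_mul (freq ℓ m)).cos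
  have e : -freq ℓ m * sinC ℓ m x = -Real.sin (freq ℓ m * id x) * (freq ℓ m * 1) := by
    simp only [sinC, ContinuousMap.coe_mk, id]
    ring
  rw [e]
  exact h

theorem isPartial_prodC_zero {f f' g : C(ℝ, ℝ)} {c : ℝ} (hf : ContDiff ℝ 1 f) (hg : ContDiff ℝ 1 g)
    (h : ∀ x, HasDerivAt f (c * f' x) x) : IsPartial 0 (prodC ℓ f g) (c • prodC ℓ f' g) where
  contDiff := contDiff_prodC hf hg
  eq z := by
    have hg' : DifferentiableAt ℝ g z.2 := hg.differentiable (by simp) z.2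
    have h1 : HasFDerivAt (fun z : ℝ × ℝ => f z.1) _ z := (h z.1).hasFDerivAt.comp z hasFDerivAt_fst
    have h2 : HasFDerivAt (fun z : ℝ × ℝ => g z.2) _ z := hg'.hasFDerivAt.comp z hasFDerivAt_snd
    have h3 := ((h1.mul h2).const_mul (2 / ℓ)).fderiv
    change fderiv ℝ (fun z : ℝ × ℝ => 2 / ℓ * (f z.1 * g z.2)) z = _ at h3
    change fderiv ℝ (fun z : ℝ × ℝ => 2 / ℓ * (f z.1 * g z.2)) z _ = _
    rw [h3]
    simp [dir, prodC]
    ring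

theorem isPartial_prodC_one {f g g' : C(ℝ, ℝ)} {c : ℝ} (hf : ContDiff ℝ 1 f) (hg : ContDiff ℝ 1 g)
    (h : ∀ x, HasDerivAt g (c * g' x) x) : IsPartial 1 (prodC ℓ f g) (c • prodC ℓ f g') where
  contDiff := contDiff_prodC hf hg
  eq z := by
    have hf' : DifferentiableAt ℝ f z.1 := hf.differentiable (by simp) z.1
    have h1 : HasFDerivAt (fun z : ℝ × ℝ => g z.2) _ z := (h z.2).hasFDerivAt.comp z hasFDerivAt_snd
    have h2 : HasFDerivAt (fun z : ℝ × ℝ => f z.1) _ z := hf'.hasFDerivAt.comp z hasFDerivAt_fst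
    have h3 := ((h2.mul h1).const_mul (2 / ℓ)).fderiv
    change fderiv ℝ (fun z : ℝ × ℝ => 2 / ℓ * (f z.1 * g z.2)) z = _ at h3
    change fderiv ℝ (fun z : ℝ × ℝ => 2 / ℓ * (f z.1 * g z.2)) z _ = _
    rw [h3]
    simp [dir, prodC]
    ring

theorem isPartial_eC (j : Fin 2) (k : ℕ × ℕ) :
    IsPartial j (eC ℓ k) (kfreq ℓ j k • gC ℓ j k) := by
  fin_cases j
  · exact isPartial_prodC_zero (contDiff_sinC _) (contDiff_sinC _) (hasDerivAt_sinC _)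
  · exact isPartial_prodC_one (contDiff_sinC _) (contDiff_sinC _) (hasDerivAt_sinC _)

theorem isPartial_gC_self (j : Fin 2) (k : ℕ × ℕ) :
    IsPartial j (gC ℓ j k) (-kfreq ℓ j k • eC ℓ k) := by
  fin_cases j
  · exact isPartial_prodC_zero (contDiff_cosC _) (contDiff_sinC _) (hasDerivAt_cosC _)
  · exact isPartial_prodC_one (contDiff_sinC _) (contDiff_cosC _) (hasDerivAt_cosC _)

theorem isPartial_gC_of_ne {i j : Fin 2} (h : i ≠ j) (k : ℕ × ℕ) :
    IsPartial j (gC ℓ i k) (kfreq ℓ j k • ccC ℓ k) := by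
  fin_cases i <;> fin_cases j
  · exact absurd rfl h
  · exact isPartial_prodC_one (contDiff_cosC _) (contDiff_sinC _) (hasDerivAt_sinC _)
  · exact isPartial_prodC_zero (contDiff_sinC _) (contDiff_cosC _) (hasDerivAt_sinC _)
  · exact absurd rfl h

/-! #### Completeness of the eigenfunctions -/

theorem norm_contL2_le {χ : C(ℝ × ℝ, ℝ)} {C : ℝ}
    (h : ∀ z ∈ (square ℓ : Set (ℝ × ℝ)), |χ z| ≤ C) :
    ‖contL2 ℓ χ‖ ≤ (measureUnivNNReal
      ((volume : Measure (ℝ × ℝ)).restrict (square ℓ : Set (ℝ × ℝ))) : ℝ) ^ (2 : ℝ)⁻¹ * max C 0 := by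
  have := Lp.norm_le_of_ae_bound (f := contL2 ℓ χ) (C := max C 0) (le_max_right _ _) ?_
  · simpa using this
  · filter_upwards [coeFn_contL2 (ℓ := ℓ) χ, ae_square h] with z h1 h2
    rw [h1]
    exact h2.trans (le_max_left _ _)

/-- The subalgebra generated by `cos (πx/ℓ)` and `cos (πy/ℓ)`. -/
def cosAlgebra (ℓ : ℝ) : Subalgebra ℝ C(ℝ × ℝ, ℝ) :=
  Algebra.adjoin ℝ {(cosC ℓ 0).comp ⟨Prod.fst, continuous_fst⟩,
    (cosC ℓ 0).comp ⟨Prod.snd, continuous_snd⟩}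

theorem cos_mul_sinC (m : ℕ) (x : ℝ) :
    cosC ℓ 0 x * sinC ℓ (m + 1) x = (1 / 2) * (sinC ℓ (m + 2) x + sinC ℓ m x) := by
  have h1 : freq ℓ (m + 2) * x = freq ℓ (m + 1) * x + freq ℓ 0 * x := by
    simp only [freq]; push_cast; ring
  have h2 : freq ℓ m * x = freq ℓ (m + 1) * x - freq ℓ 0 * x := by
    simp only [freq]; push_cast; ring
  simp only [sinC, cosC, ContinuousMap.coe_mk]
  rw [h1, h2, Real.sin_add, Real.sin_sub]
  ring

theorem cos_mul_sinC_zero (x : ℝ) :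
    cosC ℓ 0 x * sinC ℓ 0 x = (1 / 2) * sinC ℓ 1 x := by
  have h1 : freq ℓ 1 * x = 2 * (freq ℓ 0 * x) := by
    simp only [freq]; push_cast; ring
  simp only [sinC, cosC, ContinuousMap.coe_mk]
  rw [h1, Real.sin_two_mul]
  ring

/-- Multiplication with `cos (πx/ℓ)` or `cos (πy/ℓ)` raises and lowers the frequency of a sine,
so that the span of the eigenfunctions is a module over `cosAlgebra ℓ`. -/
theorem cosAlgebra_mul_mem {a : C(ℝ × ℝ, ℝ)} (ha : a ∈ cosAlgebra ℓ) :
    ∀ s ∈ Submodule.span ℝ (range (eC ℓ)), a * s ∈ Submodule.span ℝ (range (eC ℓ)) := by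
  have he : ∀ k, eC ℓ k ∈ Submodule.span ℝ (range (eC ℓ)) := fun k =>
    Submodule.subset_span ⟨k, rfl⟩
  induction ha using Algebra.adjoin_induction with
  | mem c hc =>
    intro s hs
    induction hs using Submodule.span_induction with
    | mem s hs =>
      obtain ⟨⟨m, n⟩, rfl⟩ := hs
      rcases hc with rfl | rfl
      -- The lowest sine is raised only: `sin 0` is not among the sines.
      · rcases m with _ | m
        · have : (cosC ℓ 0).comp ⟨Prod.fst, continuous_fst⟩ * eC ℓ (0, n)
              = (1 / 2 : ℝ) • eC ℓ (1, n) := by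
            ext z
            have := cos_mul_sinC_zero (ℓ := ℓ) z.1
            simp only [eC, prodC, ContinuousMap.mul_apply, ContinuousMap.comp_apply,
              ContinuousMap.coe_mk, ContinuousMap.smul_apply, smul_eq_mul]
            linear_combination (2 / ℓ * sinC ℓ n z.2) * this
          rw [this]
          exact Submodule.smul_mem _ _ (he _)
        · have : (cosC ℓ 0).comp ⟨Prod.fst, continuous_fst⟩ * eC ℓ (m + 1, n)
              = (1 / 2 : ℝ) • (eC ℓ (m + 2, n) + eC ℓ (m, n)) := by
            ext z
            have := cos_mul_sinC (ℓ := ℓ) m z.1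
            simp only [eC, prodC, ContinuousMap.mul_apply, ContinuousMap.comp_apply,
              ContinuousMap.coe_mk, ContinuousMap.smul_apply, smul_eq_mul, ContinuousMap.add_apply]
            linear_combination (2 / ℓ * sinC ℓ n z.2) * this
          rw [this]
          exact Submodule.smul_mem _ _ (Submodule.add_mem _ (he _) (he _))
      · rcases n with _ | n
        · have : (cosC ℓ 0).comp ⟨Prod.snd, continuous_snd⟩ * eC ℓ (m, 0)
              = (1 / 2 : ℝ) • eC ℓ (m, 1) := by
            ext z
            have := cos_mul_sinC_zero (ℓ := ℓ) z.2
            simp only [eC, prodC, ContinuousMap.mul_apply, ContinuousMap.comp_apply,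
              ContinuousMap.coe_mk, ContinuousMap.smul_apply, smul_eq_mul]
            linear_combination (2 / ℓ * sinC ℓ m z.1) * this
          rw [this]
          exact Submodule.smul_mem _ _ (he _)
        · have : (cosC ℓ 0).comp ⟨Prod.snd, continuous_snd⟩ * eC ℓ (m, n + 1)
              = (1 / 2 : ℝ) • (eC ℓ (m, n + 2) + eC ℓ (m, n)) := by
            ext z
            have := cos_mul_sinC (ℓ := ℓ) n z.2
            simp only [eC, prodC, ContinuousMap.mul_apply, ContinuousMap.comp_apply,
              ContinuousMap.coe_mk, ContinuousMap.smul_apply, smul_eq_mul, ContinuousMap.add_apply]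
            linear_combination (2 / ℓ * sinC ℓ m z.1) * this
          rw [this]
          exact Submodule.smul_mem _ _ (Submodule.add_mem _ (he _) (he _))
    | zero => rw [mul_zero]; exact Submodule.zero_mem _
    | add x y _ _ hx hy => rw [mul_add]; exact Submodule.add_mem _ hx hy
    | smul r x _ hx => rw [mul_smul_comm]; exact Submodule.smul_mem _ _ hx
  | algebraMap r =>
    intro s hs
    rw [← Algebra.smul_def]
    exact Submodule.smul_mem _ _ hs
  | add x y _ _ hx hy =>
    intro s hs
    rw [add_mul]
    exact Submodule.add_mem _ (hx s hs) (hy s hs)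
  | mul x y _ _ hx hy =>
    intro s hs
    rw [mul_assoc]
    exact hx _ (hy s hs)

/-- By the theorem of Stone and Weierstrass: the cosine of lowest frequency is injective on `[0, ℓ]`,
so that `cos (πx/ℓ)` and `cos (πy/ℓ)` separate the points of the closed square. -/
theorem exists_cosAlgebra_approx (hℓ : 0 < ℓ) (F : C(ℝ × ℝ, ℝ)) {ε : ℝ} (hε : 0 < ε) :
    ∃ a ∈ cosAlgebra ℓ, ∀ z ∈ (square ℓ : Set (ℝ × ℝ)), |F z - a z| ≤ ε := by
  let K : Set (ℝ × ℝ) := Icc 0 ℓ ×ˢ Icc 0 ℓ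
  have : CompactSpace K := isCompact_iff_compactSpace.1 (isCompact_closedSquare ℓ)
  let res : C(ℝ × ℝ, ℝ) →ₐ[ℝ] C(K, ℝ) :=
    ContinuousMap.compRightAlgHom ℝ ℝ ⟨Subtype.val, continuous_subtype_val⟩
  have hinj : ∀ x ∈ Icc (0 : ℝ) ℓ, ∀ y ∈ Icc (0 : ℝ) ℓ, cosC ℓ 0 x = cosC ℓ 0 y → x = y := by
    intro x hx y hy h
    have hp := Real.pi_pos
    have key : ∀ t ∈ Icc (0 : ℝ) ℓ, freq ℓ 0 * t ∈ Icc 0 Real.pi := by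
      intro t ht
      have : freq ℓ 0 * t = Real.pi * (t / ℓ) := by simp only [freq]; push_cast; ring
      rw [this]
      have h1 : t / ℓ ≤ 1 := (div_le_one hℓ).2 ht.2
      have h2 : 0 ≤ t / ℓ := div_nonneg ht.1 hℓ.le
      exact ⟨by positivity, mul_le_of_le_one_right hp.le h1⟩
    exact mul_left_cancel₀ (freq_pos hℓ 0).ne' (Real.injOn_cos (key x hx) (key y hy) h)
  have hsep : ((cosAlgebra ℓ).map res).SeparatesPoints := by
    intro z w hzw
    by_contra hcon
    push Not at hcon
    apply hzw
    have h1 : cosC ℓ 0 z.1.1 = cosC ℓ 0 w.1.1 :=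
      hcon _ ⟨_, ⟨(cosC ℓ 0).comp ⟨Prod.fst, continuous_fst⟩,
        Algebra.subset_adjoin (Or.inl rfl), rfl⟩, rfl⟩
    have h2 : cosC ℓ 0 z.1.2 = cosC ℓ 0 w.1.2 :=
      hcon _ ⟨_, ⟨(cosC ℓ 0).comp ⟨Prod.snd, continuous_snd⟩,
        Algebra.subset_adjoin (Or.inr rfl), rfl⟩, rfl⟩
    exact Subtype.ext (Prod.ext (hinj _ z.2.1 _ w.2.1 h1) (hinj _ z.2.2 _ w.2.2 h2))
  have htop := ContinuousMap.subalgebra_topologicalClosure_eq_top_of_separatesPoints _ hsep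
  have hF : res F ∈ ((cosAlgebra ℓ).map res).topologicalClosure := by rw [htop]; trivial
  obtain ⟨_, ⟨a, ha, rfl⟩, hd⟩ := Metric.mem_closure_iff.1 hF ε hε
  refine ⟨a, ha, fun z hz => ?_⟩
  have := ContinuousMap.dist_apply_le_dist (f := res F) (g := res a) ⟨z, square_subset_Icc ℓ hz⟩
  exact this.trans hd.le

theorem sinC_zero_pos (hℓ : 0 < ℓ) {x : ℝ} (hx : x ∈ Ioo 0 ℓ) : 0 < sinC ℓ 0 x := by
  have : freq ℓ 0 * x = Real.pi * (x / ℓ) := by simp only [freq]; push_cast; ring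
  simp only [sinC, ContinuousMap.coe_mk, this]
  have h1 : x / ℓ < 1 := (div_lt_one hℓ).2 hx.2
  have h2 : 0 < x / ℓ := div_pos hx.1 hℓ
  have := Real.pi_pos
  exact Real.sin_pos_of_pos_of_lt_pi (by positivity) (mul_lt_of_lt_one_right this h1)

theorem eC_zero_pos (hℓ : 0 < ℓ) {z : ℝ × ℝ} (hz : z ∈ (square ℓ : Set (ℝ × ℝ))) :
    0 < eC ℓ (0, 0) z := by
  have h1 := sinC_zero_pos hℓ hz.1
  have h2 := sinC_zero_pos hℓ hz.2
  change 0 < 2 / ℓ * (sinC ℓ 0 z.1 * sinC ℓ 0 z.2)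
  positivity

/-- A test function is `e₀` times a continuous function, which is uniformly close to a polynomial
in `cos (πx/ℓ)` and `cos (πy/ℓ)`; so it is uniformly close to the span of the eigenfunctions. -/
theorem inner_testFn_eq_zero (hℓ : 0 < ℓ) {v : L2 ℓ}
    (hv : ∀ k, inner ℝ (contL2 ℓ (eC ℓ k)) v = 0) (φ : TestFn ℓ) :
    inner ℝ v (contL2 ℓ φ.toC) = 0 := by
  have hspan : ∀ s ∈ Submodule.span ℝ (range (eC ℓ)), inner ℝ v (contL2 ℓ s) = 0 := by
    intro s hs
    induction hs using Submodule.span_induction with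
    | mem s hs => obtain ⟨k, rfl⟩ := hs; rw [real_inner_comm, hv k]
    | zero =>
      have : contL2 ℓ 0 = 0 := by simpa using contL2_smul (ℓ := ℓ) 0 0
      rw [this, inner_zero_right]
    | add x y _ _ hx hy => rw [contL2_add, inner_add_right, hx, hy, add_zero]
    | smul r x _ hx => rw [contL2_smul, inner_smul_right, hx, mul_zero]
  -- The quotient vanishes near each point outside `D`, whatever the zeros of `e₀` are there.
  have hc : Continuous fun z => φ z / eC ℓ (0, 0) z := by
    refine continuous_iff_continuousAt.2 fun z => ?_
    by_cases hz : z ∈ (square ℓ : Set (ℝ × ℝ))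
    · exact φ.continuous.continuousAt.div (eC ℓ (0, 0)).continuous.continuousAt
        (eC_zero_pos hℓ hz).ne'
    · have hz' : z ∉ tsupport φ := fun h => hz (φ.tsupport_subset h)
      have : (fun z => φ z / eC ℓ (0, 0) z) =ᶠ[𝓝 z] fun _ => 0 := by
        filter_upwards [notMem_tsupport_iff_eventuallyEq.1 hz'] with w hw
        rw [hw]; simp
      exact continuousAt_const.congr this.symm
  set c : ℝ := (measureUnivNNReal
      ((volume : Measure (ℝ × ℝ)).restrict (square ℓ : Set (ℝ × ℝ))) : ℝ) ^ (2 : ℝ)⁻¹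
  have hbound : ∀ ε > 0, |inner ℝ v (contL2 ℓ φ.toC)| ≤ (‖v‖ * (c * (2 / ℓ))) * ε := by
    intro ε hε
    obtain ⟨a, ha, hac⟩ := exists_cosAlgebra_approx hℓ ⟨_, hc⟩ hε
    have h0 := hspan _ (cosAlgebra_mul_mem ha _ (Submodule.subset_span ⟨(0, 0), rfl⟩))
    have h1 : contL2 ℓ φ.toC = contL2 ℓ (a * eC ℓ (0, 0))
        + contL2 ℓ (φ.toC - a * eC ℓ (0, 0)) := by
      rw [← contL2_add]; congr 1; abel
    rw [h1, inner_add_right, h0, zero_add]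
    refine (abs_real_inner_le_norm _ _).trans ?_
    have h2 : ∀ z ∈ (square ℓ : Set (ℝ × ℝ)), |(φ.toC - a * eC ℓ (0, 0)) z| ≤ 2 / ℓ * ε := by
      intro z hz
      have hp := eC_zero_pos hℓ hz
      have : (φ.toC - a * eC ℓ (0, 0)) z
          = eC ℓ (0, 0) z * (φ z / eC ℓ (0, 0) z - a z) := by
        simp only [ContinuousMap.sub_apply, ContinuousMap.mul_apply, TestFn.toC,
          ContinuousMap.coe_mk]
        field_simp
      rw [this, abs_mul]
      exact mul_le_mul (abs_eC_le hℓ _ _) (hac z hz) (abs_nonneg _) (by positivity)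
    have h3 := norm_contL2_le h2
    rw [max_eq_left (by positivity)] at h3
    calc ‖v‖ * _ ≤ ‖v‖ * (c * (2 / ℓ * ε)) := by gcongr
      _ = _ := by ring
  by_contra hne
  have hpos : 0 < |inner ℝ v (contL2 ℓ φ.toC)| := abs_pos.2 hne
  set C := ‖v‖ * (c * (2 / ℓ)) with hC
  have hC0 : 0 ≤ C := by positivity
  have := hbound (|inner ℝ v (contL2 ℓ φ.toC)| / (2 * (C + 1))) (by positivity)
  have h4 : C * (|inner ℝ v (contL2 ℓ φ.toC)| / (2 * (C + 1)))
      ≤ |inner ℝ v (contL2 ℓ φ.toC)| / 2 := by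
    rw [mul_div_assoc', div_le_div_iff₀ (by positivity) (by positivity)]
    nlinarith
  linarith

/-- The Hilbert basis of `L²(D)` consisting of the eigenfunctions of the Dirichlet Laplacian. -/
def eBasis (hℓ : 0 < ℓ) : HilbertBasis (ℕ × ℕ) ℝ (L2 ℓ) :=
  HilbertBasis.mkOfOrthogonalEqBot (orthonormal_e hℓ) <| by
    rw [Submodule.eq_bot_iff]
    intro v hv
    refine eq_zero_of_inner_testFn fun φ => inner_testFn_eq_zero hℓ (fun k => ?_) φ
    exact (Submodule.mem_orthogonal _ _).1 hv _ (Submodule.subset_span ⟨k, rfl⟩)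

theorem eBasis_apply (hℓ : 0 < ℓ) (k : ℕ × ℕ) : eBasis hℓ k = contL2 ℓ (eC ℓ k) := by
  simp [eBasis]

end Trig

/-! ### The eigenfunctions satisfy the boundary condition -/

section Cutoff

variable {ℓ : ℝ}

theorem tendsto_contL2 {χ : ℕ → C(ℝ × ℝ, ℝ)} {η : C(ℝ × ℝ, ℝ)} {C : ℝ}
    (hb : ∀ n, ∀ z ∈ (square ℓ : Set (ℝ × ℝ)), |χ n z - η z| ≤ C)
    (hl : ∀ z ∈ (square ℓ : Set (ℝ × ℝ)), Tendsto (fun n => χ n z) atTop (𝓝 (η z))) :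
    Tendsto (fun n => contL2 ℓ (χ n)) atTop (𝓝 (contL2 ℓ η)) := by
  have key : Tendsto (fun n => ‖contL2 ℓ (χ n) - contL2 ℓ η‖ ^ 2) atTop (𝓝 0) := by
    have e : ∀ n, ‖contL2 ℓ (χ n) - contL2 ℓ η‖ ^ 2 =
        ∫ z in (square ℓ : Set (ℝ × ℝ)), (χ n z - η z) ^ 2 := by
      intro n
      rw [← real_inner_self_eq_norm_sq, inner_L2]
      refine integral_congr_ae ?_
      filter_upwards [Lp.coeFn_sub (contL2 ℓ (χ n)) (contL2 ℓ η), coeFn_contL2 (ℓ := ℓ) (χ n),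
        coeFn_contL2 (ℓ := ℓ) η] with z h1 h2 h3
      rw [h1, Pi.sub_apply, h2, h3, sq]
    simp only [e]
    rw [show (0 : ℝ) = ∫ z in (square ℓ : Set (ℝ × ℝ)), (0 : ℝ) by simp]
    refine tendsto_integral_of_dominated_convergence (fun _ => C ^ 2) ?_ (integrable_const _) ?_ ?_
    · exact fun n => (((χ n).continuous.sub η.continuous).pow 2).aestronglyMeasurable
    · intro n
      refine ae_square fun z hz => ?_
      rw [Real.norm_eq_abs, abs_pow]
      exact pow_le_pow_left₀ (abs_nonneg _) (hb n z hz) 2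
    · refine ae_square fun z hz => ?_
      simpa using ((hl z hz).sub_const (η z)).pow 2
  rw [tendsto_iff_norm_sub_tendsto_zero]
  have := key.sqrt
  simpa using this

/-- A smooth cutoff function on the line, equal to `0` on `(-∞, 1]` and to `1` on `[2, ∞)`. -/
def cut (s : ℝ) : ℝ := Real.smoothTransition (s - 1)

theorem contDiff_cut {n : ℕ∞} : ContDiff ℝ n cut :=
  Real.smoothTransition.contDiff.comp (contDiff_id.sub contDiff_const)

theorem cut_eq_zero {s : ℝ} (h : s ≤ 1) : cut s = 0 :=
  Real.smoothTransition.zero_of_nonpos (by linarith)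

theorem cut_eq_one {s : ℝ} (h : 2 ≤ s) : cut s = 1 :=
  Real.smoothTransition.one_of_one_le (by linarith)

theorem abs_cut_le (s : ℝ) : |cut s| ≤ 1 := by
  rw [cut, abs_of_nonneg (Real.smoothTransition.nonneg _)]
  exact Real.smoothTransition.le_one _

theorem deriv_cut_of_two_lt {s : ℝ} (h : 2 < s) : deriv cut s = 0 := by
  have : cut =ᶠ[𝓝 s] fun _ => 1 := by
    filter_upwards [lt_mem_nhds h] with t ht
    exact cut_eq_one ht.le
  rw [this.deriv_eq, deriv_const]

theorem exists_bound_deriv_cut : ∃ C, 0 ≤ C ∧ ∀ s, 0 ≤ s → |s * deriv cut s| ≤ C := by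
  have hc : Continuous fun s => s * deriv cut s :=
    continuous_id.mul ((contDiff_cut (n := 1)).continuous_deriv le_rfl)
  obtain ⟨C, hC⟩ := (isCompact_Icc (a := (0 : ℝ)) (b := 2)).exists_bound_of_continuousOn
    hc.continuousOn
  refine ⟨max C 0, le_max_right _ _, fun s hs => ?_⟩
  rcases le_or_gt s 2 with h | h
  · exact (hC s ⟨hs, h⟩).trans (le_max_left _ _)
  · rw [deriv_cut_of_two_lt h]; simp

/-- The function `χ` times a cutoff that vanishes where `e₀ ≤ 1/N`, near the boundary of `D`. -/
def cutFn (ℓ : ℝ) (N : ℝ) (χ : ℝ × ℝ → ℝ) : ℝ × ℝ → ℝ :=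
  (square ℓ : Set (ℝ × ℝ)).indicator fun z => cut (N * eC ℓ (0, 0) z) * χ z

/-- The compact subset of `D` that carries `cutFn ℓ N χ`. -/
def cutSet (ℓ : ℝ) (N : ℝ) : Set (ℝ × ℝ) :=
  (Icc 0 ℓ ×ˢ Icc 0 ℓ) ∩ {z | 1 ≤ N * eC ℓ (0, 0) z}

theorem isCompact_cutSet (ℓ N : ℝ) : IsCompact (cutSet ℓ N) :=
  (isCompact_closedSquare ℓ).inter_right (isClosed_le continuous_const (by fun_prop))

theorem sinC_apply_zero (m : ℕ) : sinC ℓ m 0 = 0 := by simp [sinC]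

theorem sinC_apply_end (hℓ : 0 < ℓ) (m : ℕ) : sinC ℓ m ℓ = 0 := by
  simp only [sinC, ContinuousMap.coe_mk, freq]
  rw [div_mul_cancel₀ _ hℓ.ne']
  exact_mod_cast Real.sin_nat_mul_pi (m + 1)

theorem cutSet_subset (hℓ : 0 < ℓ) (N : ℝ) : cutSet ℓ N ⊆ square ℓ := by
  rintro ⟨x, y⟩ ⟨⟨hx, hy⟩, h⟩
  have h0 : sinC ℓ 0 x ≠ 0 ∧ sinC ℓ 0 y ≠ 0 := by
    rw [← mul_ne_zero_iff]
    intro h0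
    have : eC ℓ (0, 0) (x, y) = 2 / ℓ * (sinC ℓ 0 x * sinC ℓ 0 y) := rfl
    rw [mem_ofPred_eq, this, h0] at h
    norm_num at h
  have key : ∀ t ∈ Icc (0 : ℝ) ℓ, sinC ℓ 0 t ≠ 0 → t ∈ Ioo 0 ℓ := by
    intro t ht hne
    refine ⟨lt_of_le_of_ne ht.1 ?_, lt_of_le_of_ne ht.2 ?_⟩
    · rintro rfl; exact hne (sinC_apply_zero 0)
    · rintro rfl; exact hne (sinC_apply_end hℓ 0)
  exact ⟨key x hx h0.1, key y hy h0.2⟩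

theorem cutFn_eq_zero {N : ℝ} {χ : ℝ × ℝ → ℝ} {z : ℝ × ℝ} (hz : z ∉ cutSet ℓ N) :
    cutFn ℓ N χ z = 0 := by
  by_cases h : z ∈ (square ℓ : Set (ℝ × ℝ))
  · have : N * eC ℓ (0, 0) z ≤ 1 := by
      by_contra hcon
      exact hz ⟨square_subset_Icc ℓ h, (not_le.1 hcon).le⟩
    rw [cutFn, indicator_of_mem h, cut_eq_zero this, zero_mul]
  · rw [cutFn, indicator_of_notMem h]

theorem cutFn_eventuallyEq {N : ℝ} {χ : ℝ × ℝ → ℝ} {z : ℝ × ℝ}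
    (hz : z ∈ (square ℓ : Set (ℝ × ℝ))) :
    cutFn ℓ N χ =ᶠ[𝓝 z] fun z => cut (N * eC ℓ (0, 0) z) * χ z := by
  filter_upwards [(square ℓ).isOpen.mem_nhds hz] with w hw
  rw [cutFn, indicator_of_mem hw]

/-- `cutFn ℓ N χ` as a test function. -/
def cutTest (hℓ : 0 < ℓ) (N : ℝ) (χ : ℝ × ℝ → ℝ) (hχ : ContDiff ℝ ((⊤ : ℕ∞) : WithTop ℕ∞) χ) :
    TestFn ℓ where
  toFun := cutFn ℓ N χ
  contDiff' := by
    refine contDiff_iff_contDiffAt.2 fun z => ?_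
    by_cases hz : z ∈ (square ℓ : Set (ℝ × ℝ))
    · refine ContDiffAt.congr_of_eventuallyEq ?_ (cutFn_eventuallyEq hz)
      exact ((contDiff_cut.comp (contDiff_const.mul (contDiff_eC _))).mul hχ).contDiffAt
    · have : cutFn ℓ N χ =ᶠ[𝓝 z] fun _ => 0 := by
        filter_upwards [(isCompact_cutSet ℓ N).isClosed.isOpen_compl.mem_nhds
          fun h => hz (cutSet_subset hℓ N h)] with w hw
        exact cutFn_eq_zero hw
      exact contDiffAt_const.congr_of_eventuallyEq this
  hasCompactSupport' :=
    HasCompactSupport.intro (isCompact_cutSet ℓ N) fun _ hz => cutFn_eq_zero hz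
  tsupport_subset' := by
    refine subset_trans (closure_minimal (fun z hz => ?_) (isCompact_cutSet ℓ N).isClosed)
      (cutSet_subset hℓ N)
    by_contra hcon
    exact hz (cutFn_eq_zero hcon)

theorem pd_cutTest (hℓ : 0 < ℓ) (N : ℝ) {j : Fin 2} {χ χ' e' : C(ℝ × ℝ, ℝ)}
    (hχ : ContDiff ℝ ((⊤ : ℕ∞) : WithTop ℕ∞) χ) (h : IsPartial j χ χ')
    (he : IsPartial j (eC ℓ (0, 0)) e')
    {z : ℝ × ℝ} (hz : z ∈ (square ℓ : Set (ℝ × ℝ))) :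
    pd j (cutTest hℓ N χ hχ) z =
      N * deriv cut (N * eC ℓ (0, 0) z) * e' z * χ z + cut (N * eC ℓ (0, 0) z) * χ' z := by
  have e1 : pd j (cutTest hℓ N χ hχ) z
      = fderiv ℝ (fun z => cut (N * eC ℓ (0, 0) z) * χ z) z (dir j) := by
    change fderiv ℝ (cutFn ℓ N χ) z (dir j) = _
    rw [(cutFn_eventuallyEq hz).fderiv_eq]
  have d1 : HasFDerivAt (eC ℓ (0, 0)) (fderiv ℝ (eC ℓ (0, 0)) z) z :=
    (he.contDiff.differentiable (by simp) z).hasFDerivAt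
  have d2 : HasFDerivAt χ (fderiv ℝ χ z) z :=
    (h.contDiff.differentiable (by simp) z).hasFDerivAt
  have d3 : HasDerivAt cut (deriv cut (N * eC ℓ (0, 0) z)) (N * eC ℓ (0, 0) z) :=
    ((contDiff_cut (n := 1)).differentiable (by simp) _).hasDerivAt
  have d4 := d3.comp_hasFDerivAt z (d1.const_mul N)
  have d5 := (d4.mul d2).fderiv
  change fderiv ℝ (fun z => cut (N * eC ℓ (0, 0) z) * χ z) z = _ at d5
  rw [e1, d5]
  simp [h.eq, he.eq]
  ring

/-- A smooth function on the plane that is dominated by `e₀` on `D`, hence vanishes on the boundary,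
belongs to `H¹₀(D)`. -/
theorem contL2_mem_H10Graph (hℓ : 0 < ℓ) {χ : C(ℝ × ℝ, ℝ)} {χ' : Fin 2 → C(ℝ × ℝ, ℝ)}
    (hχ : ContDiff ℝ ((⊤ : ℕ∞) : WithTop ℕ∞) χ) (h : ∀ j, IsPartial j χ (χ' j)) {C : ℝ}
    (hC : ∀ z ∈ (square ℓ : Set (ℝ × ℝ)), |χ z| ≤ C * eC ℓ (0, 0) z) :
    (contL2 ℓ χ, WithLp.toLp 2 fun j => contL2 ℓ (χ' j)) ∈ H10Graph ℓ := by
  let φ : ℕ → TestFn ℓ := fun N => cutTest hℓ N χ hχ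
  have hφ : ∀ N : ℕ, ∀ z ∈ (square ℓ : Set (ℝ × ℝ)),
      φ N z = cut (N * eC ℓ (0, 0) z) * χ z := fun N z hz =>
    indicator_of_mem (f := fun z => cut (N * eC ℓ (0, 0) z) * χ z) hz
  have hlarge : ∀ z ∈ (square ℓ : Set (ℝ × ℝ)),
      ∀ᶠ N : ℕ in atTop, 2 < (N : ℝ) * eC ℓ (0, 0) z := by
    intro z hz
    obtain ⟨n, hn⟩ := exists_nat_gt (2 / eC ℓ (0, 0) z)
    filter_upwards [eventually_ge_atTop n] with N hN
    rw [← div_lt_iff₀ (eC_zero_pos hℓ hz)]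
    exact hn.trans_le (by exact_mod_cast hN)
  have t1 : Tendsto (fun N => contL2 ℓ (φ N).toC) atTop (𝓝 (contL2 ℓ χ)) := by
    obtain ⟨B, hB⟩ := exists_bound_on_square (ℓ := ℓ) χ
    refine tendsto_contL2 (C := B + B) (fun N z hz => ?_) fun z hz => ?_
    · change |φ N z - χ z| ≤ _
      rw [hφ N z hz]
      refine (abs_sub _ _).trans (add_le_add ?_ (hB z hz))
      rw [abs_mul]
      exact (mul_le_of_le_one_left (abs_nonneg _) (abs_cut_le _)).trans (hB z hz)
    · refine tendsto_const_nhds.congr' ?_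
      filter_upwards [hlarge z hz] with N hN
      change χ z = φ N z
      rw [hφ N z hz, cut_eq_one hN.le, one_mul]
  -- The derivative of the cutoff has size `N` where `e₀` has size `1/N`, but there `|χ| ≤ C e₀`.
  -- So the derivatives are bounded uniformly in `N`, and converge by dominated convergence.
  have t2 : ∀ j, Tendsto (fun N => contL2 ℓ ((φ N).pdC j)) atTop (𝓝 (contL2 ℓ (χ' j))) := by
    intro j
    obtain ⟨B, hB⟩ := exists_bound_on_square (ℓ := ℓ) (χ' j)
    obtain ⟨B1, hB1⟩ := exists_bound_on_square (ℓ := ℓ) (kfreq ℓ j (0, 0) • gC ℓ j (0, 0))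
    obtain ⟨C1, hC1, hC1'⟩ := exists_bound_deriv_cut
    have hpd : ∀ N : ℕ, ∀ z ∈ (square ℓ : Set (ℝ × ℝ)), pd j (φ N) z = _ := fun N z hz =>
      pd_cutTest hℓ N hχ (h j) (isPartial_eC j (0, 0)) hz
    refine tendsto_contL2 (C := C1 * |C| * B1 + B + B) (fun N z hz => ?_) fun z hz => ?_
    · change |pd j (φ N) z - χ' j z| ≤ _
      have hp := eC_zero_pos hℓ hz
      rw [hpd N z hz]
      refine (abs_sub _ _).trans (add_le_add ((abs_add_le _ _).trans (add_le_add ?_ ?_)) (hB z hz))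
      · have s1 := hC1' (N * eC ℓ (0, 0) z) (by positivity)
        have s2 : |χ z| ≤ |C| * eC ℓ (0, 0) z :=
          (hC z hz).trans (mul_le_mul_of_nonneg_right (le_abs_self C) hp.le)
        have s3 : |(N : ℝ) * deriv cut (N * eC ℓ (0, 0) z)| * eC ℓ (0, 0) z ≤ C1 := by
          rw [← abs_of_pos hp, ← abs_mul, abs_of_pos hp]
          refine le_trans (le_of_eq ?_) s1
          congr 1
          ring
        rw [abs_mul, abs_mul]
        calc |(N : ℝ) * deriv cut (N * eC ℓ (0, 0) z)| * |(kfreq ℓ j (0, 0) • gC ℓ j (0, 0)) z| * |χ z|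
            ≤ |(N : ℝ) * deriv cut (N * eC ℓ (0, 0) z)| * B1 * (|C| * eC ℓ (0, 0) z) := by
              have : 0 ≤ B1 := (abs_nonneg _).trans (hB1 z hz)
              gcongr
              exact hB1 z hz
          _ = (|(N : ℝ) * deriv cut (N * eC ℓ (0, 0) z)| * eC ℓ (0, 0) z) * (|C| * B1) := by ring
          _ ≤ C1 * (|C| * B1) := by
              have : 0 ≤ B1 := (abs_nonneg _).trans (hB1 z hz)
              gcongr
          _ = _ := by ring
      · rw [abs_mul]
        exact (mul_le_of_le_one_left (abs_nonneg _) (abs_cut_le _)).trans (hB z hz)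
    · refine tendsto_const_nhds.congr' ?_
      filter_upwards [hlarge z hz] with N hN
      change χ' j z = pd j (φ N) z
      rw [hpd N z hz, cut_eq_one hN.le, deriv_cut_of_two_lt hN]
      ring
  have t3 : Tendsto (fun N => (contL2 ℓ (φ N).toC,
      (WithLp.toLp 2 fun j => contL2 ℓ ((φ N).pdC j) : L2Vec ℓ))) atTop
      (𝓝 (contL2 ℓ χ, WithLp.toLp 2 fun j => contL2 ℓ (χ' j))) :=
    t1.prodMk_nhds (((PiLp.continuous_toLp 2 _).tendsto _).comp (tendsto_pi_nhds.2 t2))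
  refine mem_closure_of_tendsto t3 (Eventually.of_forall fun N => ?_)
  exact ⟨φ N, coeFn_contL2 _, fun j => coeFn_contL2 _⟩

theorem abs_sin_nat_mul_le (m : ℕ) (x : ℝ) : |Real.sin (m * x)| ≤ m * |Real.sin x| := by
  induction m with
  | zero => simp
  | succ m ih =>
    push_cast
    rw [add_mul, one_mul, Real.sin_add, add_mul, one_mul]
    refine (abs_add_le _ _).trans (add_le_add ?_ ?_)
    · rw [abs_mul]
      exact (mul_le_of_le_one_right (abs_nonneg _) (Real.abs_cos_le_one _)).trans ih
    · rw [abs_mul]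
      exact mul_le_of_le_one_left (abs_nonneg _) (Real.abs_cos_le_one _)

theorem abs_sinC_le (m : ℕ) (x : ℝ) : |sinC ℓ m x| ≤ (m + 1) * |sinC ℓ 0 x| := by
  have h := abs_sin_nat_mul_le (m + 1) (freq ℓ 0 * x)
  have e : ((m + 1 : ℕ) : ℝ) * (freq ℓ 0 * x) = freq ℓ m * x := by
    simp only [freq]; push_cast; ring
  rw [e] at h
  exact_mod_cast h

/-- The gradient of the eigenfunction with index `k`. -/
def eGrad (ℓ : ℝ) (k : ℕ × ℕ) : L2Vec ℓ :=
  WithLp.toLp 2 fun j => kfreq ℓ j k • contL2 ℓ (gC ℓ j k)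

theorem eGrad_apply (k : ℕ × ℕ) (j : Fin 2) :
    eGrad ℓ k j = kfreq ℓ j k • contL2 ℓ (gC ℓ j k) := rfl

theorem e_mem_H10Graph (hℓ : 0 < ℓ) (k : ℕ × ℕ) : (contL2 ℓ (eC ℓ k), eGrad ℓ k) ∈ H10Graph ℓ := by
  refine contL2_mem_H10Graph hℓ (χ' := fun j => kfreq ℓ j k • gC ℓ j k) (contDiff_eC k)
    (fun j => isPartial_eC j k) (C := (k.1 + 1) * (k.2 + 1)) fun z hz => ?_
  have h1 := sinC_zero_pos hℓ hz.1
  have h2 := sinC_zero_pos hℓ hz.2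
  have s1 := abs_sinC_le (ℓ := ℓ) k.1 z.1
  have s2 := abs_sinC_le (ℓ := ℓ) k.2 z.2
  rw [abs_of_pos h1] at s1
  rw [abs_of_pos h2] at s2
  change |2 / ℓ * (sinC ℓ k.1 z.1 * sinC ℓ k.2 z.2)| ≤
    (k.1 + 1) * (k.2 + 1) * (2 / ℓ * (sinC ℓ 0 z.1 * sinC ℓ 0 z.2))
  rw [abs_mul, abs_mul, abs_of_pos (by positivity : 0 < 2 / ℓ)]
  calc 2 / ℓ * (|sinC ℓ k.1 z.1| * |sinC ℓ k.2 z.2|)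
      ≤ 2 / ℓ * (((k.1 + 1) * sinC ℓ 0 z.1) * ((k.2 + 1) * sinC ℓ 0 z.2)) := by gcongr
    _ = _ := by ring

end Cutoff

/-! ### Sine coefficients -/

section Coefficients

variable {ℓ : ℝ}

/-- The sine coefficient of `u ∈ L²(D)` with index `k`. -/
def sc (k : ℕ × ℕ) (u : L2 ℓ) : ℝ := inner ℝ (contL2 ℓ (eC ℓ k)) u

theorem sc_add (k : ℕ × ℕ) (u v : L2 ℓ) : sc k (u + v) = sc k u + sc k v := inner_add_right _ _ _

theorem sc_sub (k : ℕ × ℕ) (u v : L2 ℓ) : sc k (u - v) = sc k u - sc k v := inner_sub_right _ _ _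

theorem sc_smul (k : ℕ × ℕ) (c : ℝ) (u : L2 ℓ) : sc k (c • u) = c * sc k u :=
  real_inner_smul_right _ _ _

theorem continuous_sc (k : ℕ × ℕ) : Continuous (sc k : L2 ℓ → ℝ) := by
  unfold sc
  fun_prop

theorem hasSum_sc (hℓ : 0 < ℓ) (u : L2 ℓ) : HasSum (fun k => sc k u • contL2 ℓ (eC ℓ k)) u := by
  have := (eBasis hℓ).hasSum_repr u
  simp only [HilbertBasis.repr_apply_apply, eBasis_apply] at this
  exact this

theorem hasSum_sc_sq (hℓ : 0 < ℓ) (u : L2 ℓ) : HasSum (fun k => sc k u ^ 2) (‖u‖ ^ 2) := by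
  have := (eBasis hℓ).hasSum_inner_mul_inner u u
  rw [real_inner_self_eq_norm_sq] at this
  refine this.congr_fun fun k => ?_
  rw [eBasis_apply, real_inner_comm, sq, sc]

theorem abs_sc_le (hℓ : 0 < ℓ) (k : ℕ × ℕ) (u : L2 ℓ) : |sc k u| ≤ ‖u‖ := by
  refine abs_le_of_sq_le_sq ?_ (norm_nonneg _)
  exact le_hasSum (hasSum_sc_sq hℓ u) k fun _ _ => sq_nonneg _

theorem eq_of_sc_eq (hℓ : 0 < ℓ) {u v : L2 ℓ} (h : ∀ k, sc k u = sc k v) : u = v := by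
  have h1 := hasSum_sc hℓ u
  simp only [h] at h1
  exact h1.unique (hasSum_sc hℓ v)

theorem sc_of_hasSum (hℓ : 0 < ℓ) {c : ℕ × ℕ → ℝ} {u : L2 ℓ}
    (h : HasSum (fun k => c k • contL2 ℓ (eC ℓ k)) u) (k : ℕ × ℕ) : sc k u = c k := by
  have h1 := h.mapL (innerSL ℝ (contL2 ℓ (eC ℓ k)))
  simp only [innerSL_apply_apply, real_inner_smul_right,
    orthonormal_iff_ite.1 (orthonormal_e hℓ) k] at h1
  refine h1.unique ((hasSum_ite_eq k (c k)).congr_fun fun i => ?_)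
  by_cases hi : i = k
  · simp [hi]
  · simp [hi, Ne.symm hi]

theorem hasSum_sq_of_orthonormal {ι E : Type*} [NormedAddCommGroup E] [InnerProductSpace ℝ E]
    {v : ι → E} (hv : Orthonormal ℝ v) {c : ι → ℝ} {x : E} (h : HasSum (fun k => c k • v k) x) :
    HasSum (fun k => c k ^ 2) (‖x‖ ^ 2) := by
  classical
  have h1 : ∀ k, inner ℝ (v k) x = c k := by
    intro k
    have h1 := h.mapL (innerSL ℝ (v k))
    simp only [innerSL_apply_apply, real_inner_smul_right, orthonormal_iff_ite.1 hv k] at h1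
    refine h1.unique ((hasSum_ite_eq k (c k)).congr_fun fun i => ?_)
    by_cases hi : i = k
    · simp [hi]
    · simp [hi, Ne.symm hi]
  have h2 := h.mapL (innerSL ℝ x)
  simp only [innerSL_apply_apply, real_inner_smul_right, real_inner_self_eq_norm_sq] at h2
  refine h2.congr_fun fun k => ?_
  rw [real_inner_comm, h1, sq]

theorem summable_smul_of_orthonormal {ι E : Type*} [NormedAddCommGroup E] [InnerProductSpace ℝ E]
    [CompleteSpace E] {v : ι → E} (hv : Orthonormal ℝ v) {c : ι → ℝ}
    (h : Summable fun k => c k ^ 2) : Summable fun k => c k • v k := by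
  have := (hv.orthogonalFamily.summable_iff_norm_sq_summable c).2 (by simpa using h)
  simpa using this

/-! ### Fourier series of gradients -/

theorem kfreq_sq_le_eig (j : Fin 2) (k : ℕ × ℕ) : kfreq ℓ j k ^ 2 ≤ eig ℓ k := by
  unfold eig
  fin_cases j
  · exact le_add_of_nonneg_right (sq_nonneg _)
  · exact le_add_of_nonneg_left (sq_nonneg _)

theorem inner_grad_gC {u : L2 ℓ} {g : L2Vec ℓ} (hu : (u, g) ∈ H10Graph ℓ) (j : Fin 2)
    (k : ℕ × ℕ) : inner ℝ (g j) (contL2 ℓ (gC ℓ j k)) = kfreq ℓ j k * sc k u := by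
  rw [inner_grad_contL2 hu (isPartial_gC_self j k), contL2_smul, real_inner_smul_right, sc,
    real_inner_comm]
  ring

/-- The gradient of the sine series: `∂_j` of the eigenfunctions is again orthogonal, and the
coefficients of `∂_j u` are those of `u`, by Green's formula. -/
theorem hasSum_grad (hℓ : 0 < ℓ) {u : L2 ℓ} {g : L2Vec ℓ} (hu : (u, g) ∈ H10Graph ℓ)
    (j : Fin 2) : HasSum (fun k => (kfreq ℓ j k * sc k u) • contL2 ℓ (gC ℓ j k)) (g j) := by
  have hs : Summable fun k => (kfreq ℓ j k * sc k u) • contL2 ℓ (gC ℓ j k) := by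
    refine summable_smul_of_orthonormal (orthonormal_g hℓ j) ?_
    have := (orthonormal_g hℓ j).inner_products_summable (x := g j)
    refine this.congr fun k => ?_
    rw [← inner_grad_gC hu j k, real_inner_comm, Real.norm_eq_abs, sq_abs]
  have hw : HasWeakDeriv j u (∑' k, (kfreq ℓ j k * sc k u) • contL2 ℓ (gC ℓ j k)) := by
    refine HasWeakDeriv.hasSum (fun k => ?_) (hasSum_sc hℓ u) hs.hasSum
    have := (hasWeakDeriv_contL2 (ℓ := ℓ) (isPartial_eC (ℓ := ℓ) j k)).smul (sc k u)
    rw [contL2_smul, smul_smul, mul_comm] at this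
    exact this
  rw [(hasWeakDeriv_of_mem_H10Graph hu j).unique hw]
  exact hs.hasSum

theorem norm_vec_sq (g : L2Vec ℓ) : ‖g‖ ^ 2 = ‖g 0‖ ^ 2 + ‖g 1‖ ^ 2 := by
  rw [PiLp.norm_sq_eq_of_L2, Fin.sum_univ_two]

theorem norm_apply_le (g : L2Vec ℓ) (j : Fin 2) : ‖g j‖ ≤ ‖g‖ := PiLp.norm_apply_le g j

theorem hasSum_norm_grad_sq (hℓ : 0 < ℓ) {u : L2 ℓ} {g : L2Vec ℓ} (hu : (u, g) ∈ H10Graph ℓ) :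
    HasSum (fun k => eig ℓ k * sc k u ^ 2) (‖g‖ ^ 2) := by
  have h := (hasSum_sq_of_orthonormal (orthonormal_g hℓ 0) (hasSum_grad hℓ hu 0)).add
    (hasSum_sq_of_orthonormal (orthonormal_g hℓ 1) (hasSum_grad hℓ hu 1))
  rw [norm_vec_sq]
  refine h.congr_fun fun k => ?_
  simp only [eig]
  ring

theorem inner_grad_eGrad {u : L2 ℓ} {g : L2Vec ℓ} (hu : (u, g) ∈ H10Graph ℓ) (k : ℕ × ℕ) :
    inner ℝ g (eGrad ℓ k) = eig ℓ k * sc k u := by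
  rw [PiLp.inner_apply, Fin.sum_univ_two]
  simp only [eGrad_apply, real_inner_smul_right, inner_grad_gC hu, eig]
  ring

/-- The Fourier series of an element of `H¹₀(D)` converges in `H¹`. -/
theorem hasSum_graph (hℓ : 0 < ℓ) {u : L2 ℓ} {g : L2Vec ℓ} (hu : (u, g) ∈ H10Graph ℓ) :
    HasSum (fun k => sc k u • (contL2 ℓ (eC ℓ k), eGrad ℓ k)) (u, g) := by
  have h2 : HasSum (fun k => sc k u • eGrad ℓ k) g := by
    have h3 : HasSum (fun k j => sc k u • eGrad ℓ k j) (fun j => g j) := by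
      refine Pi.hasSum.2 fun j => ?_
      refine (hasSum_grad hℓ hu j).congr_fun fun k => ?_
      rw [eGrad_apply, smul_smul, mul_comm]
    have h4 := h3.mapL ((PiLp.continuousLinearEquiv 2 ℝ (fun _ : Fin 2 => L2 ℓ)).symm :
      (Fin 2 → L2 ℓ) →L[ℝ] L2Vec ℓ)
    exact h4
  exact (hasSum_sc hℓ u).prodMk h2

/-! ### Summability over the spectrum -/

theorem eig_zero_le (hℓ : 0 < ℓ) (k : ℕ × ℕ) : eig ℓ (0, 0) ≤ eig ℓ k := by
  have key : ∀ m : ℕ, freq ℓ 0 ≤ freq ℓ m := by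
    intro m
    unfold freq
    have := Real.pi_pos
    gcongr
    linarith [(Nat.cast_nonneg m : (0 : ℝ) ≤ m)]
  have h0 := freq_pos hℓ 0
  change freq ℓ 0 ^ 2 + freq ℓ 0 ^ 2 ≤ freq ℓ k.1 ^ 2 + freq ℓ k.2 ^ 2
  gcongr <;> exact key _

/-- The double series is dominated by a product of two series `∑ m⁻²`, as
`a² b² ≤ (a² + b²)²` for the frequencies `a` and `b`. -/
theorem summable_inv_eig_sq (hℓ : 0 < ℓ) : Summable fun k => (eig ℓ k ^ 2)⁻¹ := by
  have h1 : Summable fun m : ℕ => (freq ℓ m ^ 2)⁻¹ := by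
    have := (summable_nat_add_iff 1).2 (Real.summable_one_div_nat_pow.2 one_lt_two)
    refine (this.mul_left ((Real.pi / ℓ) ^ 2)⁻¹).congr fun m => ?_
    rw [freq, one_div, ← mul_inv]
    push_cast
    congr 1
    ring
  have h2 := h1.mul_of_nonneg h1 (fun _ => by positivity) (fun _ => by positivity)
  refine Summable.of_nonneg_of_le (fun _ => by positivity) (fun k => ?_) h2
  have p1 := freq_pos hℓ k.1
  have p2 := freq_pos hℓ k.2
  rw [← mul_inv]
  refine inv_anti₀ (by positivity) ?_
  change _ ≤ (freq ℓ k.1 ^ 2 + freq ℓ k.2 ^ 2) ^ 2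
  nlinarith [sq_nonneg (freq ℓ k.1 ^ 2), sq_nonneg (freq ℓ k.2 ^ 2),
    mul_pos (pow_pos p1 2) (pow_pos p2 2)]

theorem summable_abs_mul_inv_eig (hℓ : 0 < ℓ) {c : ℕ × ℕ → ℝ} (hc : Summable fun k => c k ^ 2) :
    Summable fun k => |c k| / eig ℓ k := by
  refine Summable.of_nonneg_of_le (fun k => ?_) (fun k => ?_) (hc.add (summable_inv_eig_sq hℓ))
  · have := eig_pos hℓ k; positivity
  · rw [div_eq_mul_inv, ← inv_pow]
    have := two_mul_le_add_sq |c k| (eig ℓ k)⁻¹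
    have h0 : 0 ≤ |c k| * (eig ℓ k)⁻¹ := mul_nonneg (abs_nonneg _) (inv_nonneg.2 (eig_pos hℓ k).le)
    rw [sq_abs] at this
    linarith

/-! ### Bounded functions -/

/-- `|u| ≤ B` almost everywhere in `D`. -/
def EssBdd (B : ℝ) (u : L2 ℓ) : Prop :=
  ∀ᵐ z ∂(volume.restrict (square ℓ : Set (ℝ × ℝ))), |u z| ≤ B

theorem isClosed_essBdd (B : ℝ) : IsClosed {u : L2 ℓ | EssBdd B u} := by
  refine isSeqClosed_iff_isClosed.1 fun u v hu hv => ?_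
  obtain ⟨ns, -, hns⟩ := (tendstoInMeasure_of_tendsto_Lp hv).exists_seq_tendsto_ae
  have h := ae_all_iff.2 fun n => (hu n : ∀ᵐ z ∂_, |u n z| ≤ B)
  filter_upwards [h, hns] with z h1 h2
  exact le_of_tendsto h2.abs (Eventually.of_forall fun n => h1 _)

theorem essBdd_contL2 {χ : C(ℝ × ℝ, ℝ)} {B : ℝ}
    (h : ∀ z ∈ (square ℓ : Set (ℝ × ℝ)), |χ z| ≤ B) : EssBdd B (contL2 ℓ χ) := by
  filter_upwards [coeFn_contL2 (ℓ := ℓ) χ, ae_square h] with z h1 h2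
  rwa [h1]

theorem exists_essBdd_contL2 (χ : C(ℝ × ℝ, ℝ)) : ∃ B, EssBdd B (contL2 ℓ χ) :=
  (exists_bound_on_square χ).imp fun _ h => essBdd_contL2 h

/-- A function with absolutely summable sine coefficients is bounded. -/
theorem essBdd_of_summable (hℓ : 0 < ℓ) {u : L2 ℓ} {S : ℝ} {b : ℕ × ℕ → ℝ}
    (hb : ∀ k, |sc k u| ≤ b k) (hS : HasSum b S) : EssBdd (2 / ℓ * S) u := by
  refine (isClosed_essBdd (ℓ := ℓ) (2 / ℓ * S)).mem_of_tendsto (hasSum_sc hℓ u)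
    (Eventually.of_forall fun F => ?_)
  have e : ∑ k ∈ F, sc k u • contL2 ℓ (eC ℓ k) = contL2 ℓ (∑ k ∈ F, sc k u • eC ℓ k) := by
    induction F using Finset.cons_induction with
    | empty => exact (by simpa using contL2_smul (ℓ := ℓ) 0 0 : contL2 ℓ 0 = 0).symm
    | cons a F ha ih => rw [Finset.sum_cons, Finset.sum_cons, ih, contL2_add, contL2_smul]
  change EssBdd _ (∑ k ∈ F, sc k u • contL2 ℓ (eC ℓ k))
  rw [e]
  refine essBdd_contL2 fun z _ => ?_
  rw [ContinuousMap.sum_apply]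
  refine (Finset.abs_sum_le_sum_abs _ _).trans ?_
  calc ∑ k ∈ F, |(sc k u • eC ℓ k) z| ≤ ∑ k ∈ F, 2 / ℓ * b k := by
        refine Finset.sum_le_sum fun k _ => ?_
        rw [ContinuousMap.smul_apply, smul_eq_mul, abs_mul, mul_comm]
        exact mul_le_mul (abs_eC_le hℓ k z) (hb k) (abs_nonneg _) (by positivity)
    _ = 2 / ℓ * ∑ k ∈ F, b k := by rw [Finset.mul_sum]
    _ ≤ 2 / ℓ * S := by
        gcongr
        exact sum_le_hasSum F (fun k _ => (abs_nonneg _).trans (hb k)) hS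

theorem memLp_mul_of_essBdd {B : ℝ} {u : L2 ℓ} (hu : EssBdd B u) (v : L2 ℓ) :
    MemLp (fun z => u z * v z) 2 (volume.restrict (square ℓ : Set (ℝ × ℝ))) :=
  (Lp.memLp v).of_le_mul (c := B) ((Lp.memLp u).1.mul (Lp.memLp v).1) (by
    filter_upwards [hu] with z hz
    rw [norm_mul]
    gcongr
    exact hz)

theorem norm_toLp_mul_le {B : ℝ} {u : L2 ℓ} (hu : EssBdd B u) (v : L2 ℓ) :
    ‖(memLp_mul_of_essBdd hu v).toLp‖ ≤ B * ‖v‖ := by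
  refine Lp.norm_le_mul_norm_of_ae_le_mul ?_
  filter_upwards [(memLp_mul_of_essBdd hu v).coeFn_toLp, hu] with z h1 h2
  rw [h1, norm_mul]
  gcongr
  exact h2

/-- Multiplication of `L²(D)` with a bounded function. -/
def mulBdd {B : ℝ} {u : L2 ℓ} (hu : EssBdd B u) : L2 ℓ →L[ℝ] L2 ℓ :=
  LinearMap.mkContinuous
    { toFun := fun v => (memLp_mul_of_essBdd hu v).toLp
      map_add' := fun v w => by
        refine Lp.ext ?_
        filter_upwards [(memLp_mul_of_essBdd hu (v + w)).coeFn_toLp,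
          (memLp_mul_of_essBdd hu v).coeFn_toLp, (memLp_mul_of_essBdd hu w).coeFn_toLp,
          Lp.coeFn_add (memLp_mul_of_essBdd hu v).toLp (memLp_mul_of_essBdd hu w).toLp,
          Lp.coeFn_add v w] with z h1 h2 h3 h4 h5
        rw [h1, h4, Pi.add_apply, h2, h3, h5, Pi.add_apply, mul_add]
      map_smul' := fun c v => by
        refine Lp.ext ?_
        filter_upwards [(memLp_mul_of_essBdd hu (c • v)).coeFn_toLp,
          (memLp_mul_of_essBdd hu v).coeFn_toLp,
          Lp.coeFn_smul c (memLp_mul_of_essBdd hu v).toLp, Lp.coeFn_smul c v] with z h1 h2 h4 h5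
        rw [h1, RingHom.id_apply, h4, Pi.smul_apply, h2, h5, Pi.smul_apply, smul_eq_mul,
          smul_eq_mul]
        ring } B (norm_toLp_mul_le hu)

theorem coeFn_mulBdd {B : ℝ} {u : L2 ℓ} (hu : EssBdd B u) (v : L2 ℓ) :
    mulBdd hu v =ᵐ[volume.restrict (square ℓ : Set (ℝ × ℝ))] fun z => u z * v z :=
  (memLp_mul_of_essBdd hu v).coeFn_toLp

theorem norm_mulBdd_le {B : ℝ} {u : L2 ℓ} (hu : EssBdd B u) (v : L2 ℓ) :
    ‖mulBdd hu v‖ ≤ B * ‖v‖ :=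
  norm_toLp_mul_le hu v

/-- The integral of a product of three functions. -/
def trip (u v w : L2 ℓ) : ℝ := ∫ z in (square ℓ : Set (ℝ × ℝ)), u z * v z * w z

theorem trip_eq_inner {B : ℝ} {u : L2 ℓ} (hu : EssBdd B u) (v w : L2 ℓ) :
    trip u v w = inner ℝ (mulBdd hu v) w := by
  rw [inner_L2]
  refine integral_congr_ae ?_
  filter_upwards [coeFn_mulBdd hu v] with z h
  rw [h]

theorem integrable_trip {B : ℝ} {u : L2 ℓ} (hu : EssBdd B u) (v w : L2 ℓ) :
    Integrable (fun z => u z * v z * w z) (volume.restrict (square ℓ : Set (ℝ × ℝ))) := by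
  refine (integrable_L2_mul (mulBdd hu v) w).congr ?_
  filter_upwards [coeFn_mulBdd hu v] with z h
  rw [h]

theorem trip_comm (u v w : L2 ℓ) : trip u v w = trip u w v := by
  refine integral_congr_ae (Eventually.of_forall fun z => ?_)
  simp only
  ring

theorem trip_rotate (u v w : L2 ℓ) : trip u v w = trip w u v := by
  refine integral_congr_ae (Eventually.of_forall fun z => ?_)
  simp only
  ring

theorem abs_trip_le {B : ℝ} {u : L2 ℓ} (hu : EssBdd B u) (v w : L2 ℓ) :
    |trip u v w| ≤ B * ‖v‖ * ‖w‖ := by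
  rw [trip_eq_inner hu]
  refine (abs_real_inner_le_norm _ _).trans ?_
  gcongr
  exact norm_mulBdd_le hu v

theorem trip_sub_left {B B' : ℝ} {u u' : L2 ℓ} (hu : EssBdd B u) (hu' : EssBdd B' u')
    (v w : L2 ℓ) : trip (u - u') v w = trip u v w - trip u' v w := by
  rw [trip, trip, trip, ← integral_sub (integrable_trip hu v w) (integrable_trip hu' v w)]
  refine integral_congr_ae ?_
  filter_upwards [Lp.coeFn_sub u u'] with z h
  rw [h, Pi.sub_apply]
  ring

/-- The trilinear form `∫_D ψ (∂ₓq ∂_yv - ∂_yq ∂ₓv)`, where `g = ∇q` and `d = ∇v`. It is the weak form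
of `(J(ψ, q), v)` and needs no derivative of `ψ`. -/
def tri (ψ : L2 ℓ) (g d : L2Vec ℓ) : ℝ := trip ψ (g 0) (d 1) - trip ψ (g 1) (d 0)

theorem tri_self (ψ : L2 ℓ) (g : L2Vec ℓ) : tri ψ g g = 0 := by
  rw [tri, trip_comm, sub_self]

theorem abs_tri_le {B : ℝ} (hB : 0 ≤ B) {ψ : L2 ℓ} (hψ : EssBdd B ψ) (g d : L2Vec ℓ) :
    |tri ψ g d| ≤ B * ‖g‖ * ‖d‖ := by
  have h1 := abs_trip_le hψ (g 0) (d 1)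
  have h2 := abs_trip_le hψ (g 1) (d 0)
  have hg := norm_vec_sq g
  have hd := norm_vec_sq d
  have key : ‖g 0‖ * ‖d 1‖ + ‖g 1‖ * ‖d 0‖ ≤ ‖g‖ * ‖d‖ := by
    refine abs_le_of_sq_le_sq' ?_ (by positivity) |>.2
    rw [mul_pow, hg, hd]
    nlinarith [sq_nonneg (‖g 0‖ * ‖d 0‖ - ‖g 1‖ * ‖d 1‖)]
  calc |tri ψ g d| ≤ |trip ψ (g 0) (d 1)| + |trip ψ (g 1) (d 0)| := abs_sub _ _
    _ ≤ B * (‖g 0‖ * ‖d 1‖ + ‖g 1‖ * ‖d 0‖) := by linarith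
    _ ≤ B * (‖g‖ * ‖d‖) := by gcongr
    _ = _ := by ring

theorem tri_add_right {B : ℝ} {ψ : L2 ℓ} (hψ : EssBdd B ψ) (g d d' : L2Vec ℓ) :
    tri ψ g (d + d') = tri ψ g d + tri ψ g d' := by
  simp only [tri, trip_eq_inner hψ, PiLp.add_apply, inner_add_right]
  ring

theorem tri_smul_right {B : ℝ} {ψ : L2 ℓ} (hψ : EssBdd B ψ) (g d : L2Vec ℓ) (c : ℝ) :
    tri ψ g (c • d) = c * tri ψ g d := by
  simp only [tri, trip_eq_inner hψ, PiLp.smul_apply, real_inner_smul_right]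
  ring

theorem tri_sub_middle {B : ℝ} {ψ : L2 ℓ} (hψ : EssBdd B ψ) (g g' d : L2Vec ℓ) :
    tri ψ (g - g') d = tri ψ g d - tri ψ g' d := by
  simp only [tri, trip_eq_inner hψ, PiLp.sub_apply, map_sub, inner_sub_left]
  ring

theorem tri_sub_left {B B' : ℝ} {ψ ψ' : L2 ℓ} (hψ : EssBdd B ψ) (hψ' : EssBdd B' ψ')
    (g d : L2Vec ℓ) : tri (ψ - ψ') g d = tri ψ g d - tri ψ' g d := by
  simp only [tri, trip_sub_left hψ hψ']
  ring

end Coefficients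

/-! ### Functions in `H²(D) ∩ H¹₀(D)` -/

section Stream

variable {ℓ : ℝ}

/-- The eigenfunction with index `k` as an element of `H²(D) ∩ H¹₀(D)`. -/
def eH2 (hℓ : 0 < ℓ) (k : ℕ × ℕ) : H2H10 ℓ where
  toL2 := contL2 ℓ (eC ℓ k)
  grad := eGrad ℓ k
  hess i j := if i = j then -(kfreq ℓ i k ^ 2) • contL2 ℓ (eC ℓ k)
    else (kfreq ℓ i k * kfreq ℓ j k) • contL2 ℓ (ccC ℓ k)
  mem_H10 := e_mem_H10Graph hℓ k
  hess_spec i j := by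
    rw [eGrad_apply]
    split_ifs with h
    · subst h
      have := (hasWeakDeriv_contL2 (ℓ := ℓ) (isPartial_gC_self (ℓ := ℓ) i k)).smul (kfreq ℓ i k)
      rw [contL2_smul, smul_smul] at this
      convert this using 2
      ring
    · have := (hasWeakDeriv_contL2 (ℓ := ℓ) (isPartial_gC_of_ne (ℓ := ℓ) h k)).smul (kfreq ℓ i k)
      rw [contL2_smul, smul_smul] at this
      exact this

theorem eH2_lap (hℓ : 0 < ℓ) (k : ℕ × ℕ) :
    (eH2 hℓ k).lap = -(eig ℓ k) • contL2 ℓ (eC ℓ k) := by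
  simp only [H2H10.lap, eH2, if_true, ← add_smul, eig]
  congr 1
  ring

instance : Zero (H2H10 ℓ) where
  zero :=
  { toL2 := 0
    grad := 0
    hess := 0
    mem_H10 := (H10Graph ℓ).zero_mem
    hess_spec := fun i j => hasWeakDeriv_iff.2 fun φ => by simp }

theorem H2H10.zero_toL2 : (0 : H2H10 ℓ).toL2 = 0 := rfl

theorem H2H10.zero_lap : (0 : H2H10 ℓ).lap = 0 := by
  change (0 : L2 ℓ) + 0 = 0
  rw [add_zero]

instance : Sub (H2H10 ℓ) where
  sub φ η :=
  { toL2 := φ.toL2 - η.toL2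
    grad := φ.grad - η.grad
    hess := φ.hess - η.hess
    mem_H10 := (H10Graph ℓ).sub_mem φ.mem_H10 η.mem_H10
    hess_spec := fun i j => (φ.hess_spec i j).sub (η.hess_spec i j) }

theorem H2H10.sub_toL2 (φ η : H2H10 ℓ) : (φ - η).toL2 = φ.toL2 - η.toL2 := rfl

theorem H2H10.sub_grad (φ η : H2H10 ℓ) : (φ - η).grad = φ.grad - η.grad := rfl

theorem H2H10.sub_lap (φ η : H2H10 ℓ) : (φ - η).lap = φ.lap - η.lap := by
  change φ.hess 0 0 - η.hess 0 0 + (φ.hess 1 1 - η.hess 1 1) = _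
  rw [H2H10.lap, H2H10.lap]
  abel

theorem sc_lap (hℓ : 0 < ℓ) (φ : H2H10 ℓ) (k : ℕ × ℕ) :
    sc k φ.lap = -(eig ℓ k) * sc k φ.toL2 := by
  have key : ∀ j, sc k (φ.hess j j) = -(kfreq ℓ j k ^ 2) * sc k φ.toL2 := by
    intro j
    have h1 := inner_grad_eq_neg_inner (φ.hess_spec j j) (e_mem_H10Graph hℓ k)
    rw [eGrad_apply, real_inner_smul_right, inner_grad_gC φ.mem_H10] at h1
    rw [sc, real_inner_comm]
    linarith
  rw [H2H10.lap, sc_add, key, key, eig]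
  ring

theorem hasSum_eig_sq (hℓ : 0 < ℓ) (φ : H2H10 ℓ) :
    HasSum (fun k => (eig ℓ k * sc k φ.toL2) ^ 2) (‖φ.lap‖ ^ 2) :=
  (hasSum_sc_sq hℓ φ.lap).congr_fun fun k => by rw [sc_lap hℓ]; ring

theorem H2H10.exists_essBdd (hℓ : 0 < ℓ) (φ : H2H10 ℓ) : ∃ B, 0 ≤ B ∧ EssBdd B φ.toL2 := by
  have hs := (summable_abs_mul_inv_eig hℓ (hasSum_eig_sq hℓ φ).summable)
  refine ⟨_, ?_, essBdd_of_summable hℓ (fun k => le_of_eq ?_) hs.hasSum⟩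
  · refine mul_nonneg (by positivity) (tsum_nonneg fun k => ?_)
    have := eig_pos hℓ k
    positivity
  · have := eig_pos hℓ k
    rw [abs_mul, abs_of_pos this]
    field_simp

/-- A function whose Laplacian, as a formal sine series, lies in `L²(D)` belongs to
`H²(D) ∩ H¹₀(D)`. -/
theorem exists_H2H10 (hℓ : 0 < ℓ) {c : ℕ × ℕ → ℝ} (hc : Summable fun k => (eig ℓ k * c k) ^ 2) :
    ∃ φ : H2H10 ℓ, ∀ k, sc k φ.toL2 = c k := by
  have hle : ∀ {d : ℕ × ℕ → ℝ}, (∀ k, |d k| ≤ eig ℓ k * |c k|) → Summable fun k => d k ^ 2 := by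
    intro d hd
    refine Summable.of_nonneg_of_le (fun _ => sq_nonneg _) (fun k => ?_) hc
    rw [← sq_abs, ← sq_abs (eig ℓ k * c k), abs_mul, abs_of_pos (eig_pos hℓ k)]
    exact pow_le_pow_left₀ (abs_nonneg _) (hd k) 2
  have hmul : ∀ i j k, kfreq ℓ i k * kfreq ℓ j k ≤ eig ℓ k := by
    intro i j k
    nlinarith [kfreq_sq_le_eig (ℓ := ℓ) i k, kfreq_sq_le_eig (ℓ := ℓ) j k,
      sq_nonneg (kfreq ℓ i k - kfreq ℓ j k)]
  have hm : 0 < eig ℓ (0, 0) := eig_pos hℓ _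
  have h0 : Summable fun k => c k ^ 2 := by
    have : Summable fun k => (eig ℓ (0, 0) * c k) ^ 2 := hle fun k => by
      rw [abs_mul, abs_of_pos hm]
      exact mul_le_mul_of_nonneg_right (eig_zero_le hℓ k) (abs_nonneg _)
    refine (this.mul_left ((eig ℓ (0, 0)) ^ 2)⁻¹).congr fun k => ?_
    field_simp
  have h1 : ∀ j, Summable fun k => (c k * kfreq ℓ j k) ^ 2 := by
    intro j
    have : Summable fun k => (kfreq ℓ j (0, 0) * kfreq ℓ j k * c k) ^ 2 := hle fun k => by
      have p1 := kfreq_pos hℓ j (0, 0)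
      have p2 := kfreq_pos hℓ j k
      rw [abs_mul, abs_of_pos (mul_pos p1 p2)]
      refine mul_le_mul_of_nonneg_right ?_ (abs_nonneg _)
      nlinarith [kfreq_sq_le_eig (ℓ := ℓ) j k, kfreq_sq_le_eig (ℓ := ℓ) j (0, 0), eig_zero_le hℓ k,
        sq_nonneg (kfreq ℓ j (0, 0) - kfreq ℓ j k)]
    refine (this.mul_left ((kfreq ℓ j (0, 0)) ^ 2)⁻¹).congr fun k => ?_
    have p1 := kfreq_pos hℓ j (0, 0)
    field_simp
  have h2 : ∀ i j, Summable fun k => (c k * (kfreq ℓ i k * kfreq ℓ j k)) ^ 2 := by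
    refine fun i j => hle fun k => ?_
    have p1 := kfreq_pos hℓ i k
    have p2 := kfreq_pos hℓ j k
    rw [abs_mul, abs_of_pos (mul_pos p1 p2), mul_comm]
    exact mul_le_mul_of_nonneg_right (hmul i j k) (abs_nonneg _)
  have s0 := summable_smul_of_orthonormal (orthonormal_e hℓ) h0
  have s1 : ∀ j, Summable fun k => c k • eGrad ℓ k j := fun j =>
    (summable_smul_of_orthonormal (orthonormal_g hℓ j) (h1 j)).congr fun k => by
      rw [eGrad_apply, smul_smul]
  have s2 : ∀ i j, Summable fun k => c k • (eH2 hℓ k).hess i j := by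
    intro i j
    by_cases hij : i = j
    · subst hij
      refine (summable_smul_of_orthonormal (orthonormal_e hℓ) (h2 i i)).neg.congr fun k => ?_
      simp only [eH2, if_true, smul_smul, ← neg_smul]
      congr 1
      ring
    · refine (summable_smul_of_orthonormal (orthonormal_cc hℓ) (h2 i j)).congr fun k => ?_
      simp only [eH2, if_neg hij, smul_smul]
  have hg : HasSum (fun k => c k • eGrad ℓ k)
      (WithLp.toLp 2 fun j => ∑' k, c k • eGrad ℓ k j : L2Vec ℓ) := by
    have h3 : HasSum (fun k j => c k • eGrad ℓ k j) (fun j => ∑' k, c k • eGrad ℓ k j) :=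
      Pi.hasSum.2 fun j => (s1 j).hasSum
    exact h3.mapL ((PiLp.continuousLinearEquiv 2 ℝ (fun _ : Fin 2 => L2 ℓ)).symm :
      (Fin 2 → L2 ℓ) →L[ℝ] L2Vec ℓ)
  refine ⟨{
    toL2 := ∑' k, c k • contL2 ℓ (eC ℓ k)
    grad := WithLp.toLp 2 fun j => ∑' k, c k • eGrad ℓ k j
    hess := fun i j => ∑' k, c k • (eH2 hℓ k).hess i j
    mem_H10 := ?_
    hess_spec := fun i j => ?_ }, fun k => sc_of_hasSum hℓ s0.hasSum k⟩
  · refine (testGraph ℓ).isClosed_topologicalClosure.mem_of_tendsto (s0.hasSum.prodMk hg)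
      (Eventually.of_forall fun F => ?_)
    exact (H10Graph ℓ).sum_mem fun k _ => (H10Graph ℓ).smul_mem (c k) (e_mem_H10Graph hℓ k)
  · exact HasWeakDeriv.hasSum (fun k => ((eH2 hℓ k).hess_spec i j).smul (c k)) (s1 i).hasSum
      (s2 i j).hasSum

/-! ### Stream functions -/

variable {F₁ F₂ : ℝ}

theorem IsStream.sub {q q' : HH ℓ} {ψ ψ' : Fin 2 → H2H10 ℓ} (h : IsStream F₁ F₂ q ψ)
    (h' : IsStream F₁ F₂ q' ψ') : IsStream F₁ F₂ (q - q') (fun i => ψ i - ψ' i) := by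
  refine ⟨?_, ?_⟩
  · rw [PiLp.sub_apply, h.1, h'.1, H2H10.sub_lap, H2H10.sub_toL2, H2H10.sub_toL2]
    module
  · rw [PiLp.sub_apply, h.2, h'.2, H2H10.sub_lap, H2H10.sub_toL2, H2H10.sub_toL2]
    module

/-- Each Fourier mode of the stream functions solves a `2 × 2` linear system, whose inverse is
bounded by the inverse of the eigenvalue, uniformly in `F₁` and `F₂`. -/
theorem IsStream.eig_mul_abs_sc_le (hℓ : 0 < ℓ) (hF₁ : 0 < F₁) (hF₂ : 0 < F₂) {q : HH ℓ}
    {ψ : Fin 2 → H2H10 ℓ} (h : IsStream F₁ F₂ q ψ) (i : Fin 2) (k : ℕ × ℕ) :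
    eig ℓ k * |sc k (ψ i).toL2| ≤ |sc k (q 0)| + |sc k (q 1)| := by
  have e0 := congrArg (sc k) h.1
  have e1 := congrArg (sc k) h.2
  simp only [sc_sub, sc_smul, sc_lap hℓ] at e0 e1
  have hp := eig_pos hℓ k
  set lam := eig ℓ k
  set a := sc k (ψ 0).toL2
  set b := sc k (ψ 1).toL2
  set c := sc k (q 0)
  set d := sc k (q 1)
  have hS : 0 < lam + F₁ + F₂ := by positivity
  have t1 : (lam + F₁ + F₂) * (lam * a) = -((lam + F₂) * c + F₁ * d) := by rw [e0, e1]; ring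
  have t2 : (lam + F₁ + F₂) * (lam * b) = -(F₂ * c + (lam + F₁) * d) := by rw [e0, e1]; ring
  have hc := abs_nonneg c
  have hd := abs_nonneg d
  refine le_of_mul_le_mul_left ?_ hS
  fin_cases i
  · change (lam + F₁ + F₂) * (lam * |a|) ≤ _
    rw [← abs_of_pos hp, ← abs_mul, abs_of_pos hp, ← abs_of_pos hS, ← abs_mul, abs_of_pos hS, t1,
      abs_neg]
    refine (abs_add_le _ _).trans ?_
    rw [abs_mul, abs_mul, abs_of_pos hF₁, abs_of_pos (by positivity : 0 < lam + F₂)]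
    nlinarith [mul_nonneg hF₁.le hc, mul_nonneg hF₂.le hd, mul_nonneg hp.le hd]
  · change (lam + F₁ + F₂) * (lam * |b|) ≤ _
    rw [← abs_of_pos hp, ← abs_mul, abs_of_pos hp, ← abs_of_pos hS, ← abs_mul, abs_of_pos hS, t2,
      abs_neg]
    refine (abs_add_le _ _).trans ?_
    rw [abs_mul, abs_mul, abs_of_pos hF₂, abs_of_pos (by positivity : 0 < lam + F₁)]
    nlinarith [mul_nonneg hF₁.le hc, mul_nonneg hF₂.le hd, mul_nonneg hp.le hc]

/-- The stream functions exist: in each mode they are given by Cramer's rule. -/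
theorem exists_isStream (hℓ : 0 < ℓ) (hF₁ : 0 < F₁) (hF₂ : 0 < F₂) (q : HH ℓ) :
    ∃ ψ : Fin 2 → H2H10 ℓ, IsStream F₁ F₂ q ψ := by
  have hS : ∀ k, 0 < eig ℓ k + F₁ + F₂ := fun k => by
    have := eig_pos hℓ k
    positivity
  -- Up to sign, `λ_k` times the solution combines the data with coefficients in `[0, 1]`.
  have hle : ∀ {w x y : ℕ × ℕ → ℝ}, (∀ k, 0 ≤ x k ∧ x k ≤ 1) → (∀ k, 0 ≤ y k ∧ y k ≤ 1) →
      (∀ k, w k = x k * sc k (q 0) + y k * sc k (q 1)) → Summable fun k => w k ^ 2 := by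
    intro w x y hx hy hw
    refine Summable.of_nonneg_of_le (fun _ => sq_nonneg _) (fun k => ?_)
      (((hasSum_sc_sq hℓ (q 0)).summable.mul_left 2).add
        ((hasSum_sc_sq hℓ (q 1)).summable.mul_left 2))
    obtain ⟨hx0, hx1⟩ := hx k
    obtain ⟨hy0, hy1⟩ := hy k
    have h1 : (x k * sc k (q 0)) ^ 2 ≤ sc k (q 0) ^ 2 := by
      rw [mul_pow]
      exact mul_le_of_le_one_left (sq_nonneg _) (pow_le_one₀ hx0 hx1)
    have h2 : (y k * sc k (q 1)) ^ 2 ≤ sc k (q 1) ^ 2 := by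
      rw [mul_pow]
      exact mul_le_of_le_one_left (sq_nonneg _) (pow_le_one₀ hy0 hy1)
    rw [hw]
    nlinarith [sq_nonneg (x k * sc k (q 0) - y k * sc k (q 1))]
  -- The system in the mode `k` has the determinant `λ_k (λ_k + F₁ + F₂)`.
  let c : ℕ × ℕ → ℝ := fun k =>
    -((eig ℓ k + F₂) * sc k (q 0) + F₁ * sc k (q 1)) / (eig ℓ k * (eig ℓ k + F₁ + F₂))
  let d : ℕ × ℕ → ℝ := fun k =>
    -(F₂ * sc k (q 0) + (eig ℓ k + F₁) * sc k (q 1)) / (eig ℓ k * (eig ℓ k + F₁ + F₂))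
  have hc : Summable fun k => (eig ℓ k * c k) ^ 2 := by
    have := hle (w := fun k => -(eig ℓ k * c k)) (x := fun k => (eig ℓ k + F₂) / (eig ℓ k + F₁ + F₂))
      (y := fun k => F₁ / (eig ℓ k + F₁ + F₂)) ?_ ?_ ?_
    · simpa only [neg_sq] using this
    · intro k
      have := eig_pos hℓ k
      exact ⟨by positivity, (div_le_one (hS k)).2 (by linarith)⟩
    · intro k
      have := eig_pos hℓ k
      exact ⟨by positivity, (div_le_one (hS k)).2 (by linarith)⟩
    · intro k
      have h1 := (eig_pos hℓ k).ne'
      have h2 := (hS k).ne'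
      simp only [c]
      field_simp
  have hd : Summable fun k => (eig ℓ k * d k) ^ 2 := by
    have := hle (w := fun k => -(eig ℓ k * d k)) (x := fun k => F₂ / (eig ℓ k + F₁ + F₂))
      (y := fun k => (eig ℓ k + F₁) / (eig ℓ k + F₁ + F₂)) ?_ ?_ ?_
    · simpa only [neg_sq] using this
    · intro k
      have := eig_pos hℓ k
      exact ⟨by positivity, (div_le_one (hS k)).2 (by linarith)⟩
    · intro k
      have := eig_pos hℓ k
      exact ⟨by positivity, (div_le_one (hS k)).2 (by linarith)⟩
    · intro k
      have h1 := (eig_pos hℓ k).ne'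
      have h2 := (hS k).ne'
      simp only [d]
      field_simp
  obtain ⟨φ, hφ⟩ := exists_H2H10 hℓ hc
  obtain ⟨η, hη⟩ := exists_H2H10 hℓ hd
  refine ⟨![φ, η], ?_, ?_⟩
  · refine eq_of_sc_eq hℓ fun k => ?_
    have h1 := (eig_pos hℓ k).ne'
    have h2 := (hS k).ne'
    simp only [Matrix.cons_val_zero, Matrix.cons_val_one, sc_sub, sc_smul, sc_lap hℓ, hφ, hη, c, d]
    field_simp
    ring
  · refine eq_of_sc_eq hℓ fun k => ?_
    have h1 := (eig_pos hℓ k).ne'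
    have h2 := (hS k).ne'
    simp only [Matrix.cons_val_zero, Matrix.cons_val_one, sc_sub, sc_smul, sc_lap hℓ, hφ, hη, c, d]
    field_simp
    ring

theorem norm_HH_sq (q : HH ℓ) : ‖q‖ ^ 2 = ‖q 0‖ ^ 2 + ‖q 1‖ ^ 2 := norm_vec_sq q

theorem IsStream.norm_lap_le (hℓ : 0 < ℓ) (hF₁ : 0 < F₁) (hF₂ : 0 < F₂) {q : HH ℓ}
    {ψ : Fin 2 → H2H10 ℓ} (h : IsStream F₁ F₂ q ψ) (i : Fin 2) : ‖(ψ i).lap‖ ≤ 2 * ‖q‖ := by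
  refine le_trans ?_ (mul_le_mul_of_nonneg_right (?_ : √2 ≤ 2) (norm_nonneg q))
  · refine abs_le_of_sq_le_sq' ?_ (by positivity) |>.2
    rw [mul_pow, Real.sq_sqrt (by norm_num), norm_HH_sq]
    refine hasSum_le (fun k => ?_) (hasSum_eig_sq hℓ (ψ i))
      (((hasSum_sc_sq hℓ (q 0)).add (hasSum_sc_sq hℓ (q 1))).mul_left 2)
    have h1 := h.eig_mul_abs_sc_le hℓ hF₁ hF₂ i k
    rw [← sq_abs, abs_mul, abs_of_pos (eig_pos hℓ k)]
    refine (pow_le_pow_left₀ (mul_nonneg (eig_pos hℓ k).le (abs_nonneg _)) h1 2).trans ?_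
    rw [← sq_abs (sc k (q 0)), ← sq_abs (sc k (q 1))]
    nlinarith [sq_nonneg (|sc k (q 0)| - |sc k (q 1)|)]
  · rw [Real.sqrt_le_left (by norm_num)]
    norm_num

/-- The constant of the Poincaré type inequality `‖u‖ + ‖∇u‖ ≤ C ‖Δu‖`. -/
def ellC (ℓ : ℝ) : ℝ := 1 / eig ℓ (0, 0) + 1 / √(eig ℓ (0, 0))

theorem ellC_nonneg (hℓ : 0 < ℓ) : 0 ≤ ellC ℓ := by
  have := eig_pos hℓ (0, 0)
  unfold ellC
  positivity

theorem H2H10.norm_toL2_le (hℓ : 0 < ℓ) (φ : H2H10 ℓ) : ‖φ.toL2‖ ≤ ellC ℓ * ‖φ.lap‖ := by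
  have hm := eig_pos hℓ (0, 0)
  have key : eig ℓ (0, 0) * ‖φ.toL2‖ ≤ ‖φ.lap‖ := by
    refine abs_le_of_sq_le_sq' ?_ (by positivity) |>.2
    rw [mul_pow]
    refine hasSum_le (fun k => ?_) ((hasSum_sc_sq hℓ φ.toL2).mul_left _) (hasSum_eig_sq hℓ φ)
    rw [mul_pow]
    gcongr
    exact eig_zero_le hℓ k
  calc ‖φ.toL2‖ ≤ 1 / eig ℓ (0, 0) * ‖φ.lap‖ := by
        rw [div_mul_eq_mul_div, le_div_iff₀ hm]
        linarith
    _ ≤ _ := by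
        unfold ellC
        gcongr
        exact le_add_of_nonneg_right (by positivity)

theorem H2H10.norm_grad_le (hℓ : 0 < ℓ) (φ : H2H10 ℓ) : ‖φ.grad‖ ≤ ellC ℓ * ‖φ.lap‖ := by
  have hm := eig_pos hℓ (0, 0)
  have key : √(eig ℓ (0, 0)) * ‖φ.grad‖ ≤ ‖φ.lap‖ := by
    refine abs_le_of_sq_le_sq' ?_ (by positivity) |>.2
    rw [mul_pow, Real.sq_sqrt hm.le]
    refine hasSum_le (fun k => ?_) ((hasSum_norm_grad_sq hℓ φ.mem_H10).mul_left _)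
      (hasSum_eig_sq hℓ φ)
    have := eig_zero_le hℓ k
    have hk := eig_pos hℓ k
    calc eig ℓ (0, 0) * (eig ℓ k * sc k φ.toL2 ^ 2) ≤ eig ℓ k * (eig ℓ k * sc k φ.toL2 ^ 2) := by
          gcongr
      _ = _ := by ring
  have hs : 0 < √(eig ℓ (0, 0)) := Real.sqrt_pos.2 hm
  calc ‖φ.grad‖ ≤ 1 / √(eig ℓ (0, 0)) * ‖φ.lap‖ := by
        rw [div_mul_eq_mul_div, le_div_iff₀ hs]
        linarith
    _ ≤ _ := by
        unfold ellC
        gcongr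
        exact le_add_of_nonneg_left (by positivity)

/-- A norm of `q ∈ ℍ`, weaker than that of `ℍ`, that bounds the stream functions uniformly on `D`. -/
def weakSup (q : HH ℓ) : ℝ := 2 / ℓ * ∑' k, (|sc k (q 0)| + |sc k (q 1)|) / eig ℓ k

theorem summable_weakSup (hℓ : 0 < ℓ) (q : HH ℓ) :
    Summable fun k => (|sc k (q 0)| + |sc k (q 1)|) / eig ℓ k :=
  ((summable_abs_mul_inv_eig hℓ (hasSum_sc_sq hℓ (q 0)).summable).add
    (summable_abs_mul_inv_eig hℓ (hasSum_sc_sq hℓ (q 1)).summable)).congr fun k => by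
      rw [add_div]

theorem weakSup_nonneg (hℓ : 0 < ℓ) (q : HH ℓ) : 0 ≤ weakSup q := by
  refine mul_nonneg (by positivity) (tsum_nonneg fun k => ?_)
  have := eig_pos hℓ k
  positivity

theorem IsStream.essBdd (hℓ : 0 < ℓ) (hF₁ : 0 < F₁) (hF₂ : 0 < F₂) {q : HH ℓ}
    {ψ : Fin 2 → H2H10 ℓ} (h : IsStream F₁ F₂ q ψ) (i : Fin 2) :
    EssBdd (weakSup q) (ψ i).toL2 := by
  refine essBdd_of_summable hℓ (fun k => ?_) (summable_weakSup hℓ q).hasSum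
  rw [le_div_iff₀ (eig_pos hℓ k), mul_comm]
  exact h.eig_mul_abs_sc_le hℓ hF₁ hF₂ i k

/-- The high modes contribute little to `weakSup`: a consequence of the Cauchy-Schwarz inequality. -/
theorem weakSup_le (hℓ : 0 < ℓ) (q : HH ℓ) (F : Finset (ℕ × ℕ)) :
    weakSup q ≤ 2 / ℓ * (∑ k ∈ F, (|sc k (q 0)| + |sc k (q 1)|) / eig ℓ k
      + 2 * (√(∑' k : {k // k ∉ F}, (eig ℓ k ^ 2)⁻¹) * ‖q‖)) := by
  unfold weakSup
  refine mul_le_mul_of_nonneg_left ?_ (by positivity)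
  rw [← (summable_weakSup hℓ q).sum_add_tsum_subtype_compl F]
  refine add_le_add le_rfl ?_
  set S := ∑' k : {k // k ∉ F}, (eig ℓ k ^ 2)⁻¹
  have hS : Summable fun k : {k // k ∉ F} => (eig ℓ k ^ 2)⁻¹ :=
    (summable_inv_eig_sq hℓ).subtype _
  have hS0 : 0 ≤ S := tsum_nonneg fun k => by positivity
  have key : ∀ (i : Fin 2) (G : Finset {k // k ∉ F}),
      ∑ k ∈ G, |sc k (q i)| / eig ℓ k ≤ √S * ‖q‖ := by
    intro i G
    have h1 := Finset.sum_mul_sq_le_sq_mul_sq G (fun k : {k // k ∉ F} => (eig ℓ k)⁻¹)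
      (fun k => |sc (k : ℕ × ℕ) (q i)|)
    refine abs_le_of_sq_le_sq' ?_ (by positivity) |>.2
    rw [mul_pow, Real.sq_sqrt hS0]
    have e : ∑ k ∈ G, |sc (k : ℕ × ℕ) (q i)| / eig ℓ k
        = ∑ k ∈ G, (eig ℓ k)⁻¹ * |sc (k : ℕ × ℕ) (q i)| :=
      Finset.sum_congr rfl fun k _ => by rw [div_eq_inv_mul]
    rw [e]
    refine h1.trans (mul_le_mul ?_ ?_ (Finset.sum_nonneg fun _ _ => sq_nonneg _) hS0)
    · simp only [inv_pow]
      exact hS.sum_le_tsum G fun k _ => by positivity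
    · simp only [sq_abs]
      have h2 := (hasSum_sc_sq hℓ (q i))
      have h3 : ∑ k ∈ G, sc (k : ℕ × ℕ) (q i) ^ 2 ≤
          ∑' k : {k // k ∉ F}, sc (k : ℕ × ℕ) (q i) ^ 2 :=
        Summable.sum_le_tsum G (fun _ _ => sq_nonneg _) (h2.summable.subtype _)
      refine h3.trans ?_
      have h4 := h2.summable.tsum_subtype_le (fun k => sc k (q i) ^ 2) {k | k ∉ F}
        (fun k => sq_nonneg _)
      rw [h2.tsum_eq] at h4
      exact h4.trans (pow_le_pow_left₀ (norm_nonneg _) (norm_apply_le q i) 2)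
  refine Real.tsum_le_of_sum_le (fun k => ?_) fun G => ?_
  · have := eig_pos hℓ k
    positivity
  · have h0 := key 0 G
    have h1 := key 1 G
    simp only [add_div, Finset.sum_add_distrib]
    linarith

theorem exists_weakSup_le (hℓ : 0 < ℓ) : ∃ C, 0 ≤ C ∧ ∀ q : HH ℓ, weakSup q ≤ C * ‖q‖ := by
  refine ⟨2 / ℓ * (2 * √(∑' k : {k // k ∉ (∅ : Finset (ℕ × ℕ))}, (eig ℓ k ^ 2)⁻¹)),
    by positivity, fun q => ?_⟩
  have := weakSup_le hℓ q ∅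
  rw [Finset.sum_empty, zero_add] at this
  linarith

end Stream

/-! ### The Jacobian -/

section Jacobian

variable {ℓ : ℝ}

theorem inner_contL2_mul (u : L2 ℓ) (χ η : C(ℝ × ℝ, ℝ)) :
    inner ℝ u (contL2 ℓ (χ * η)) = trip u (contL2 ℓ χ) (contL2 ℓ η) := by
  rw [inner_contL2]
  refine integral_congr_ae ?_
  filter_upwards [coeFn_contL2 (ℓ := ℓ) χ, coeFn_contL2 (ℓ := ℓ) η] with z h1 h2
  rw [h1, h2, ContinuousMap.mul_apply, mul_assoc]

theorem TestFn.contDiff_pd (j : Fin 2) (φ : TestFn ℓ) :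
    ContDiff ℝ ((⊤ : ℕ∞) : WithTop ℕ∞) (pd j φ) :=
  (φ.contDiff.fderiv_right (by simp)).clm_apply contDiff_const

/-- The product of a partial derivative of a test function with a smooth function. -/
def TestFn.pdMul (j : Fin 2) (φ : TestFn ℓ) (χ : ℝ × ℝ → ℝ)
    (hχ : ContDiff ℝ ((⊤ : ℕ∞) : WithTop ℕ∞) χ) : TestFn ℓ where
  toFun z := pd j φ z * χ z
  contDiff' := (φ.contDiff_pd j).mul hχ
  hasCompactSupport' := (φ.hasCompactSupport_pd j).mul_right
  tsupport_subset' := by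
    refine subset_trans ?_ φ.tsupport_subset
    exact (tsupport_mul_subset_left (f := pd j φ) (g := χ)).trans
      (tsupport_fderiv_apply_subset ℝ (dir j))

theorem two_le_infty : (1 + 1 : WithTop ℕ∞) ≤ ((⊤ : ℕ∞) : WithTop ℕ∞) := by
  rw [one_add_one_eq_two]
  exact ENat.LEInfty.out

theorem TestFn.pd_pd_comm (φ : TestFn ℓ) (z : ℝ × ℝ) :
    fderiv ℝ (pd 1 φ) z (dir 0) = fderiv ℝ (pd 0 φ) z (dir 1) := by
  have hd : DifferentiableAt ℝ (fderiv ℝ φ) z :=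
    ((φ.contDiff.fderiv_right (m := 1) two_le_infty).differentiable (by simp)) z
  have key : ∀ i j, fderiv ℝ (pd i φ) z (dir j) = fderiv ℝ (fderiv ℝ φ) z (dir j) (dir i) := by
    intro i j
    have h1 : HasFDerivAt (fun z => fderiv ℝ φ z (dir i)) _ z :=
      hd.hasFDerivAt.clm_apply (hasFDerivAt_const (dir i) z)
    have h2 : fderiv ℝ (pd i φ) z = _ := h1.fderiv
    rw [h2]
    simp
  rw [key, key]
  have hs : IsSymmSndFDerivAt ℝ φ z :=
    (φ.contDiff.contDiffAt (x := z)).isSymmSndFDerivAt (by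
      rw [minSmoothness_of_isRCLikeNormedField, ← one_add_one_eq_two]
      exact two_le_infty)
  exact hs _ _

theorem TestFn.pd_pdMul (i j : Fin 2) (φ : TestFn ℓ) {χ χ' : C(ℝ × ℝ, ℝ)}
    (hχ : ContDiff ℝ ((⊤ : ℕ∞) : WithTop ℕ∞) χ) (h : IsPartial j χ χ') (z : ℝ × ℝ) :
    pd j (φ.pdMul i χ hχ) z = fderiv ℝ (pd i φ) z (dir j) * χ z + pd i φ z * χ' z := by
  have d1 : HasFDerivAt (pd i φ) _ z :=
    ((φ.contDiff_pd i).differentiable (by simp) z).hasFDerivAt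
  have d2 : HasFDerivAt χ _ z := (hχ.differentiable (by simp) z).hasFDerivAt
  have d3 := (d1.mul d2).fderiv
  change fderiv ℝ (fun z => pd i φ z * χ z) z = _ at d3
  change fderiv ℝ (fun z => pd i φ z * χ z) z (dir j) = _
  rw [d3]
  simp only [_root_.add_apply, _root_.smul_apply, smul_eq_mul, h.eq]
  ring

/-- Integration by parts in the Jacobian: the derivative of `ψ` is moved to `q` and `χ`, and the
mixed second derivatives of `q` cancel. -/
theorem jacobian_by_parts {ψ : L2 ℓ} {dψ : L2Vec ℓ} (hψ : ∀ j, HasWeakDeriv j ψ (dψ j))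
    {u : L2 ℓ} {g : L2Vec ℓ} (hu : (u, g) ∈ H10Graph ℓ) {χ : C(ℝ × ℝ, ℝ)}
    {χ' : Fin 2 → C(ℝ × ℝ, ℝ)} (hχ : ContDiff ℝ ((⊤ : ℕ∞) : WithTop ℕ∞) χ)
    (h : ∀ j, IsPartial j χ (χ' j)) :
    trip (contL2 ℓ χ) (dψ 0) (g 1) - trip (contL2 ℓ χ) (dψ 1) (g 0) =
      tri ψ g (WithLp.toLp 2 fun j => contL2 ℓ (χ' j)) := by
  obtain ⟨B, hB⟩ := exists_essBdd_contL2 (ℓ := ℓ) χ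
  have hB' := fun j => exists_essBdd_contL2 (ℓ := ℓ) (χ' j)
  have hc : IsClosed {p : L2 ℓ × L2Vec ℓ |
      trip (contL2 ℓ χ) (dψ 0) (p.2 1) - trip (contL2 ℓ χ) (dψ 1) (p.2 0) =
      tri ψ p.2 (WithLp.toLp 2 fun j => contL2 ℓ (χ' j))} := by
    obtain ⟨B0, hB0⟩ := hB' 0
    obtain ⟨B1, hB1⟩ := hB' 1
    have e : ∀ p : L2 ℓ × L2Vec ℓ, tri ψ p.2 (WithLp.toLp 2 fun j => contL2 ℓ (χ' j)) =
        inner ℝ (mulBdd hB1 ψ) (p.2 0) - inner ℝ (mulBdd hB0 ψ) (p.2 1) := by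
      intro p
      rw [tri, trip_rotate, trip_rotate ψ (p.2 1), ← trip_eq_inner, ← trip_eq_inner]
    simp only [e, trip_eq_inner hB]
    refine isClosed_eq ?_ ?_ <;> fun_prop
  -- Both sides are continuous in `(u, ∇u)`, so it suffices to take a test function `φ` for `u`.
  refine hc.closure_subset_iff.2 ?_ hu
  rintro p ⟨φ, -, h2⟩
  have e2 : ∀ j, p.2 j = contL2 ℓ (φ.pdC j) := fun j =>
    Lp.ext ((h2 j).trans (coeFn_contL2 (φ.pdC j)).symm)
  have e3 : ∀ i j, trip (contL2 ℓ χ) (dψ i) (contL2 ℓ (φ.pdC j)) =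
      inner ℝ (dψ i) (contL2 ℓ (φ.pdMul j χ hχ).toC) := by
    intro i j
    rw [trip_comm, trip_rotate, ← inner_contL2_mul]
    congr 2
    ext z
    exact mul_comm _ _
  -- `∂_y (φ_x χ) - φ_x χ_y = ∂_x (φ_y χ) - φ_y χ_x`, as `φ_xy = φ_yx`.
  have e4 : contL2 ℓ ((φ.pdMul 0 χ hχ).pdC 1) + contL2 ℓ (φ.pdC 1 * χ' 0) =
      contL2 ℓ ((φ.pdMul 1 χ hχ).pdC 0) + contL2 ℓ (φ.pdC 0 * χ' 1) := by
    rw [← contL2_add, ← contL2_add]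
    congr 1
    ext z
    change pd 1 (φ.pdMul 0 χ hχ) z + pd 1 φ z * χ' 0 z = pd 0 (φ.pdMul 1 χ hχ) z + pd 0 φ z * χ' 1 z
    rw [TestFn.pd_pdMul _ _ _ _ (h 1), TestFn.pd_pdMul _ _ _ _ (h 0), TestFn.pd_pd_comm]
    ring
  have e5 := congrArg (inner ℝ ψ) e4
  rw [inner_add_right, inner_add_right, inner_contL2_mul, inner_contL2_mul,
    hasWeakDeriv_iff.1 (hψ 1), hasWeakDeriv_iff.1 (hψ 0)] at e5
  change trip (contL2 ℓ χ) (dψ 0) (p.2 1) - trip (contL2 ℓ χ) (dψ 1) (p.2 0) =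
    trip ψ (p.2 0) (contL2 ℓ (χ' 1)) - trip ψ (p.2 1) (contL2 ℓ (χ' 0))
  rw [e2, e2, e3, e3]
  linarith

theorem jacobi_eq {B : ℝ} (β : ℝ) (ψ : H2H10 ℓ) (g : L2Vec ℓ) {φ : H2H10 ℓ}
    (hφ : EssBdd B φ.toL2) :
    jacobi β ψ g φ = trip φ.toL2 (ψ.grad 0) (g 1) - trip φ.toL2 (ψ.grad 1) (g 0)
      + β * inner ℝ (ψ.grad 0) φ.toL2 := by
  rw [inner_L2, trip, trip, ← integral_const_mul,
    ← integral_sub (integrable_trip hφ _ _) (integrable_trip hφ _ _)]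
  refine Eq.trans ?_ (integral_add ((integrable_trip hφ _ _).sub (integrable_trip hφ _ _))
      ((integrable_L2_mul _ _).const_mul _))
  refine integral_congr_ae (Eventually.of_forall fun z => ?_)
  simp only
  ring

/-- The Jacobian against an eigenfunction: the quadratic part, written without derivatives of `ψ`,
and the drift `β ∂ₓψ`. -/
theorem jacobi_eH2 (hℓ : 0 < ℓ) (β : ℝ) (ψ : H2H10 ℓ) {u : L2 ℓ} {g : L2Vec ℓ}
    (hu : (u, g) ∈ H10Graph ℓ) (k : ℕ × ℕ) :
    jacobi β ψ g (eH2 hℓ k) = tri ψ.toL2 g (eGrad ℓ k)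
      + β * inner ℝ (ψ.grad 0) (contL2 ℓ (eC ℓ k)) := by
  obtain ⟨B, hB⟩ := exists_essBdd_contL2 (ℓ := ℓ) (eC ℓ k)
  rw [jacobi_eq β ψ g (φ := eH2 hℓ k) hB]
  congr 1
  exact jacobian_by_parts (fun j => hasWeakDeriv_of_mem_H10Graph ψ.mem_H10 j) hu (contDiff_eC k)
    (fun j => isPartial_eC j k)

end Jacobian

/-! ### Integrals over the time interval -/

section Time

variable {ℓ T : ℝ}

theorem timeMeasure_map (T : ℝ) :
    (timeMeasure T).map Subtype.val = (volume : Measure ℝ).restrict (Icc 0 T) :=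
  map_comap_subtype_coe measurableSet_Icc _

instance isFiniteMeasure_timeMeasure (T : ℝ) : IsFiniteMeasure (timeMeasure T) := by
  refine ⟨?_⟩
  have h := congrArg (fun m : Measure ℝ => m univ) (timeMeasure_map T)
  simp only [Measure.restrict_apply_univ] at h
  rw [Measure.map_apply measurable_subtype_coe MeasurableSet.univ, preimage_univ] at h
  rw [h]
  exact isCompact_Icc.measure_lt_top

theorem timeMeasure_real_Ioc {T : ℝ} {s t : Icc (0 : ℝ) T} (h : s ≤ t) :
    (timeMeasure T).real (Ioc s t) = t - s := by
  have e : Subtype.val ⁻¹' (Ioc (s : ℝ) t) = Ioc s t := rfl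
  rw [Measure.real, ← e, ← Measure.map_apply measurable_subtype_coe measurableSet_Ioc,
    timeMeasure_map, Measure.restrict_apply measurableSet_Ioc, inter_eq_left.2, Real.volume_Ioc,
    ENNReal.toReal_ofReal (sub_nonneg.2 h)]
  exact fun x hx => ⟨s.2.1.trans hx.1.le, hx.2.trans t.2.2⟩

theorem Iic_inter_Icc (t : Icc (0 : ℝ) T) : Iic (t : ℝ) ∩ Icc 0 T = Icc (0 : ℝ) (t : ℝ) := by
  ext x
  exact ⟨fun h => ⟨h.2.1, h.1⟩, fun h => ⟨h.2, h.1, h.2.trans t.2.2⟩⟩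

/-- The extension of a function on `[0,T]` to the line that is constant to the left of `0` and to the
right of `T`. -/
def extT (hT : 0 ≤ T) (b : Icc (0 : ℝ) T → ℝ) (x : ℝ) : ℝ := b (projIcc 0 T hT x)

theorem extT_coe (hT : 0 ≤ T) (b : Icc (0 : ℝ) T → ℝ) (t : Icc (0 : ℝ) T) : extT hT b t = b t := by
  rw [extT, projIcc_val]

theorem integrableOn_extT (hT : 0 ≤ T) {b : Icc (0 : ℝ) T → ℝ} (hb : Integrable b (timeMeasure T)) :
    IntegrableOn (extT hT b) (Icc 0 T) := by
  rw [IntegrableOn, ← timeMeasure_map,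
    (MeasurableEmbedding.subtype_coe measurableSet_Icc).integrable_map_iff]
  exact hb.congr (Eventually.of_forall fun t => (extT_coe hT b t).symm)

theorem intervalIntegrable_extT (hT : 0 ≤ T) {b : Icc (0 : ℝ) T → ℝ}
    (hb : Integrable b (timeMeasure T)) (t : Icc (0 : ℝ) T) :
    IntervalIntegrable (extT hT b) volume 0 t := by
  rw [intervalIntegrable_iff_integrableOn_Icc_of_le t.2.1]
  exact (integrableOn_extT hT hb).mono_set (Icc_subset_Icc_right t.2.2)

theorem setIntegral_Iic_eq (hT : 0 ≤ T) (b : Icc (0 : ℝ) T → ℝ) (t : Icc (0 : ℝ) T) :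
    ∫ s in Iic t, b s ∂(timeMeasure T) = ∫ x in (0 : ℝ)..t, extT hT b x := by
  have h1 := (MeasurableEmbedding.subtype_coe (measurableSet_Icc (a := (0 : ℝ)) (b := T))).setIntegral_map
    (μ := timeMeasure T) (extT hT b) (Iic (t : ℝ))
  have e : Subtype.val ⁻¹' (Iic (t : ℝ)) = Iic t := rfl
  rw [e, timeMeasure_map, Measure.restrict_restrict measurableSet_Iic] at h1
  rw [Iic_inter_Icc, integral_Icc_eq_integral_Ioc, ← intervalIntegral.integral_of_le t.2.1] at h1
  rw [h1]
  simp only [extT_coe]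

theorem time_nonneg (t : Icc (0 : ℝ) T) : 0 ≤ T := t.2.1.trans t.2.2

/-- The product rule `(a²)' = 2 a a'` for an absolutely continuous function. -/
theorem sq_eq_of_integral {b a : Icc (0 : ℝ) T → ℝ} {a₀ : ℝ} (hb : Integrable b (timeMeasure T))
    (ha : ∀ t, a t = a₀ + ∫ s in Iic t, b s ∂(timeMeasure T)) (t : Icc (0 : ℝ) T) :
    a t ^ 2 = a₀ ^ 2 + 2 * ∫ s in Iic t, a s * b s ∂(timeMeasure T) := by
  have hT := time_nonneg t
  set B : ℝ → ℝ := extT hT b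
  set F : ℝ → ℝ := fun x => a₀ + ∫ y in (0 : ℝ)..x, B y with hF
  have hBi : IntervalIntegrable B volume 0 t := intervalIntegrable_extT hT hb t
  have hFa : ∀ s : Icc (0 : ℝ) T, F s = a s := fun s => by
    rw [ha s, setIntegral_Iic_eq hT b s]
  have hac : AbsolutelyContinuousOnInterval F 0 t := by
    have h1 := hBi.absolutelyContinuousOnInterval_intervalIntegral (c := 0) (by simp)
    have h2 : AbsolutelyContinuousOnInterval (fun _ : ℝ => a₀) 0 t :=
      (LipschitzWith.const a₀).lipschitzOnWith.absolutelyContinuousOnInterval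
    exact h2.add h1
  have key := hac.integral_deriv_mul_eq_sub hac
  have hder : ∀ᵐ x, x ∈ uIoc 0 (t : ℝ) → deriv F x * F x + F x * deriv F x = 2 * (F x * B x) := by
    filter_upwards [hBi.ae_hasDerivAt_integral] with x hx hx'
    have h3 := hx (uIoc_subset_uIcc hx') 0 (by simp)
    have h4 : HasDerivAt F (B x) x := h3.const_add a₀
    rw [h4.deriv]
    ring
  rw [intervalIntegral.integral_congr_ae hder, intervalIntegral.integral_const_mul] at key
  have h0 : F 0 = a₀ := by simp [hF]
  rw [hFa t, h0] at key
  rw [setIntegral_Iic_eq hT _ t]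
  have e : ∫ x in (0 : ℝ)..t, extT hT (fun s => a s * b s) x = ∫ x in (0 : ℝ)..t, F x * B x := by
    refine intervalIntegral.integral_congr fun x hx => ?_
    rw [uIcc_of_le t.2.1] at hx
    have hx' : x ∈ Icc 0 T := ⟨hx.1, hx.2.trans t.2.2⟩
    have h5 := extT_coe hT (fun s => a s * b s) ⟨x, hx'⟩
    have h6 := extT_coe hT b ⟨x, hx'⟩
    have h7 := hFa ⟨x, hx'⟩
    simp only at h5 h6 h7 ⊢
    rw [h5, h7, ← h6]
  rw [e]
  linarith

theorem sq_integral_mul_le {α : Type*} [MeasurableSpace α] {μ : Measure α} {f g : α → ℝ}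
    (hf : MemLp f 2 μ) (hg : MemLp g 2 μ) :
    (∫ x, f x * g x ∂μ) ^ 2 ≤ (∫ x, f x ^ 2 ∂μ) * ∫ x, g x ^ 2 ∂μ := by
  have key : ∀ {f g : α → ℝ} (hf : MemLp f 2 μ) (hg : MemLp g 2 μ),
      inner ℝ (hf.toLp f) (hg.toLp g) = ∫ x, f x * g x ∂μ := by
    intro f g hf hg
    rw [L2.inner_def]
    refine integral_congr_ae ?_
    filter_upwards [hf.coeFn_toLp, hg.coeFn_toLp] with x h1 h2
    rw [h1, h2]
    simp [mul_comm]
  have h := real_inner_mul_inner_self_le (hf.toLp f) (hg.toLp g)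
  rw [key, key, key] at h
  simpa only [sq] using h

theorem integral_mul_le_sqrt {α : Type*} [MeasurableSpace α] {μ : Measure α} {f g : α → ℝ}
    (hf : MemLp f 2 μ) (hg : MemLp g 2 μ) :
    ∫ x, f x * g x ∂μ ≤ √(∫ x, f x ^ 2 ∂μ) * √(∫ x, g x ^ 2 ∂μ) := by
  rw [← Real.sqrt_mul (integral_nonneg fun _ => sq_nonneg _)]
  exact Real.le_sqrt_of_sq_le (sq_integral_mul_le hf hg)

theorem memLp_of_continuous {E : Type*} [NormedAddCommGroup E] {w : Icc (0 : ℝ) T → E}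
    (hw : Continuous w) {p : ℝ≥0∞} : MemLp w p (timeMeasure T) := by
  obtain ⟨C, hC⟩ := isCompact_univ.exists_bound_of_continuousOn hw.continuousOn
  exact MemLp.of_bound hw.aestronglyMeasurable_of_compactSpace C
    (Eventually.of_forall fun x => hC x trivial)

/-- Gronwall's inequality with a square integrable coefficient: after squaring and the
Cauchy-Schwarz inequality, the coefficient is constant. -/
theorem exists_gronwall_bound (T A N : ℝ) (hN : 0 ≤ N) : ∃ C, ∀ u : C(Icc (0 : ℝ) T, ℝ),
    ∀ ρ : Icc (0 : ℝ) T → ℝ, (∀ t, 0 ≤ u t) → MemLp ρ 2 (timeMeasure T) →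
    ∫ s, ρ s ^ 2 ∂(timeMeasure T) ≤ N →
    (∀ t, u t ≤ A + ∫ s in Iic t, ρ s * u s ∂(timeMeasure T)) → ∀ t, u t ≤ C := by
  refine ⟨√(2 * A ^ 2 + 2 * N * gronwallBound 0 (2 * N) (2 * A ^ 2) T), fun u ρ hu hρ hρN h t => ?_⟩
  have hT := time_nonneg t
  have hsq : ∀ t, u t ^ 2 ≤ 2 * A ^ 2 + 2 * N * ∫ s in Iic t, u s ^ 2 ∂(timeMeasure T) := by
    intro t
    set I := ∫ s in Iic t, ρ s * u s ∂(timeMeasure T)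
    have h1 : I ^ 2 ≤ N * ∫ s in Iic t, u s ^ 2 ∂(timeMeasure T) := by
      refine (sq_integral_mul_le (hρ.restrict _)
        ((memLp_of_continuous u.continuous).restrict _)).trans ?_
      refine mul_le_mul_of_nonneg_right ?_ (integral_nonneg fun _ => sq_nonneg _)
      exact (setIntegral_le_integral hρ.integrable_sq
        (Eventually.of_forall fun _ => sq_nonneg _)).trans hρN
    have h2 : u t ^ 2 ≤ (A + I) ^ 2 := pow_le_pow_left₀ (hu t) (h t) 2
    nlinarith [sq_nonneg (A - I)]
  set v : ℝ → ℝ := extT hT fun s => u s ^ 2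
  have hv : Continuous v := (u.continuous.pow 2).comp continuous_projIcc
  set V : ℝ → ℝ := fun x => ∫ y in (0 : ℝ)..x, v y
  have hV : ∀ x, HasDerivAt V (v x) x := fun x =>
    intervalIntegral.integral_hasDerivAt_right (hv.intervalIntegrable _ _)
      (hv.stronglyMeasurableAtFilter _ _) hv.continuousAt
  have hVt : ∀ s : Icc (0 : ℝ) T, V s = ∫ r in Iic s, u r ^ 2 ∂(timeMeasure T) := fun s =>
    (setIntegral_Iic_eq hT (fun r => u r ^ 2) s).symm
  have hg : ∀ x ∈ Icc 0 T, ‖V x‖ ≤ gronwallBound 0 (2 * N) (2 * A ^ 2) (x - 0) := by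
    refine norm_le_gronwallBound_of_norm_deriv_right_le (f' := v)
      (fun x _ => (hV x).continuousAt.continuousWithinAt) (fun x _ => (hV x).hasDerivWithinAt)
      (by simp [V]) fun x hx => ?_
    have hx' : x ∈ Icc 0 T := ⟨hx.1, hx.2.le⟩
    have h3 := hsq ⟨x, hx'⟩
    rw [← hVt] at h3
    have h4 : v x = u ⟨x, hx'⟩ ^ 2 := extT_coe hT (fun s => u s ^ 2) ⟨x, hx'⟩
    rw [Real.norm_of_nonneg (by rw [h4]; positivity), h4]
    have h5 : V x ≤ ‖V x‖ := le_abs_self _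
    have : 2 * N * V x ≤ 2 * N * ‖V x‖ := by gcongr
    linarith
  refine Real.le_sqrt_of_sq_le ((hsq t).trans ?_)
  rw [← hVt]
  have h6 : V t ≤ gronwallBound 0 (2 * N) (2 * A ^ 2) T := by
    refine (le_abs_self _).trans ((hg t t.2).trans ?_)
    rw [sub_zero]
    exact gronwallBound_mono le_rfl (by positivity) (by positivity) t.2.2
  gcongr

/-! ### The energy identity -/

/-- The partial sum, over `F`, of the sine series of `u` together with its gradient. -/
def partialGraph (F : Finset (ℕ × ℕ)) (u : L2 ℓ) : L2 ℓ × L2Vec ℓ :=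
  ∑ k ∈ F, sc k u • (contL2 ℓ (eC ℓ k), eGrad ℓ k)

theorem partialGraph_mem (hℓ : 0 < ℓ) (F : Finset (ℕ × ℕ)) (u : L2 ℓ) :
    partialGraph F u ∈ H10Graph ℓ :=
  (H10Graph ℓ).sum_mem fun k _ => (H10Graph ℓ).smul_mem _ (e_mem_H10Graph hℓ k)

theorem sc_partialGraph_sq_le (hℓ : 0 < ℓ) (F : Finset (ℕ × ℕ)) (u : L2 ℓ) (k : ℕ × ℕ) :
    sc k (partialGraph F u).1 ^ 2 ≤ sc k u ^ 2 := by
  have h : sc k (partialGraph F u).1 = if k ∈ F then sc k u else 0 := by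
    rw [partialGraph, Prod.fst_sum, sc, inner_sum]
    simp only [Prod.smul_mk, real_inner_smul_right, orthonormal_iff_ite.1 (orthonormal_e hℓ) k,
      mul_ite, mul_one, mul_zero, Finset.sum_ite_eq]
  rw [h]
  split_ifs
  · exact le_rfl
  · rw [zero_pow two_ne_zero]; exact sq_nonneg _

theorem norm_partialGraph_fst_le (hℓ : 0 < ℓ) (F : Finset (ℕ × ℕ)) (u : L2 ℓ) :
    ‖(partialGraph F u).1‖ ≤ ‖u‖ := by
  refine abs_le_of_sq_le_sq' ?_ (norm_nonneg _) |>.2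
  exact hasSum_le (sc_partialGraph_sq_le hℓ F u) (hasSum_sc_sq hℓ _) (hasSum_sc_sq hℓ u)

theorem norm_partialGraph_snd_le (hℓ : 0 < ℓ) (F : Finset (ℕ × ℕ)) {u : L2 ℓ} {g : L2Vec ℓ}
    (hu : (u, g) ∈ H10Graph ℓ) : ‖(partialGraph F u).2‖ ≤ ‖g‖ := by
  refine abs_le_of_sq_le_sq' ?_ (norm_nonneg _) |>.2
  exact hasSum_le
    (fun k => mul_le_mul_of_nonneg_left (sc_partialGraph_sq_le hℓ F u k) (eig_pos hℓ k).le)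
    (hasSum_norm_grad_sq hℓ (partialGraph_mem hℓ F u)) (hasSum_norm_grad_sq hℓ hu)

theorem tendsto_apply_partialGraph (hℓ : 0 < ℓ) {A : L2 ℓ × L2Vec ℓ →ₗ[ℝ] ℝ} {c : ℝ}
    (hA : ∀ p, |A p| ≤ c * (‖p.1‖ + ‖p.2‖)) {u : L2 ℓ} {g : L2Vec ℓ} (hu : (u, g) ∈ H10Graph ℓ) :
    Tendsto (fun F => A (partialGraph F u)) atTop (𝓝 (A (u, g))) := by
  have hc : Continuous A := by
    refine (A.mkContinuous (|c| * 2) fun p => ?_).continuous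
    rw [Real.norm_eq_abs]
    calc |A p| ≤ c * (‖p.1‖ + ‖p.2‖) := hA p
      _ ≤ |c| * (‖p‖ + ‖p‖) := by
          gcongr
          · exact le_abs_self _
          · exact norm_fst_le p
          · exact norm_snd_le p
      _ = _ := by ring
  exact (hc.tendsto _).comp (hasSum_graph hℓ hu)

theorem aestronglyMeasurable_apply_partialGraph {w : Icc (0 : ℝ) T → L2 ℓ} (hw : Continuous w)
    {A : Icc (0 : ℝ) T → L2 ℓ × L2Vec ℓ →ₗ[ℝ] ℝ}
    (hm : ∀ k, AEStronglyMeasurable (fun s => A s (contL2 ℓ (eC ℓ k), eGrad ℓ k)) (timeMeasure T))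
    (F : Finset (ℕ × ℕ)) :
    AEStronglyMeasurable (fun s => A s (partialGraph F (w s))) (timeMeasure T) := by
  have : (fun s => A s (partialGraph F (w s))) = fun s =>
      ∑ k ∈ F, sc k (w s) * A s (contL2 ℓ (eC ℓ k), eGrad ℓ k) := by
    funext s
    simp only [partialGraph, map_sum, map_smul, smul_eq_mul]
  rw [this]
  exact Finset.aestronglyMeasurable_fun_sum F fun k _ =>
    ((continuous_sc k).comp hw).aestronglyMeasurable.mul (hm k)

theorem integrable_energy (hℓ : 0 < ℓ) {w : Icc (0 : ℝ) T → L2 ℓ} (hw : Continuous w)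
    {gw : Icc (0 : ℝ) T → L2Vec ℓ} (hgw : MemLp gw 2 (timeMeasure T))
    (hH : ∀ᵐ t ∂(timeMeasure T), (w t, gw t) ∈ H10Graph ℓ)
    {A : Icc (0 : ℝ) T → L2 ℓ × L2Vec ℓ →ₗ[ℝ] ℝ} {ρ : Icc (0 : ℝ) T → ℝ}
    (hρ : MemLp ρ 2 (timeMeasure T))
    (hA : ∀ᵐ s ∂(timeMeasure T), ∀ p, |A s p| ≤ ρ s * (‖p.1‖ + ‖p.2‖))
    (hm : ∀ k, AEStronglyMeasurable (fun s => A s (contL2 ℓ (eC ℓ k), eGrad ℓ k))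
      (timeMeasure T)) :
    Integrable (fun s => A s (w s, gw s)) (timeMeasure T) := by
  refine Integrable.mono' (hρ.integrable_mul ((memLp_of_continuous hw.norm (p := 2)).add hgw.norm))
    (aestronglyMeasurable_of_tendsto_ae atTop
      (aestronglyMeasurable_apply_partialGraph hw hm) ?_) ?_
  · filter_upwards [hA, hH] with s h1 h2 using tendsto_apply_partialGraph hℓ h1 h2
  · filter_upwards [hA] with s h1 using h1 _

/-- The energy identity. If each sine coefficient of `w` satisfies `w_k' = A(s)(e_k, ∇e_k)`, where
`A(s)` is a functional on `H¹₀(D)` with norm in `L²(0,T)`, then `(‖w‖²)' = 2 A(s)(w, ∇w)`. The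
identity holds for the truncated sine series of `w`, and these converge in `H¹₀(D)`. -/
theorem energy_identity (hℓ : 0 < ℓ) {w : Icc (0 : ℝ) T → L2 ℓ} (hw : Continuous w)
    {gw : Icc (0 : ℝ) T → L2Vec ℓ} (hgw : MemLp gw 2 (timeMeasure T))
    (hH : ∀ᵐ t ∂(timeMeasure T), (w t, gw t) ∈ H10Graph ℓ) {w₀ : L2 ℓ}
    {A : Icc (0 : ℝ) T → L2 ℓ × L2Vec ℓ →ₗ[ℝ] ℝ} {ρ : Icc (0 : ℝ) T → ℝ}
    (hρ : MemLp ρ 2 (timeMeasure T))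
    (hA : ∀ᵐ s ∂(timeMeasure T), ∀ p, |A s p| ≤ ρ s * (‖p.1‖ + ‖p.2‖))
    (hm : ∀ k, AEStronglyMeasurable (fun s => A s (contL2 ℓ (eC ℓ k), eGrad ℓ k)) (timeMeasure T))
    (heq : ∀ k t, sc k (w t) = sc k w₀
      + ∫ s in Iic t, A s (contL2 ℓ (eC ℓ k), eGrad ℓ k) ∂(timeMeasure T))
    (t : Icc (0 : ℝ) T) :
    ‖w t‖ ^ 2 = ‖w₀‖ ^ 2 + 2 * ∫ s in Iic t, A s (w s, gw s) ∂(timeMeasure T) := by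
  have hint : ∀ k, Integrable (fun s => A s (contL2 ℓ (eC ℓ k), eGrad ℓ k)) (timeMeasure T) := by
    intro k
    refine Integrable.mono' ((hρ.integrable one_le_two).mul_const
      (‖contL2 ℓ (eC ℓ k)‖ + ‖eGrad ℓ k‖)) (hm k) ?_
    filter_upwards [hA] with s hs
    exact hs (contL2 ℓ (eC ℓ k), eGrad ℓ k)
  have hmeas : ∀ k, AEStronglyMeasurable
      (fun s => sc k (w s) * A s (contL2 ℓ (eC ℓ k), eGrad ℓ k)) (timeMeasure T) := fun k =>
    ((continuous_sc k).comp hw).aestronglyMeasurable.mul (hm k)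
  have hint2 : ∀ k, Integrable
      (fun s => sc k (w s) * A s (contL2 ℓ (eC ℓ k), eGrad ℓ k)) (timeMeasure T) := by
    intro k
    refine Integrable.mono' ((hρ.integrable_mul (memLp_of_continuous hw.norm (p := 2))).mul_const
      (‖contL2 ℓ (eC ℓ k)‖ + ‖eGrad ℓ k‖)) (hmeas k) ?_
    filter_upwards [hA] with s hs
    rw [norm_mul, mul_comm]
    have h1 := hs (contL2 ℓ (eC ℓ k), eGrad ℓ k)
    calc _ ≤ (ρ s * (‖contL2 ℓ (eC ℓ k)‖ + ‖eGrad ℓ k‖)) * ‖w s‖ :=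
          mul_le_mul h1 (abs_sc_le hℓ k _) (abs_nonneg _) ((abs_nonneg _).trans h1)
      _ = _ := by
          simp only [Pi.mul_apply]
          ring
  have hF : ∀ F : Finset (ℕ × ℕ), ∑ k ∈ F, sc k (w t) ^ 2 = ∑ k ∈ F, sc k w₀ ^ 2
      + 2 * ∫ s in Iic t, A s (partialGraph F (w s)) ∂(timeMeasure T) := by
    intro F
    have e : ∀ s, A s (partialGraph F (w s)) =
        ∑ k ∈ F, sc k (w s) * A s (contL2 ℓ (eC ℓ k), eGrad ℓ k) := fun s => by
      simp only [partialGraph, map_sum, map_smul, smul_eq_mul]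
    simp only [e]
    rw [integral_finsetSum F fun k _ => (hint2 k).integrableOn, Finset.mul_sum,
      ← Finset.sum_add_distrib]
    exact Finset.sum_congr rfl fun k _ => sq_eq_of_integral (hint k) (heq k) t
  have hlim : Tendsto (fun F : Finset (ℕ × ℕ) =>
      ∫ s in Iic t, A s (partialGraph F (w s)) ∂(timeMeasure T)) atTop
      (𝓝 (∫ s in Iic t, A s (w s, gw s) ∂(timeMeasure T))) := by
    refine tendsto_integral_filter_of_dominated_convergence
      (fun s => ρ s * (‖w s‖ + ‖gw s‖)) (Eventually.of_forall fun F => ?_)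
      (Eventually.of_forall fun F => ?_) ?_ ?_
    · exact (aestronglyMeasurable_apply_partialGraph hw hm F).restrict
    · refine ae_restrict_of_ae ?_
      filter_upwards [hA, hH] with s h1 h2
      refine (h1 _).trans ?_
      have h0 : 0 ≤ ρ s * (‖w s‖ + ‖gw s‖) := (abs_nonneg _).trans (h1 (w s, gw s))
      have h3 : ‖(partialGraph F (w s)).1‖ + ‖(partialGraph F (w s)).2‖ ≤ ‖w s‖ + ‖gw s‖ :=
        add_le_add (norm_partialGraph_fst_le hℓ F _) (norm_partialGraph_snd_le hℓ F h2)
      rcases le_or_gt 0 (ρ s) with h | h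
      · exact mul_le_mul_of_nonneg_left h3 h
      · exact (mul_nonpos_of_nonpos_of_nonneg h.le (by positivity)).trans h0
    · exact (hρ.integrable_mul ((memLp_of_continuous hw.norm (p := 2)).add hgw.norm)).integrableOn
    · refine ae_restrict_of_ae ?_
      filter_upwards [hA, hH] with s h1 h2 using tendsto_apply_partialGraph hℓ h1 h2
  have h1 : Tendsto (fun F : Finset (ℕ × ℕ) => ∑ k ∈ F, sc k (w t) ^ 2) atTop (𝓝 (‖w t‖ ^ 2)) :=
    hasSum_sc_sq hℓ (w t)
  have h2 : Tendsto (fun F : Finset (ℕ × ℕ) => ∑ k ∈ F, sc k w₀ ^ 2) atTop (𝓝 (‖w₀‖ ^ 2)) :=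
    hasSum_sc_sq hℓ w₀
  refine tendsto_nhds_unique h1 ?_
  simp only [hF]
  exact h2.add (hlim.const_mul 2)

end Time

/-! ### The space `H₀` and the operators in `L_Q(H₀; H)` -/

section NoiseSpace

variable {H : Type} [NormedAddCommGroup H] [InnerProductSpace ℝ H] [CompleteSpace H]

theorem H0.ofH_inv (R : H →L[ℝ] H) (h : H0 R) : H0.ofH R (H0.inv R h) = h :=
  LinearEquiv.apply_symm_apply (LinearEquiv.ofBijective _ (H0.bijective R)) h

theorem H0.norm_inv (R : H →L[ℝ] H) (h : H0 R) : ‖H0.inv R h‖ = ‖h‖ := rfl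

theorem H0.inv_mem (R : H →L[ℝ] H) (h : H0 R) :
    H0.inv R h ∈ (LinearMap.ker (R : H →ₗ[ℝ] H))ᗮ :=
  ((LinearEquiv.ofBijective _ (H0.bijective R)).symm h).2

theorem H0.inv_ofH_of_mem (R : H →L[ℝ] H) {u : H} (hu : u ∈ (LinearMap.ker (R : H →ₗ[ℝ] H))ᗮ) :
    H0.inv R (H0.ofH R u) = u :=
  congrArg Subtype.val
    (LinearEquiv.symm_apply_apply (LinearEquiv.ofBijective _ (H0.bijective R)) ⟨u, hu⟩)

theorem H0.norm_ofH_le (R : H →L[ℝ] H) (u : H) : ‖H0.ofH R u‖ ≤ ‖u‖ := by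
  rw [← H0.norm_inv]
  set v := H0.inv R (H0.ofH R u)
  have h1 : u - v ∈ LinearMap.ker (R : H →ₗ[ℝ] H) := by
    rw [LinearMap.mem_ker, map_sub, sub_eq_zero]
    exact congrArg Subtype.val (H0.ofH_inv R (H0.ofH R u)).symm
  have h2 : inner ℝ (u - v) v = 0 := (Submodule.mem_orthogonal _ _).1 (H0.inv_mem R _) _ h1
  have h3 := norm_add_sq_real (u - v) v
  rw [h2, sub_add_cancel] at h3
  refine abs_le_of_sq_le_sq' ?_ (norm_nonneg _) |>.2
  nlinarith [sq_nonneg ‖u - v‖]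

instance (R : H →L[ℝ] H) : CompleteSpace (H0 R) := by
  have hi : Isometry (H0.inv R) :=
    AddMonoidHomClass.isometry_of_norm (H0.inv R) (H0.norm_inv R)
  rw [completeSpace_iff_isComplete_range hi.isUniformInducing]
  have : range (H0.inv R) = ((LinearMap.ker (R : H →ₗ[ℝ] H))ᗮ : Submodule ℝ H) := by
    ext u
    constructor
    · rintro ⟨h, rfl⟩
      exact H0.inv_mem R h
    · exact fun hu => ⟨H0.ofH R u, H0.inv_ofH_of_mem R hu⟩
  rw [this]
  exact (Submodule.isClosed_orthogonal _).isComplete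

/-- The Hilbert-Schmidt norm of `S Q^{1/2}` bounds the operator norm of `S`. -/
theorem norm_le_of_lqNormSq_le {R : H →L[ℝ] H} {S : H0 R →L[ℝ] H} {c : ℝ} (hc : 0 ≤ c)
    (h : lqNormSq R S ≤ ENNReal.ofReal c) (x : H0 R) : ‖S x‖ ≤ √c * ‖x‖ := by
  let G : H →L[ℝ] H :=
    S ∘L (H0.ofH R).mkContinuous 1 fun u => by rw [one_mul]; exact H0.norm_ofH_le R u
  have hsum : ∀ F : Finset (stdIndex H), ∑ i ∈ F, ‖G (stdBasis H i)‖ ^ 2 ≤ c := by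
    intro F
    have h1 : ∑ i ∈ F, ‖G (stdBasis H i)‖ₑ ^ 2 ≤ ENNReal.ofReal c :=
      (ENNReal.sum_le_tsum F).trans h
    have h2 : ∑ i ∈ F, ‖G (stdBasis H i)‖ₑ ^ 2
        = ENNReal.ofReal (∑ i ∈ F, ‖G (stdBasis H i)‖ ^ 2) := by
      rw [ENNReal.ofReal_sum_of_nonneg fun _ _ => sq_nonneg _]
      refine Finset.sum_congr rfl fun i _ => ?_
      rw [ENNReal.ofReal_pow (norm_nonneg _), ofReal_norm]
    rw [h2] at h1
    exact (ENNReal.ofReal_le_ofReal_iff hc).1 h1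
  have key : ∀ u, ‖G u‖ ≤ √c * ‖u‖ := by
    intro u
    have hu := ((stdBasis H).hasSum_repr u).mapL G
    refine le_of_tendsto (Tendsto.norm hu) (Eventually.of_forall fun F => ?_)
    refine (norm_sum_le _ _).trans ?_
    simp only [map_smul, norm_smul]
    refine abs_le_of_sq_le_sq' ?_ (by positivity) |>.2
    refine (Finset.sum_mul_sq_le_sq_mul_sq F _ _).trans ?_
    rw [mul_pow, Real.sq_sqrt hc, mul_comm]
    refine mul_le_mul (hsum F) ?_ (Finset.sum_nonneg fun _ _ => sq_nonneg _) hc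
    have := (stdBasis H).orthonormal.sum_inner_products_le u (s := F)
    refine le_trans (le_of_eq (Finset.sum_congr rfl fun i _ => ?_)) this
    rw [HilbertBasis.repr_apply_apply]
  -- `x = Q^{1/2} u` for the preimage `u` of minimal norm, and `|x|₀ = ‖u‖`.
  have := key (H0.inv R x)
  rw [H0.norm_inv] at this
  refine le_trans (le_of_eq ?_) this
  change ‖S x‖ = ‖S (H0.ofH R (H0.inv R x))‖
  rw [H0.ofH_inv]

theorem NoiseAssumption.exists_growth {R : H →L[ℝ] H} {σ : H → H0 R →L[ℝ] H}
    (hσ : NoiseAssumption R σ) : ∃ K, 0 ≤ K ∧ ∀ q h, ‖σ q h‖ ≤ K * (1 + ‖q‖) * ‖h‖ := by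
  obtain ⟨K, hK, h⟩ := hσ.growth
  refine ⟨√K, Real.sqrt_nonneg _, fun q x => ?_⟩
  refine (norm_le_of_lqNormSq_le (by positivity) (h q) x).trans ?_
  rw [Real.sqrt_mul hK.le]
  gcongr
  rw [Real.sqrt_le_left (by positivity)]
  nlinarith [norm_nonneg q]

theorem NoiseAssumption.exists_lipschitz {R : H →L[ℝ] H} {σ : H → H0 R →L[ℝ] H}
    (hσ : NoiseAssumption R σ) : ∃ L, 0 ≤ L ∧ ∀ p q, ‖σ p - σ q‖ ≤ L * ‖p - q‖ := by
  obtain ⟨L, hL, h⟩ := hσ.lipschitz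
  refine ⟨√L, Real.sqrt_nonneg _, fun p q => ?_⟩
  refine ContinuousLinearMap.opNorm_le_bound _ (by positivity) fun x => ?_
  refine (norm_le_of_lqNormSq_le (by positivity) (h p q) x).trans ?_
  rw [Real.sqrt_mul hL.le, Real.sqrt_sq (norm_nonneg _)]

theorem continuous_of_norm_sub_le {α E F : Type*} [TopologicalSpace α] [NormedAddCommGroup E]
    [NormedAddCommGroup F] {a : α → E} {q : α → F} {C : ℝ} (hq : Continuous q)
    (h : ∀ s t, ‖a s - a t‖ ≤ C * ‖q s - q t‖) : Continuous a := by
  refine continuous_iff_continuousAt.2 fun t => ?_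
  rw [ContinuousAt, tendsto_iff_norm_sub_tendsto_zero]
  refine squeeze_zero (fun _ => norm_nonneg _) (fun s => h s t) ?_
  have := ((tendsto_iff_norm_sub_tendsto_zero.1 (hq.tendsto t)).const_mul C)
  rwa [mul_zero] at this

theorem NoiseAssumption.continuous_op {R : H →L[ℝ] H} {σ : H → H0 R →L[ℝ] H}
    (hσ : NoiseAssumption R σ) : Continuous σ := by
  obtain ⟨L, -, h⟩ := hσ.exists_lipschitz
  exact continuous_of_norm_sub_le (E := H0 R →L[ℝ] H) (q := fun q : H => q) continuous_id h

end NoiseSpace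

/-! ### The equation of one layer -/

section Layer

variable {ℓ T : ℝ}

/-- The functional `(v, ∇v) ↦ -ν (g, ∇v) - (J(ψ, q), v) + (z, v)` for `g = ∇q`. -/
def layerFun (ν : ℝ) {B : ℝ} {ψ : L2 ℓ} (hψ : EssBdd B ψ) (g : L2Vec ℓ) (z : L2 ℓ) :
    L2 ℓ × L2Vec ℓ →ₗ[ℝ] ℝ where
  toFun p := -ν * inner ℝ g p.2 - tri ψ g p.2 + inner ℝ z p.1
  map_add' p p' := by
    rw [Prod.snd_add, Prod.fst_add, tri_add_right hψ, inner_add_right, inner_add_right]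
    ring
  map_smul' c p := by
    rw [Prod.smul_snd, Prod.smul_fst, tri_smul_right hψ, real_inner_smul_right,
      real_inner_smul_right, RingHom.id_apply, smul_eq_mul]
    ring

theorem layerFun_apply (ν : ℝ) {B : ℝ} {ψ : L2 ℓ} (hψ : EssBdd B ψ) (g : L2Vec ℓ) (z v : L2 ℓ)
    (d : L2Vec ℓ) :
    layerFun ν hψ g z (v, d) = -ν * inner ℝ g d - tri ψ g d + inner ℝ z v := rfl

theorem abs_layerFun_le (ν : ℝ) {B : ℝ} (hB : 0 ≤ B) {ψ : L2 ℓ} (hψ : EssBdd B ψ) (g : L2Vec ℓ)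
    (z : L2 ℓ) (p : L2 ℓ × L2Vec ℓ) :
    |layerFun ν hψ g z p| ≤ ((|ν| + B) * ‖g‖ + ‖z‖) * (‖p.1‖ + ‖p.2‖) := by
  change |-ν * inner ℝ g p.2 - tri ψ g p.2 + inner ℝ z p.1| ≤ _
  have h1 := abs_real_inner_le_norm g p.2
  have h2 := abs_tri_le hB hψ g p.2
  have h3 := abs_real_inner_le_norm z p.1
  have h4 : |-ν * inner ℝ g p.2| ≤ |ν| * (‖g‖ * ‖p.2‖) := by
    rw [abs_mul, abs_neg]
    gcongr
  have h5 := abs_add_le (-ν * inner ℝ g p.2 - tri ψ g p.2) (inner ℝ z p.1)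
  have h6 := abs_sub (-ν * inner ℝ g p.2) (tri ψ g p.2)
  have h7 : 0 ≤ (|ν| + B) * ‖g‖ * ‖p.1‖ := by positivity
  have h8 : 0 ≤ ‖z‖ * ‖p.2‖ := by positivity
  nlinarith

/-- The weak form of `∂ₜq + J(ψ, q) = ν Δq + z`, `q(0) = ξ`, for the potential vorticity `q` of one
layer with gradient `g`, tested with the eigenfunctions, for paths of the regularity of `X`. -/
structure LayerEq (T ν : ℝ) (ξ : L2 ℓ) (q : Icc (0 : ℝ) T → L2 ℓ) (g : Icc (0 : ℝ) T → L2Vec ℓ)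
    (ψ z : Icc (0 : ℝ) T → L2 ℓ) : Prop where
  cont_q : Continuous q
  cont_ψ : Continuous ψ
  memLp_g : MemLp g 2 (timeMeasure T)
  memLp_z : MemLp z 2 (timeMeasure T)
  mem_graph : ∀ᵐ s ∂(timeMeasure T), (q s, g s) ∈ H10Graph ℓ
  bdd : ∃ B, 0 ≤ B ∧ ∀ s, EssBdd B (ψ s)
  eq : ∀ k t, sc k (q t) = sc k ξ + ∫ s in Iic t, (-ν * inner ℝ (g s) (eGrad ℓ k)
    - tri (ψ s) (g s) (eGrad ℓ k) + inner ℝ (z s) (contL2 ℓ (eC ℓ k))) ∂(timeMeasure T)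

theorem aestronglyMeasurable_apply {g : Icc (0 : ℝ) T → L2Vec ℓ}
    (hg : AEStronglyMeasurable g (timeMeasure T)) (j : Fin 2) :
    AEStronglyMeasurable (fun s => g s j) (timeMeasure T) :=
  (PiLp.continuous_apply 2 (fun _ : Fin 2 => L2 ℓ) j).comp_aestronglyMeasurable hg

theorem aestronglyMeasurable_inner_const {E : Type*} [NormedAddCommGroup E] [InnerProductSpace ℝ E]
    {z : Icc (0 : ℝ) T → E} (hz : AEStronglyMeasurable z (timeMeasure T)) (e : E) :
    AEStronglyMeasurable (fun s => (inner ℝ (z s) e : ℝ)) (timeMeasure T) :=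
  hz.inner aestronglyMeasurable_const

theorem aestronglyMeasurable_tri {ψ : Icc (0 : ℝ) T → L2 ℓ} {g : Icc (0 : ℝ) T → L2Vec ℓ}
    (hψ : Continuous ψ) (hg : AEStronglyMeasurable g (timeMeasure T)) (k : ℕ × ℕ) :
    AEStronglyMeasurable (fun s => tri (ψ s) (g s) (eGrad ℓ k)) (timeMeasure T) := by
  have key : ∀ i j, AEStronglyMeasurable (fun s => trip (ψ s) (g s i) (eGrad ℓ k j))
      (timeMeasure T) := by
    intro i j
    obtain ⟨B, hB⟩ := exists_essBdd_contL2 (ℓ := ℓ) (kfreq ℓ j k • gC ℓ j k)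
    have e : ∀ s, trip (ψ s) (g s i) (eGrad ℓ k j) = inner ℝ (mulBdd hB (ψ s)) (g s i) := by
      intro s
      rw [← trip_eq_inner, trip_rotate, eGrad_apply, contL2_smul]
    simp only [e]
    exact (((mulBdd hB).continuous.comp hψ).aestronglyMeasurable).inner
      (aestronglyMeasurable_apply hg i)
  exact (key 0 1).sub (key 1 0)

variable {ν : ℝ} {ξ : L2 ℓ} {q q' : Icc (0 : ℝ) T → L2 ℓ} {g g' : Icc (0 : ℝ) T → L2Vec ℓ}
  {ψ ψ' z z' : Icc (0 : ℝ) T → L2 ℓ}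

theorem memLp_layerCoef (hc : Continuous ψ) (hg : MemLp g 2 (timeMeasure T))
    (hz : MemLp z 2 (timeMeasure T)) (hψ : ∃ B, 0 ≤ B ∧ ∀ s, EssBdd B (ψ s)) (k : ℕ × ℕ) :
    MemLp (fun s => -ν * inner ℝ (g s) (eGrad ℓ k)
    - tri (ψ s) (g s) (eGrad ℓ k) + inner ℝ (z s) (contL2 ℓ (eC ℓ k))) 2 (timeMeasure T) := by
  obtain ⟨B, hB, hψ⟩ := hψ
  refine MemLp.of_le_mul (c := ‖contL2 ℓ (eC ℓ k)‖ + ‖eGrad ℓ k‖)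
    ((hg.norm.const_mul (|ν| + B)).add hz.norm) ?_ (Eventually.of_forall fun s => ?_)
  · exact (((aestronglyMeasurable_inner_const hg.1 _).const_mul (-ν)).sub
      (aestronglyMeasurable_tri hc hg.1 k)).add (aestronglyMeasurable_inner_const hz.1 _)
  · have := abs_layerFun_le ν hB (hψ s) (g s) (z s) (contL2 ℓ (eC ℓ k), eGrad ℓ k)
    refine this.trans ?_
    rw [mul_comm]
    exact mul_le_mul_of_nonneg_left (le_abs_self _) (by positivity)

theorem LayerEq.memLp_coef (h : LayerEq T ν ξ q g ψ z) (k : ℕ × ℕ) :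
    MemLp (fun s => -ν * inner ℝ (g s) (eGrad ℓ k)
    - tri (ψ s) (g s) (eGrad ℓ k) + inner ℝ (z s) (contL2 ℓ (eC ℓ k))) 2 (timeMeasure T) :=
  memLp_layerCoef h.cont_ψ h.memLp_g h.memLp_z h.bdd k

theorem LayerEq.energy (hℓ : 0 < ℓ) (h : LayerEq T ν ξ q g ψ z) (t : Icc (0 : ℝ) T) :
    ‖q t‖ ^ 2 = ‖ξ‖ ^ 2
      + 2 * ∫ s in Iic t, (-ν * ‖g s‖ ^ 2 + inner ℝ (z s) (q s)) ∂(timeMeasure T) := by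
  obtain ⟨B, hB, hψ⟩ := h.bdd
  rw [energy_identity hℓ h.cont_q h.memLp_g h.mem_graph (w₀ := ξ)
    (A := fun s => layerFun ν (hψ s) (g s) (z s)) (ρ := fun s => (|ν| + B) * ‖g s‖ + ‖z s‖)
    ((h.memLp_g.norm.const_mul (|ν| + B)).add h.memLp_z.norm)
    (Eventually.of_forall fun s p => abs_layerFun_le ν hB (hψ s) (g s) (z s) p)
    (fun k => (h.memLp_coef k).1) h.eq t]
  simp only [layerFun_apply, tri_self, real_inner_self_eq_norm_sq, sub_zero]

/-- The energy identity for the difference of two solutions. By `J(ψ', q - q')` being orthogonal to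
`q - q'`, only the difference of the stream functions remains in the nonlinear term. -/
theorem LayerEq.energy_sub (hℓ : 0 < ℓ) (h : LayerEq T ν ξ q g ψ z)
    (h' : LayerEq T ν ξ q' g' ψ' z') :
    Integrable (fun s => -ν * ‖g s - g' s‖ ^ 2 - tri (ψ s - ψ' s) (g s) (g s - g' s)
      + inner ℝ (z s - z' s) (q s - q' s)) (timeMeasure T) ∧
    ∀ t, ‖q t - q' t‖ ^ 2 = 2 * ∫ s in Iic t, (-ν * ‖g s - g' s‖ ^ 2
      - tri (ψ s - ψ' s) (g s) (g s - g' s) + inner ℝ (z s - z' s) (q s - q' s))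
        ∂(timeMeasure T) := by
  obtain ⟨B, hB, hψ⟩ := h.bdd
  obtain ⟨B', hB', hψ'⟩ := h'.bdd
  have hm : ∀ᵐ s ∂(timeMeasure T), (q s - q' s, g s - g' s) ∈ H10Graph ℓ := by
    filter_upwards [h.mem_graph, h'.mem_graph] with s h1 h2
    exact (H10Graph ℓ).sub_mem h1 h2
  let A := fun s => layerFun ν (hψ s) (g s) (z s) - layerFun ν (hψ' s) (g' s) (z' s)
  have hA : ∀ s p, |A s p| ≤ (((|ν| + B) * ‖g s‖ + ‖z s‖) + ((|ν| + B') * ‖g' s‖ + ‖z' s‖))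
      * (‖p.1‖ + ‖p.2‖) := by
    intro s p
    rw [LinearMap.sub_apply, add_mul]
    exact (abs_sub _ _).trans (add_le_add (abs_layerFun_le ν hB (hψ s) (g s) (z s) p)
      (abs_layerFun_le ν hB' (hψ' s) (g' s) (z' s) p))
  have hρ : MemLp (fun s => ((|ν| + B) * ‖g s‖ + ‖z s‖) + ((|ν| + B') * ‖g' s‖ + ‖z' s‖)) 2
      (timeMeasure T) := ((h.memLp_g.norm.const_mul (|ν| + B)).add h.memLp_z.norm).add
      ((h'.memLp_g.norm.const_mul (|ν| + B')).add h'.memLp_z.norm)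
  have e : ∀ s, A s (q s - q' s, g s - g' s) = -ν * ‖g s - g' s‖ ^ 2
      - tri (ψ s - ψ' s) (g s) (g s - g' s) + inner ℝ (z s - z' s) (q s - q' s) := by
    intro s
    change layerFun ν (hψ s) (g s) (z s) (q s - q' s, g s - g' s)
      - layerFun ν (hψ' s) (g' s) (z' s) (q s - q' s, g s - g' s) = _
    have e1 := tri_sub_left (hψ s) (hψ' s) (g s) (g s - g' s)
    -- `J(ψ, q) - J(ψ', q') = J(ψ - ψ', q) + J(ψ', q - q')`, and the last term is orthogonal
    -- to `q - q'`.
    have e2 := tri_sub_middle (hψ' s) (g s) (g' s) (g s - g' s)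
    rw [tri_self] at e2
    have e3 := real_inner_self_eq_norm_sq (g s - g' s)
    rw [inner_sub_left] at e3
    rw [layerFun_apply, layerFun_apply, ← e3, e1, inner_sub_left]
    linear_combination e2
  have hmeas : ∀ k, AEStronglyMeasurable (fun s => A s (contL2 ℓ (eC ℓ k), eGrad ℓ k))
      (timeMeasure T) := fun k => (h.memLp_coef k).1.sub (h'.memLp_coef k).1
  simp only [← e]
  refine ⟨integrable_energy hℓ (h.cont_q.sub h'.cont_q) (h.memLp_g.sub h'.memLp_g) hm hρ
    (Eventually.of_forall hA) hmeas, fun t => ?_⟩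
  have key := energy_identity hℓ (h.cont_q.sub h'.cont_q) (h.memLp_g.sub h'.memLp_g) hm (w₀ := 0)
    hρ (Eventually.of_forall hA) hmeas
    (fun k t => by
      have e1 := h.eq k t
      have e2 := h'.eq k t
      simp only [A, LinearMap.sub_apply, layerFun_apply]
      rw [integral_sub ((h.memLp_coef k).integrable one_le_two).integrableOn
        ((h'.memLp_coef k).integrable one_le_two).integrableOn]
      change sc k (q t - q' t) = _
      have e0 : sc k (0 : L2 ℓ) = 0 := inner_zero_right _
      rw [sc_sub, e1, e2, e0]
      ring) t
  rw [norm_zero, zero_pow two_ne_zero, zero_add] at key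
  exact key

/-- The Fourier coefficients of solutions are Hölder continuous in time, uniformly for bounded
data. -/
theorem LayerEq.abs_sc_sub_le (h : LayerEq T ν ξ q g ψ z) {B N : ℝ} (hB : 0 ≤ B)
    (hψ : ∀ s, EssBdd B (ψ s)) (hg : ∫ s, ‖g s‖ ^ 2 ∂(timeMeasure T) ≤ N)
    (hz : ∫ s, ‖z s‖ ^ 2 ∂(timeMeasure T) ≤ N) (k : ℕ × ℕ) {s t : Icc (0 : ℝ) T} (hst : s ≤ t) :
    |sc k (q t) - sc k (q s)| ≤
      √(t - s) * √(2 * (‖contL2 ℓ (eC ℓ k)‖ + ‖eGrad ℓ k‖) ^ 2 * ((|ν| + B) ^ 2 + 1) * N) := by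
  set b := fun s => -ν * inner ℝ (g s) (eGrad ℓ k)
    - tri (ψ s) (g s) (eGrad ℓ k) + inner ℝ (z s) (contL2 ℓ (eC ℓ k))
  set c := ‖contL2 ℓ (eC ℓ k)‖ + ‖eGrad ℓ k‖
  have hb : MemLp b 2 (timeMeasure T) := h.memLp_coef k
  have hbi := hb.integrable one_le_two
  have e : sc k (q t) - sc k (q s) = ∫ r in Ioc s t, 1 * b r ∂(timeMeasure T) := by
    rw [h.eq k t, h.eq k s, add_sub_add_left_eq_sub, ← Iic_union_Ioc_eq_Iic hst,
      setIntegral_union (Iic_disjoint_Ioc le_rfl) measurableSet_Ioc hbi.integrableOn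
        hbi.integrableOn, add_sub_cancel_left]
    simp only [one_mul]
  have h1 := sq_integral_mul_le (μ := (timeMeasure T).restrict (Ioc s t)) (f := fun _ => 1)
    (memLp_const 1) (hb.restrict (Ioc s t))
  rw [← e] at h1
  simp only [one_pow, integral_const, smul_eq_mul, mul_one, measureReal_restrict_apply_univ,
    timeMeasure_real_Ioc hst] at h1
  rw [← Real.sqrt_mul (sub_nonneg.2 hst)]
  refine Real.abs_le_sqrt (h1.trans (mul_le_mul_of_nonneg_left ?_ (sub_nonneg.2 hst)))
  refine (setIntegral_le_integral hb.integrable_sq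
    (Eventually.of_forall fun _ => sq_nonneg _)).trans ?_
  have hgi : Integrable (fun r => ‖g r‖ ^ 2) (timeMeasure T) := h.memLp_g.norm.integrable_sq
  have hzi : Integrable (fun r => ‖z r‖ ^ 2) (timeMeasure T) := h.memLp_z.norm.integrable_sq
  calc ∫ r, b r ^ 2 ∂(timeMeasure T)
      ≤ ∫ r, (2 * c ^ 2 * (|ν| + B) ^ 2 * ‖g r‖ ^ 2 + 2 * c ^ 2 * ‖z r‖ ^ 2) ∂(timeMeasure T) := by
        refine integral_mono hb.integrable_sq ((hgi.const_mul _).add (hzi.const_mul _)) fun r => ?_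
        have h2 := abs_layerFun_le ν hB (hψ r) (g r) (z r) (contL2 ℓ (eC ℓ k), eGrad ℓ k)
        have h3 : b r ^ 2 ≤ (((|ν| + B) * ‖g r‖ + ‖z r‖) * c) ^ 2 := by
          rw [← sq_abs]
          exact pow_le_pow_left₀ (abs_nonneg _) h2 2
        refine h3.trans ?_
        rw [mul_pow]
        nlinarith [mul_nonneg (sq_nonneg c) (sq_nonneg ((|ν| + B) * ‖g r‖ - ‖z r‖))]
    _ = 2 * c ^ 2 * (|ν| + B) ^ 2 * ∫ r, ‖g r‖ ^ 2 ∂(timeMeasure T)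
        + 2 * c ^ 2 * ∫ r, ‖z r‖ ^ 2 ∂(timeMeasure T) := by
        rw [integral_add (hgi.const_mul _) (hzi.const_mul _), integral_const_mul,
          integral_const_mul]
    _ ≤ 2 * c ^ 2 * (|ν| + B) ^ 2 * N + 2 * c ^ 2 * N := by gcongr
    _ = _ := by ring

end Layer

/-! ### Weak solutions as solutions of the layer equations -/

section Solutions

variable {ℓ T F₁ F₂ : ℝ}

/-- The coupling constant of the layer `i`. -/
def coupling (F₁ F₂ : ℝ) (i : Fin 2) : ℝ := if i = 0 then F₁ else F₂

theorem IsStream.apply {q : HH ℓ} {ψ : Fin 2 → H2H10 ℓ} (h : IsStream F₁ F₂ q ψ) (i : Fin 2) :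
    q i = (ψ i).lap - coupling F₁ F₂ i • ((ψ i).toL2 - (ψ (1 - i)).toL2) := by
  fin_cases i
  · exact h.1
  · exact h.2

/-- The terms of order zero in the equation of the layer `i`: the terms `±ν F_i Δ(ψ₁ - ψ₂)` in
`ν Δ²ψ_i - ν Δq_i`, the drift `β ∂ₓψ_i`, the forcing or the friction, and the control `m`. -/
def layerSource (F₁ F₂ ν β r : ℝ) (ψ : Fin 2 → H2H10 ℓ) (fs : L2 ℓ) (m : HH ℓ) (i : Fin 2) : L2 ℓ :=
  (ν * coupling F₁ F₂ i) • ((ψ i).lap - (ψ (1 - i)).lap) - β • (ψ i).grad 0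
    + (if i = 0 then fs else (-r) • (ψ 1).lap) + m i

/-- The constant in the bound of the terms of order zero. -/
def sourceC (ℓ F₁ F₂ ν β r : ℝ) : ℝ := 4 * (|ν| * (F₁ + F₂)) + 2 * (|β| * ellC ℓ) + 2 * |r|

theorem sourceC_nonneg (hℓ : 0 < ℓ) (hF₁ : 0 < F₁) (hF₂ : 0 < F₂) (ν β r : ℝ) :
    0 ≤ sourceC ℓ F₁ F₂ ν β r := by
  have := ellC_nonneg hℓ
  unfold sourceC
  positivity

theorem norm_layerSource_le (hℓ : 0 < ℓ) (hF₁ : 0 < F₁) (hF₂ : 0 < F₂) (ν β r : ℝ) {q : HH ℓ}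
    {ψ : Fin 2 → H2H10 ℓ} (h : IsStream F₁ F₂ q ψ) (fs : L2 ℓ) (m : HH ℓ) (i : Fin 2) :
    ‖layerSource F₁ F₂ ν β r ψ fs m i‖ ≤ sourceC ℓ F₁ F₂ ν β r * ‖q‖ + ‖fs‖ + ‖m‖ := by
  have hl := fun j => h.norm_lap_le hℓ hF₁ hF₂ j
  have hg : ‖(ψ i).grad 0‖ ≤ ellC ℓ * (2 * ‖q‖) :=
    (norm_apply_le _ _).trans (((ψ i).norm_grad_le hℓ).trans
      (mul_le_mul_of_nonneg_left (hl i) (ellC_nonneg hℓ)))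
  have hc : |coupling F₁ F₂ i| ≤ F₁ + F₂ := by
    unfold coupling
    split_ifs
    · rw [abs_of_pos hF₁]; linarith
    · rw [abs_of_pos hF₂]; linarith
  have h1 : ‖(ν * coupling F₁ F₂ i) • ((ψ i).lap - (ψ (1 - i)).lap)‖
      ≤ 4 * (|ν| * (F₁ + F₂)) * ‖q‖ := by
    rw [norm_smul, norm_mul]
    calc _ ≤ (|ν| * (F₁ + F₂)) * (2 * ‖q‖ + 2 * ‖q‖) := by
          gcongr
          · exact le_rfl
          · exact hc
          · exact (norm_sub_le _ _).trans (add_le_add (hl _) (hl _))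
      _ = _ := by ring
  have h2 : ‖β • (ψ i).grad 0‖ ≤ 2 * (|β| * ellC ℓ) * ‖q‖ := by
    rw [norm_smul]
    calc _ ≤ |β| * (ellC ℓ * (2 * ‖q‖)) := by gcongr; exact le_rfl
      _ = _ := by ring
  have h3 : ‖(if i = 0 then fs else (-r) • (ψ 1).lap : L2 ℓ)‖ ≤ 2 * |r| * ‖q‖ + ‖fs‖ := by
    split_ifs
    · exact le_add_of_nonneg_left (by positivity)
    · rw [norm_smul, norm_neg]
      have : ‖r‖ * ‖(ψ 1).lap‖ ≤ |r| * (2 * ‖q‖) := by gcongr; exacts [le_rfl, hl 1]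
      linarith [norm_nonneg fs]
  have h4 : ‖m i‖ ≤ ‖m‖ := norm_apply_le m i
  unfold layerSource sourceC
  refine (norm_add_le _ _).trans ?_
  refine (add_le_add ((norm_add_le _ _).trans (add_le_add (norm_sub_le _ _) le_rfl)) le_rfl).trans ?_
  linarith

theorem jacobi_zero (β : ℝ) (ψ : H2H10 ℓ) (g : L2Vec ℓ) : jacobi β ψ g 0 = 0 := by
  rw [jacobi, ← integral_zero (ℝ × ℝ) ℝ (μ := volume.restrict (square ℓ : Set (ℝ × ℝ)))]
  refine integral_congr_ae ?_
  filter_upwards [Lp.coeFn_zero ℝ 2 (volume.restrict (square ℓ : Set (ℝ × ℝ)))] with z hz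
  rw [H2H10.zero_toL2, hz, Pi.zero_apply, mul_zero]

/-- The test function that is the eigenfunction with index `k` in the layer `i` and vanishes in the
other one. -/
def layerTest (hℓ : 0 < ℓ) (i : Fin 2) (k : ℕ × ℕ) (j : Fin 2) : H2H10 ℓ :=
  if j = i then eH2 hℓ k else 0

theorem inner_toHH_layerTest (hℓ : 0 < ℓ) (q : HH ℓ) (i : Fin 2) (k : ℕ × ℕ) :
    inner ℝ q (toHH (layerTest hℓ i k)) = sc k (q i) := by
  rw [real_inner_comm, PiLp.inner_apply, Fin.sum_univ_two, sc]
  fin_cases i <;> simp [toHH, layerTest, H2H10.zero_toL2, eH2]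

/-- The integrand in the weak formulation, with an eigenfunction of one layer as a test function. -/
theorem weak_integrand (hℓ : 0 < ℓ) (ν β r : ℝ) {q : HH ℓ} {g : GradHH ℓ} {ψ : Fin 2 → H2H10 ℓ}
    (h : IsStream F₁ F₂ q ψ) (hg : ∀ i, (q i, g i) ∈ H10Graph ℓ) (fs : L2 ℓ) (m : HH ℓ)
    (i : Fin 2) (k : ℕ × ℕ) :
    inner ℝ m (toHH (layerTest hℓ i k)) -
      (∑ j, (jacobi β (ψ j) (g j) (layerTest hℓ i k j)
        - ν * inner ℝ (ψ j).lap (layerTest hℓ i k j).lap)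
        - inner ℝ fs (layerTest hℓ i k 0).toL2 + r * inner ℝ (ψ 1).lap (layerTest hℓ i k 1).toL2) =
    -ν * inner ℝ (g i) (eGrad ℓ k) - tri (ψ i).toL2 (g i) (eGrad ℓ k)
      + inner ℝ (layerSource F₁ F₂ ν β r ψ fs m i) (contL2 ℓ (eC ℓ k)) := by
  have hsum : ∑ j, (jacobi β (ψ j) (g j) (layerTest hℓ i k j)
        - ν * inner ℝ (ψ j).lap (layerTest hℓ i k j).lap) =
      jacobi β (ψ i) (g i) (eH2 hℓ k) - ν * inner ℝ (ψ i).lap (eH2 hℓ k).lap := by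
    rw [Finset.sum_eq_single i]
    · rw [layerTest, if_pos rfl]
    · intro j _ hj
      rw [layerTest, if_neg hj, jacobi_zero, H2H10.zero_lap, inner_zero_right]
      ring
    · exact fun h => absurd (Finset.mem_univ i) h
  have e0 := congrArg (sc k) (h.apply i)
  rw [sc_sub, sc_smul, sc_sub] at e0
  have hlap := fun j => sc_lap hℓ (ψ j) k
  have hf : (if i = 0 then sc k fs else -r * sc k (ψ 1).lap)
      = inner ℝ fs (layerTest hℓ i k 0).toL2 - r * inner ℝ (ψ 1).lap (layerTest hℓ i k 1).toL2 := by
    rw [real_inner_comm, real_inner_comm _ (ψ 1).lap]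
    fin_cases i <;> simp [layerTest, H2H10.zero_toL2, eH2, sc]
  have hs : inner ℝ (layerSource F₁ F₂ ν β r ψ fs m i) (contL2 ℓ (eC ℓ k)) =
      ν * coupling F₁ F₂ i * (sc k (ψ i).lap - sc k (ψ (1 - i)).lap) - β * sc k ((ψ i).grad 0)
      + (if i = 0 then sc k fs else -r * sc k (ψ 1).lap) + sc k (m i) := by
    rw [real_inner_comm]
    change sc k _ = _
    rw [layerSource, sc_add, sc_add, sc_sub, sc_smul, sc_smul, sc_sub]
    split_ifs
    · rfl
    · rw [sc_smul]
  rw [inner_toHH_layerTest, hsum, jacobi_eH2 hℓ β (ψ i) (hg i), eH2_lap, real_inner_smul_right,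
    real_inner_comm, real_inner_comm _ (ψ i).lap, inner_grad_eGrad (hg i), hs, hf]
  change sc k (m i) - ((_ + β * sc k _ - ν * (_ * sc k (ψ i).lap)) - _ + _) = _
  rw [e0, hlap, hlap]
  ring

theorem exists_norm_le_of_continuous {E : Type*} [NormedAddCommGroup E] {q : Icc (0 : ℝ) T → E}
    (hq : Continuous q) : ∃ C, 0 ≤ C ∧ ∀ t, ‖q t‖ ≤ C := by
  obtain ⟨C, hC⟩ := isCompact_univ.exists_bound_of_continuousOn hq.continuousOn
  exact ⟨max C 0, le_max_right _ _, fun t => (hC t trivial).trans (le_max_left _ _)⟩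

theorem aestronglyMeasurable_clm_apply {E F : Type*} [NormedAddCommGroup E] [NormedSpace ℝ E]
    [NormedAddCommGroup F] [NormedSpace ℝ F] {A : Icc (0 : ℝ) T → E →L[ℝ] F} (hA : Continuous A)
    {h : Icc (0 : ℝ) T → E} (hh : AEStronglyMeasurable h (timeMeasure T)) :
    AEStronglyMeasurable (fun s => A s (h s)) (timeMeasure T) :=
  isBoundedBilinearMap_apply.continuous.comp_aestronglyMeasurable
    (hA.aestronglyMeasurable_of_compactSpace.prodMk hh)

/-- The path of the operators `σ(q)` applied to the control. -/
theorem memLp_control {R : HH ℓ →L[ℝ] HH ℓ} {σ : HH ℓ → H0 R →L[ℝ] HH ℓ}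
    (hσ : NoiseAssumption R σ) {q : Icc (0 : ℝ) T → HH ℓ} (hq : Continuous q)
    (h : Lp (H0 R) 2 (timeMeasure T)) : MemLp (fun s => σ (q s) (h s)) 2 (timeMeasure T) := by
  obtain ⟨K, hK, hg⟩ := hσ.exists_growth
  obtain ⟨C, hC, hqC⟩ := exists_norm_le_of_continuous hq
  refine (Lp.memLp h).of_le_mul (c := K * (1 + C)) ?_ (Eventually.of_forall fun s => ?_)
  · exact aestronglyMeasurable_clm_apply (hσ.continuous_op.comp hq) (Lp.memLp h).1
  · refine (hg _ _).trans ?_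
    gcongr
    exact hqC s

theorem X.continuous_val (q : X ℓ T) : Continuous (X.val q) :=
  (q : WithLp 2 (C(Icc (0 : ℝ) T, HH ℓ) × Lp (GradHH ℓ) 2 (timeMeasure T))).fst.continuous

theorem X.memLp_grad (q : X ℓ T) : MemLp (X.grad q) 2 (timeMeasure T) :=
  Lp.memLp (q : WithLp 2 (C(Icc (0 : ℝ) T, HH ℓ) × Lp (GradHH ℓ) 2 (timeMeasure T))).snd

theorem X.mem_graph (q : X ℓ T) :
    ∀ᵐ t ∂(timeMeasure T), ∀ i, (X.val q t i, X.grad q t i) ∈ H10Graph ℓ := q.2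

theorem X.memLp_grad_apply (q : X ℓ T) (i : Fin 2) :
    MemLp (fun s => X.grad q s i) 2 (timeMeasure T) :=
  (X.memLp_grad q).mono
    ((PiLp.continuous_apply 2 (fun _ : Fin 2 => L2Vec ℓ) i).comp_aestronglyMeasurable
      (X.memLp_grad q).1)
    (Eventually.of_forall fun s => PiLp.norm_apply_le (X.grad q s) i)

variable {q : Icc (0 : ℝ) T → HH ℓ} {ψ : Icc (0 : ℝ) T → Fin 2 → H2H10 ℓ}

theorem continuous_stream_lap (hℓ : 0 < ℓ) (hF₁ : 0 < F₁) (hF₂ : 0 < F₂) (hq : Continuous q)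
    (hψ : ∀ t, IsStream F₁ F₂ (q t) (ψ t)) (i : Fin 2) : Continuous fun t => (ψ t i).lap :=
  continuous_of_norm_sub_le hq fun s t => by
    rw [← H2H10.sub_lap]
    exact ((hψ s).sub (hψ t)).norm_lap_le hℓ hF₁ hF₂ i

theorem continuous_stream_grad (hℓ : 0 < ℓ) (hF₁ : 0 < F₁) (hF₂ : 0 < F₂) (hq : Continuous q)
    (hψ : ∀ t, IsStream F₁ F₂ (q t) (ψ t)) (i : Fin 2) : Continuous fun t => (ψ t i).grad :=
  continuous_of_norm_sub_le (continuous_stream_lap hℓ hF₁ hF₂ hq hψ i) fun s t => by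
    rw [← H2H10.sub_grad, ← H2H10.sub_lap]
    exact H2H10.norm_grad_le hℓ _

theorem continuous_stream (hℓ : 0 < ℓ) (hF₁ : 0 < F₁) (hF₂ : 0 < F₂) (hq : Continuous q)
    (hψ : ∀ t, IsStream F₁ F₂ (q t) (ψ t)) (i : Fin 2) : Continuous fun t => (ψ t i).toL2 :=
  continuous_of_norm_sub_le (continuous_stream_lap hℓ hF₁ hF₂ hq hψ i) fun s t => by
    rw [← H2H10.sub_toL2, ← H2H10.sub_lap]
    exact H2H10.norm_toL2_le hℓ _

theorem memLp_layerSource (hℓ : 0 < ℓ) (hF₁ : 0 < F₁) (hF₂ : 0 < F₂) (ν β r : ℝ)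
    (hq : Continuous q) (hψ : ∀ t, IsStream F₁ F₂ (q t) (ψ t)) {f : Icc (0 : ℝ) T → L2 ℓ}
    (hf : MemLp f 2 (timeMeasure T)) {m : Icc (0 : ℝ) T → HH ℓ} (hm : MemLp m 2 (timeMeasure T))
    (i : Fin 2) : MemLp (fun s => layerSource F₁ F₂ ν β r (ψ s) (f s) (m s) i) 2 (timeMeasure T) := by
  have h1 : ∀ j, Continuous fun t => (ψ t j).lap := continuous_stream_lap hℓ hF₁ hF₂ hq hψ
  have h2 : Continuous fun t => (ψ t i).grad 0 :=
    (PiLp.continuous_apply 2 (fun _ : Fin 2 => L2 ℓ) 0).comp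
      (continuous_stream_grad hℓ hF₁ hF₂ hq hψ i)
  have h3 : MemLp (fun s => (if i = 0 then f s else (-r) • (ψ s 1).lap : L2 ℓ)) 2
      (timeMeasure T) := by
    split_ifs
    · exact hf
    · exact memLp_of_continuous ((h1 1).const_smul (-r))
  have h4 : MemLp (fun s => m s i) 2 (timeMeasure T) :=
    hm.mono ((PiLp.continuous_apply 2 (fun _ : Fin 2 => L2 ℓ) i).comp_aestronglyMeasurable hm.1)
      (Eventually.of_forall fun s => norm_apply_le (m s) i)
  have h5 : Continuous fun t =>
      (ν * coupling F₁ F₂ i) • ((ψ t i).lap - (ψ t (1 - i)).lap) - β • (ψ t i).grad 0 :=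
    (((h1 i).sub (h1 (1 - i))).const_smul (ν * coupling F₁ F₂ i)).sub (h2.const_smul β)
  have h6 := memLp_of_continuous h5 (p := 2)
  exact (h6.add h3).add h4

/-- The equation of a weak solution `q`, for a given path `ψ` of stream functions. -/
def WeakEq (ν β r : ℝ) (f : Lp (L2 ℓ) 2 (timeMeasure T))
    (R : HH ℓ →L[ℝ] HH ℓ) (σ : HH ℓ → H0 R →L[ℝ] HH ℓ) (ξ : HH ℓ)
    (h : Lp (H0 R) 2 (timeMeasure T)) (q : X ℓ T) (ψ : Icc (0 : ℝ) T → Fin 2 → H2H10 ℓ) : Prop :=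
  ∀ (φ : Fin 2 → H2H10 ℓ) (t : Icc (0 : ℝ) T),
    inner ℝ (X.val q t) (toHH φ) - inner ℝ ξ (toHH φ)
      + ∫ s in Iic t, (∑ i, (jacobi β (ψ s i) (X.grad q s i) (φ i)
            - ν * inner ℝ (ψ s i).lap (φ i).lap)
          - inner ℝ (f s) (φ 0).toL2 + r * inner ℝ (ψ s 1).lap (φ 1).toL2)
          ∂(timeMeasure T)
    = ∫ s in Iic t, inner ℝ (σ (X.val q s) (h s)) (toHH φ) ∂(timeMeasure T)

/-- A weak solution solves the equation of each layer. -/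
theorem layerEq_of_weak (hℓ : 0 < ℓ) (hF₁ : 0 < F₁) (hF₂ : 0 < F₂) {ν β r : ℝ}
    {f : Lp (L2 ℓ) 2 (timeMeasure T)} {R : HH ℓ →L[ℝ] HH ℓ} {σ : HH ℓ → H0 R →L[ℝ] HH ℓ}
    (hσ : NoiseAssumption R σ) {ξ : HH ℓ} {h : Lp (H0 R) 2 (timeMeasure T)} {q : X ℓ T}
    (hψ : ∀ t, IsStream F₁ F₂ (X.val q t) (ψ t))
    (heq : WeakEq ν β r f R σ ξ h q ψ) (i : Fin 2) :
    LayerEq T ν (ξ i) (fun t => X.val q t i) (fun t => X.grad q t i) (fun t => (ψ t i).toL2)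
      (fun t => layerSource F₁ F₂ ν β r (ψ t) (f t) (σ (X.val q t) (h t)) i) := by
  have hq := X.continuous_val q
  have hm := memLp_control hσ hq h
  have hz := memLp_layerSource hℓ hF₁ hF₂ ν β r hq hψ (Lp.memLp f) hm i
  have hc := continuous_stream hℓ hF₁ hF₂ hq hψ i
  have hb : ∃ B, 0 ≤ B ∧ ∀ s, EssBdd B (ψ s i).toL2 := by
    obtain ⟨C, hC, hw⟩ := exists_weakSup_le hℓ
    obtain ⟨D, hD, hqD⟩ := exists_norm_le_of_continuous hq
    refine ⟨C * D, by positivity, fun s => ?_⟩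
    filter_upwards [(hψ s).essBdd hℓ hF₁ hF₂ i] with z hz
    refine hz.trans ((hw _).trans ?_)
    gcongr
    exact hqD s
  refine ⟨?_, hc, X.memLp_grad_apply q i, hz, ?_, hb, fun k t => ?_⟩
  · exact (PiLp.continuous_apply 2 (fun _ : Fin 2 => L2 ℓ) i).comp hq
  · filter_upwards [X.mem_graph q] with s hs using hs i
  · have e := heq (layerTest hℓ i k) t
    rw [inner_toHH_layerTest, inner_toHH_layerTest] at e
    have hI := (memLp_layerCoef (ν := ν) hc (X.memLp_grad_apply q i) hz hb k).integrable one_le_two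
    have hI2 : Integrable (fun s => inner ℝ (σ (X.val q s) (h s)) (toHH (layerTest hℓ i k)))
        (timeMeasure T) := (hm.integrable one_le_two).inner_const _
    have hae := (X.mem_graph q).mono fun s hs =>
      weak_integrand hℓ ν β r (hψ s) hs (f s) (σ (X.val q s) (h s)) i k
    have hI1 : Integrable (fun s => ∑ j, (jacobi β (ψ s j) (X.grad q s j) (layerTest hℓ i k j)
        - ν * inner ℝ (ψ s j).lap (layerTest hℓ i k j).lap)
        - inner ℝ (f s) (layerTest hℓ i k 0).toL2
        + r * inner ℝ (ψ s 1).lap (layerTest hℓ i k 1).toL2) (timeMeasure T) := by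
      refine (hI2.sub hI).congr ?_
      filter_upwards [hae] with s hs
      rw [Pi.sub_apply, ← hs]
      ring
    rw [← setIntegral_congr_ae measurableSet_Iic (hae.mono fun s hs _ => hs),
      integral_sub hI2.integrableOn hI1.integrableOn]
    linarith

end Solutions

/-! ### A priori bounds -/

section Apriori

variable {ℓ T F₁ F₂ ν β r : ℝ}

/-- A path `q ∈ X` whose layers solve the layer equations with the stream functions `ψ` of `q` and
the sources `z`, together with a common bound `N` of `q` in `X` and of `z` in `L²`. -/
structure BoundedSolution (F₁ F₂ ν N : ℝ) (ξ : HH ℓ) (q : X ℓ T)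
    (ψ : Icc (0 : ℝ) T → Fin 2 → H2H10 ℓ) (z : Icc (0 : ℝ) T → Fin 2 → L2 ℓ) : Prop where
  stream : ∀ t, IsStream F₁ F₂ (X.val q t) (ψ t)
  eq : ∀ i, LayerEq T ν (ξ i) (fun t => X.val q t i) (fun t => X.grad q t i)
    (fun t => (ψ t i).toL2) (fun t => z t i)
  norm_le : ∀ t, ‖X.val q t‖ ≤ N
  grad_le : ∫ s, ‖X.grad q s‖ ^ 2 ∂(timeMeasure T) ≤ N
  source_le : ∀ i, ∫ s, ‖z s i‖ ^ 2 ∂(timeMeasure T) ≤ N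

theorem norm_GradHH_sq (g : GradHH ℓ) : ‖g‖ ^ 2 = ‖g 0‖ ^ 2 + ‖g 1‖ ^ 2 := by
  rw [PiLp.norm_sq_eq_of_L2, Fin.sum_univ_two]

theorem norm_GradHH_apply_le (g : GradHH ℓ) (i : Fin 2) : ‖g i‖ ≤ ‖g‖ := PiLp.norm_apply_le g i

/-- The energy inequality for the two layers, for sources of linear growth in `q`. -/
theorem energy_le (hℓ : 0 < ℓ) {ξ : HH ℓ} {q : X ℓ T} {ψ z : Icc (0 : ℝ) T → Fin 2 → L2 ℓ}
    (h : ∀ i, LayerEq T ν (ξ i) (fun t => X.val q t i) (fun t => X.grad q t i)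
      (fun t => ψ t i) (fun t => z t i)) {ρ : Icc (0 : ℝ) T → ℝ} (hρ : MemLp ρ 2 (timeMeasure T))
    (hz : ∀ s i, 4 * (‖z s i‖ * ‖X.val q s‖) ≤ ρ s * (1 + ‖X.val q s‖ ^ 2))
    (t : Icc (0 : ℝ) T) :
    ‖X.val q t‖ ^ 2 + 2 * ν * ∫ s in Iic t, ‖X.grad q s‖ ^ 2 ∂(timeMeasure T) ≤
      ‖ξ‖ ^ 2 + ∫ s in Iic t, ρ s * (1 + ‖X.val q s‖ ^ 2) ∂(timeMeasure T) := by
  have e0 := (h 0).energy hℓ t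
  have e1 := (h 1).energy hℓ t
  have hu : Continuous fun s => 1 + ‖X.val q s‖ ^ 2 :=
    continuous_const.add ((X.continuous_val q).norm.pow 2)
  have hρu : Integrable (fun s => ρ s * (1 + ‖X.val q s‖ ^ 2)) (timeMeasure T) :=
    hρ.integrable_mul (memLp_of_continuous hu (p := 2))
  have hg : ∀ i, Integrable (fun s => -ν * ‖X.grad q s i‖ ^ 2) (timeMeasure T) := fun i =>
    (h i).memLp_g.norm.integrable_sq.const_mul (-ν)
  have hgg : Integrable (fun s => ‖X.grad q s‖ ^ 2) (timeMeasure T) :=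
    (X.memLp_grad q).norm.integrable_sq
  have hzi : ∀ i, Integrable (fun s => inner ℝ (z s i) (X.val q s i)) (timeMeasure T) := by
    intro i
    refine Integrable.mono' (hρu.const_mul (1 / 4))
      ((h i).memLp_z.1.inner (memLp_of_continuous (h i).cont_q (p := 2)).1)
      (Eventually.of_forall fun s => ?_)
    have h1 := abs_real_inner_le_norm (z s i) (X.val q s i)
    have h2 := norm_apply_le (X.val q s) i
    have h3 := mul_le_mul_of_nonneg_left h2 (norm_nonneg (z s i))
    have := hz s i
    rw [Real.norm_eq_abs]
    linarith
  have key : ∀ i, ∫ s in Iic t, (-ν * ‖X.grad q s i‖ ^ 2 + inner ℝ (z s i) (X.val q s i))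
      ∂(timeMeasure T) ≤ -ν * ∫ s in Iic t, ‖X.grad q s i‖ ^ 2 ∂(timeMeasure T) +
        1 / 4 * ∫ s in Iic t, ρ s * (1 + ‖X.val q s‖ ^ 2) ∂(timeMeasure T) := by
    intro i
    rw [integral_add (hg i).integrableOn (hzi i).integrableOn, integral_const_mul,
      ← integral_const_mul (1 / 4)]
    refine add_le_add le_rfl (integral_mono (hzi i).integrableOn (hρu.const_mul _).integrableOn
      fun s => ?_)
    have h1 := real_inner_le_norm (z s i) (X.val q s i)
    have h2 := norm_apply_le (X.val q s) i
    have h3 := mul_le_mul_of_nonneg_left h2 (norm_nonneg (z s i))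
    have := hz s i
    simp only
    linarith
  have k0 := key 0
  have k1 := key 1
  have hs : ∫ s in Iic t, ‖X.grad q s‖ ^ 2 ∂(timeMeasure T) =
      ∫ s in Iic t, ‖X.grad q s 0‖ ^ 2 ∂(timeMeasure T)
        + ∫ s in Iic t, ‖X.grad q s 1‖ ^ 2 ∂(timeMeasure T) := by
    rw [← integral_add (h 0).memLp_g.norm.integrable_sq.integrableOn
      (h 1).memLp_g.norm.integrable_sq.integrableOn]
    simp only [norm_GradHH_sq]
  rw [hs, norm_HH_sq, norm_HH_sq ξ, e0, e1]
  linarith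

theorem integral_sq_add_three_le {a b : Icc (0 : ℝ) T → ℝ} (ha : MemLp a 2 (timeMeasure T))
    (hb : MemLp b 2 (timeMeasure T)) (c : ℝ) :
    ∫ s, (c + a s + b s) ^ 2 ∂(timeMeasure T) ≤ 3 * (c ^ 2 * (timeMeasure T).real univ
      + ∫ s, a s ^ 2 ∂(timeMeasure T) + ∫ s, b s ^ 2 ∂(timeMeasure T)) := by
  have e : 3 * (c ^ 2 * (timeMeasure T).real univ
      + ∫ s, a s ^ 2 ∂(timeMeasure T) + ∫ s, b s ^ 2 ∂(timeMeasure T)) =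
      ∫ s, 3 * (c ^ 2 + a s ^ 2 + b s ^ 2) ∂(timeMeasure T) := by
    have h1 : Integrable (fun s => c ^ 2 + a s ^ 2) (timeMeasure T) :=
      (integrable_const _).add ha.integrable_sq
    rw [integral_const_mul, integral_add h1 hb.integrable_sq, integral_add (integrable_const _) ha.integrable_sq, integral_const,
      smul_eq_mul, mul_comm (c ^ 2)]
  rw [e]
  refine integral_mono (((memLp_const c).add ha).add hb).integrable_sq
    ((((integrable_const _).add ha.integrable_sq).add hb.integrable_sq).const_mul 3) fun s => ?_
  simp only
  nlinarith [sq_nonneg (c - a s), sq_nonneg (c - b s), sq_nonneg (a s - b s)]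

/-- Solutions with controls in a ball are bounded in `X`, uniformly. -/
theorem exists_boundedSolution (hℓ : 0 < ℓ) (hT : 0 ≤ T) (hF₁ : 0 < F₁) (hF₂ : 0 < F₂) (hν : 0 < ν)
    (β r M : ℝ) (f : Lp (L2 ℓ) 2 (timeMeasure T)) {R : HH ℓ →L[ℝ] HH ℓ}
    {σ : HH ℓ → H0 R →L[ℝ] HH ℓ} (hσ : NoiseAssumption R σ) (ξ : HH ℓ) :
    ∃ N, 0 ≤ N ∧ ∀ h ∈ controlBall R T M, ∀ (q : X ℓ T) ψ,
      (∀ t, IsStream F₁ F₂ (X.val q t) (ψ t)) → WeakEq ν β r f R σ ξ h q ψ →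
      BoundedSolution F₁ F₂ ν N ξ q ψ fun t =>
        layerSource F₁ F₂ ν β r (ψ t) (f t) (σ (X.val q t) (h t)) := by
  obtain ⟨K, hK, hgr⟩ := hσ.exists_growth
  set C := sourceC ℓ F₁ F₂ ν β r
  have hC : 0 ≤ C := sourceC_nonneg hℓ hF₁ hF₂ ν β r
  set m := (timeMeasure T).real univ
  -- A bound of the square integral of the coefficient `ρ` below, uniform in the control.
  set N₁ := 3 * ((4 * C) ^ 2 * m + ∫ s, (4 * ‖f s‖) ^ 2 ∂(timeMeasure T) + (8 * K) ^ 2 * |M|)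
  have hN₁ : 0 ≤ N₁ := by
    have : 0 ≤ ∫ s, (4 * ‖f s‖) ^ 2 ∂(timeMeasure T) := integral_nonneg fun _ => sq_nonneg _
    positivity
  obtain ⟨D₀, hD₀⟩ := exists_gronwall_bound T (1 + ‖ξ‖ ^ 2) N₁ hN₁
  set D := max D₀ 1
  have hD : 1 ≤ D := le_max_right _ _
  set N₂ := (‖ξ‖ ^ 2 + (N₁ + D ^ 2 * m)) / (2 * ν)
  have hm : 0 ≤ m := measureReal_nonneg
  refine ⟨D + N₂ + D ^ 2 * N₁, by positivity, fun h hh q ψ hψ heq => ?_⟩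
  set z := fun t => layerSource F₁ F₂ ν β r (ψ t) (f t) (σ (X.val q t) (h t))
  have hL : ∀ i, LayerEq T ν (ξ i) (fun t => X.val q t i) (fun t => X.grad q t i)
      (fun t => (ψ t i).toL2) (fun t => z t i) := layerEq_of_weak hℓ hF₁ hF₂ hσ hψ heq
  -- The growth of the sources: `‖z‖ ≤ C ‖q‖ + ‖f‖ + K (1 + ‖q‖) |h|₀`.
  set ρ : Icc (0 : ℝ) T → ℝ := fun s => 4 * C + 4 * ‖f s‖ + 8 * K * ‖h s‖
  have hρf : MemLp (fun s => 4 * ‖f s‖) 2 (timeMeasure T) := (Lp.memLp f).norm.const_mul 4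
  have hρh : MemLp (fun s => 8 * K * ‖h s‖) 2 (timeMeasure T) :=
    (Lp.memLp h).norm.const_mul (8 * K)
  have hρ : MemLp ρ 2 (timeMeasure T) := ((memLp_const (4 * C)).add hρf).add hρh
  have hρ0 : ∀ s, 0 ≤ ρ s := fun s => by positivity
  have hρN : ∫ s, ρ s ^ 2 ∂(timeMeasure T) ≤ N₁ := by
    refine (integral_sq_add_three_le hρf hρh (4 * C)).trans ?_
    have e : ∫ s, (8 * K * ‖h s‖) ^ 2 ∂(timeMeasure T)
        = (8 * K) ^ 2 * ∫ s, ‖h s‖ ^ 2 ∂(timeMeasure T) := by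
      rw [← integral_const_mul]
      simp only [mul_pow]
    have h1 : ∫ s, ‖h s‖ ^ 2 ∂(timeMeasure T) ≤ |M| := le_trans hh (le_abs_self M)
    have h2 := mul_le_mul_of_nonneg_left h1 (sq_nonneg (8 * K))
    rw [e]
    simp only [N₁, m]
    linarith
  have hza : ∀ s i, 4 * ‖z s i‖ ≤ ρ s * (1 + ‖X.val q s‖ ^ 2) := by
    intro s i
    set a := ‖X.val q s‖ with ha
    have h1 := norm_layerSource_le hℓ hF₁ hF₂ ν β r (hψ s) (f s) (σ (X.val q s) (h s)) i
    have h2 := hgr (X.val q s) (h s)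
    change ‖z s i‖ ≤ C * a + _ + _ at h1
    rw [← ha] at h2
    have h3 : 0 ≤ ‖f s‖ * a ^ 2 := by positivity
    have h4 : 0 ≤ C * (1 + a ^ 2 - a) := mul_nonneg hC (by nlinarith [sq_nonneg (a - 1)])
    have h5 : 0 ≤ K * ‖h s‖ * (2 * (1 + a ^ 2) - (1 + a)) :=
      mul_nonneg (by positivity) (by nlinarith [sq_nonneg (a - 1)])
    simp only [ρ]
    linarith
  have hzb : ∀ s i, 4 * (‖z s i‖ * ‖X.val q s‖) ≤ ρ s * (1 + ‖X.val q s‖ ^ 2) := by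
    intro s i
    set a := ‖X.val q s‖ with ha
    have ha0 : 0 ≤ a := norm_nonneg _
    have h1 := norm_layerSource_le hℓ hF₁ hF₂ ν β r (hψ s) (f s) (σ (X.val q s) (h s)) i
    have h2 := hgr (X.val q s) (h s)
    change ‖z s i‖ ≤ C * a + _ + _ at h1
    rw [← ha] at h2
    have h6 : ‖z s i‖ * a ≤ (C * a + ‖f s‖ + K * (1 + a) * ‖h s‖) * a :=
      mul_le_mul_of_nonneg_right (by linarith) ha0
    have h3 : 0 ≤ ‖f s‖ * (1 + a ^ 2 - a) :=
      mul_nonneg (norm_nonneg _) (by nlinarith [sq_nonneg (a - 1)])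
    have h5 : 0 ≤ K * ‖h s‖ * (2 * (1 + a ^ 2) - (1 + a) * a) :=
      mul_nonneg (by positivity) (by nlinarith [sq_nonneg (a - 1)])
    simp only [ρ]
    linarith
  have hen := energy_le hℓ (ψ := fun t i => (ψ t i).toL2) hL hρ hzb
  let u : C(Icc (0 : ℝ) T, ℝ) := ⟨fun s => 1 + ‖X.val q s‖ ^ 2,
    continuous_const.add ((X.continuous_val q).norm.pow 2)⟩
  -- Gronwall's inequality for `1 + ‖q‖²`, after dropping the dissipation.
  have hu : ∀ t, 1 + ‖X.val q t‖ ^ 2 ≤ D := by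
    intro t
    refine (hD₀ u ρ (fun t => ?_) hρ hρN (fun t => ?_) t).trans (le_max_left _ _)
    · change 0 ≤ 1 + ‖X.val q t‖ ^ 2
      positivity
    · have h1 := hen t
      have h2 : 0 ≤ ∫ s in Iic t, ‖X.grad q s‖ ^ 2 ∂(timeMeasure T) :=
        integral_nonneg fun _ => sq_nonneg _
      have h3 : 0 ≤ 2 * ν * ∫ s in Iic t, ‖X.grad q s‖ ^ 2 ∂(timeMeasure T) := by positivity
      change 1 + ‖X.val q t‖ ^ 2 ≤ _ + ∫ s in Iic t, ρ s * (1 + ‖X.val q s‖ ^ 2) ∂(timeMeasure T)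
      linarith
  have hN₂ : 0 ≤ N₂ := by positivity
  have hDN : 0 ≤ D ^ 2 * N₁ := by positivity
  refine ⟨hψ, hL, fun t => ?_, ?_, fun i => ?_⟩
  · nlinarith [hu t, sq_nonneg (‖X.val q t‖ - 1)]
  · have h1 := hen ⟨T, hT, le_rfl⟩
    have huniv : Iic (⟨T, hT, le_rfl⟩ : Icc (0 : ℝ) T) = univ :=
      eq_univ_of_forall fun s => s.2.2
    rw [huniv, setIntegral_univ, setIntegral_univ] at h1
    have h2 : ∫ s, ρ s * (1 + ‖X.val q s‖ ^ 2) ∂(timeMeasure T) ≤ N₁ + D ^ 2 * m := by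
      have h3 : ∫ s, ρ s * (1 + ‖X.val q s‖ ^ 2) ∂(timeMeasure T)
          ≤ ∫ s, (ρ s ^ 2 + D ^ 2) ∂(timeMeasure T) := by
        refine integral_mono (hρ.integrable_mul (memLp_of_continuous u.continuous (p := 2)))
          (hρ.integrable_sq.add (integrable_const _)) fun s => ?_
        have := hu s
        have h4 := mul_le_mul_of_nonneg_left this (hρ0 s)
        simp only
        nlinarith [sq_nonneg (ρ s - D), hρ0 s]
      rw [integral_add hρ.integrable_sq (integrable_const _), integral_const, smul_eq_mul] at h3
      linarith
    have h4 : ∫ s, ‖X.grad q s‖ ^ 2 ∂(timeMeasure T) ≤ N₂ := by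
      rw [le_div_iff₀ (by positivity)]
      nlinarith [sq_nonneg ‖X.val q ⟨T, hT, le_rfl⟩‖]
    linarith
  · have h1 : ∫ s, ‖z s i‖ ^ 2 ∂(timeMeasure T) ≤ ∫ s, D ^ 2 * ρ s ^ 2 ∂(timeMeasure T) := by
      refine integral_mono (hL i).memLp_z.norm.integrable_sq (hρ.integrable_sq.const_mul _)
        fun s => ?_
      simp only
      rw [← mul_pow]
      refine pow_le_pow_left₀ (norm_nonneg _) ?_ 2
      have h2 := hza s i
      have h3 := mul_le_mul_of_nonneg_left (hu s) (hρ0 s)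
      linarith [norm_nonneg (z s i)]
    rw [integral_const_mul] at h1
    have h2 := mul_le_mul_of_nonneg_left hρN (sq_nonneg D)
    linarith

end Apriori

/-! ### The difference of two solutions -/

section Difference

variable {ℓ T F₁ F₂ ν N : ℝ}

theorem norm_sub_sq_le {E : Type*} [NormedAddCommGroup E] (x y : E) :
    ‖x - y‖ ^ 2 ≤ 2 * ‖x‖ ^ 2 + 2 * ‖y‖ ^ 2 := by
  have h := pow_le_pow_left₀ (norm_nonneg _) (norm_sub_le x y) 2
  nlinarith [sq_nonneg (‖x‖ - ‖y‖)]

theorem integral_norm_sub_sq_le {E : Type*} [NormedAddCommGroup E] {a b : Icc (0 : ℝ) T → E}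
    (ha : MemLp a 2 (timeMeasure T)) (hb : MemLp b 2 (timeMeasure T))
    (haN : ∫ s, ‖a s‖ ^ 2 ∂(timeMeasure T) ≤ N) (hbN : ∫ s, ‖b s‖ ^ 2 ∂(timeMeasure T) ≤ N) :
    ∫ s, ‖a s - b s‖ ^ 2 ∂(timeMeasure T) ≤ 4 * N := by
  have h1 : ∫ s, ‖a s - b s‖ ^ 2 ∂(timeMeasure T)
      ≤ ∫ s, (2 * ‖a s‖ ^ 2 + 2 * ‖b s‖ ^ 2) ∂(timeMeasure T) :=
    integral_mono (ha.sub hb).norm.integrable_sq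
      ((ha.norm.integrable_sq.const_mul 2).add (hb.norm.integrable_sq.const_mul 2))
      fun s => norm_sub_sq_le _ _
  rw [integral_add (ha.norm.integrable_sq.const_mul 2) (hb.norm.integrable_sq.const_mul 2),
    integral_const_mul, integral_const_mul] at h1
  linarith

variable {ξ : HH ℓ} {q q' : X ℓ T} {ψ ψ' : Icc (0 : ℝ) T → Fin 2 → H2H10 ℓ}
  {z z' : Icc (0 : ℝ) T → Fin 2 → L2 ℓ}

theorem BoundedSolution.nonneg (h : BoundedSolution F₁ F₂ ν N ξ q ψ z) : 0 ≤ N :=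
  (integral_nonneg fun _ => sq_nonneg _).trans h.grad_le

theorem BoundedSolution.grad_apply_le (h : BoundedSolution F₁ F₂ ν N ξ q ψ z) (i : Fin 2) :
    ∫ s, ‖X.grad q s i‖ ^ 2 ∂(timeMeasure T) ≤ N :=
  (integral_mono (X.memLp_grad_apply q i).norm.integrable_sq (X.memLp_grad q).norm.integrable_sq
    fun s => pow_le_pow_left₀ (norm_nonneg _) (norm_GradHH_apply_le (X.grad q s) i) 2).trans
    h.grad_le

theorem X.memLp_val_sub (q q' : X ℓ T) :
    MemLp (fun s => ‖X.val q s - X.val q' s‖) 2 (timeMeasure T) :=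
  memLp_of_continuous ((X.continuous_val q).sub (X.continuous_val q')).norm

/-- In the energy identity for the difference, the nonlinear term is controlled by the maximum of
the difference of the stream functions, and the sources by the `L²` norm of the difference. -/
theorem BoundedSolution.layer_sub_le (hℓ : 0 < ℓ) (hF₁ : 0 < F₁) (hF₂ : 0 < F₂)
    (h : BoundedSolution F₁ F₂ ν N ξ q ψ z) (h' : BoundedSolution F₁ F₂ ν N ξ q' ψ' z') {S : ℝ}
    (hS : ∀ t, weakSup (X.val q t - X.val q' t) ≤ S) (i : Fin 2) (t : Icc (0 : ℝ) T) :
    ‖X.val q t i - X.val q' t i‖ ^ 2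
      + 2 * ν * ∫ s in Iic t, ‖X.grad q s i - X.grad q' s i‖ ^ 2 ∂(timeMeasure T) ≤
    6 * N * S + 4 * √N * √(∫ s, ‖X.val q s - X.val q' s‖ ^ 2 ∂(timeMeasure T)) := by
  have hS0 : 0 ≤ S := (weakSup_nonneg hℓ _).trans (hS t)
  have hN := h.nonneg
  set dg : Icc (0 : ℝ) T → ℝ := fun s => ‖X.grad q s i - X.grad q' s i‖
  set G : Icc (0 : ℝ) T → ℝ := fun s => 2 * ‖X.grad q s i‖ ^ 2 + ‖X.grad q' s i‖ ^ 2
  set Z : Icc (0 : ℝ) T → ℝ := fun s => ‖z s i - z' s i‖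
  set W : Icc (0 : ℝ) T → ℝ := fun s => ‖X.val q s - X.val q' s‖
  have hdg : Integrable (fun s => dg s ^ 2) (timeMeasure T) :=
    ((X.memLp_grad_apply q i).sub (X.memLp_grad_apply q' i)).norm.integrable_sq
  have hg1 := (X.memLp_grad_apply q i).norm.integrable_sq.const_mul 2
  have hg2 := (X.memLp_grad_apply q' i).norm.integrable_sq
  have hG : Integrable G (timeMeasure T) := hg1.add hg2
  have hZ : MemLp Z 2 (timeMeasure T) := ((h.eq i).memLp_z.sub (h'.eq i).memLp_z).norm
  have hW : MemLp W 2 (timeMeasure T) := X.memLp_val_sub q q'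
  have hZW : Integrable (fun s => Z s * W s) (timeMeasure T) := hZ.integrable_mul hW
  have hGN : ∫ s in Iic t, G s ∂(timeMeasure T) ≤ 3 * N := by
    refine (setIntegral_le_integral hG (Eventually.of_forall fun s => by positivity)).trans ?_
    rw [integral_add hg1 hg2, integral_const_mul]
    linarith [h.grad_apply_le i, h'.grad_apply_le i]
  have hZWN : ∫ s in Iic t, Z s * W s ∂(timeMeasure T)
      ≤ 2 * √N * √(∫ s, W s ^ 2 ∂(timeMeasure T)) := by
    refine (setIntegral_le_integral hZW (Eventually.of_forall fun s => by positivity)).trans ?_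
    refine (integral_mul_le_sqrt hZ hW).trans ?_
    refine mul_le_mul_of_nonneg_right ?_ (Real.sqrt_nonneg _)
    have e : 2 * √N = √(4 * N) := by
      rw [Real.sqrt_mul (by norm_num), show (4 : ℝ) = 2 ^ 2 by norm_num, Real.sqrt_sq (by norm_num)]
    rw [e]
    exact Real.sqrt_le_sqrt (integral_norm_sub_sq_le (h.eq i).memLp_z (h'.eq i).memLp_z
      (h.source_le i) (h'.source_le i))
  have hmain : Integrable (fun s => -ν * dg s ^ 2 + S * G s + Z s * W s) (timeMeasure T) :=
    ((hdg.const_mul (-ν)).add (hG.const_mul S)).add hZW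
  have hpt : ∀ s, -tri ((ψ s i).toL2 - (ψ' s i).toL2) (X.grad q s i) (X.grad q s i - X.grad q' s i)
      + inner ℝ (z s i - z' s i) (X.val q s i - X.val q' s i) ≤ S * G s + Z s * W s := by
    intro s
    have hb := ((h.stream s).sub (h'.stream s)).essBdd hℓ hF₁ hF₂ i
    have h1 := abs_tri_le (weakSup_nonneg hℓ _) hb (X.grad q s i) (X.grad q s i - X.grad q' s i)
    have h2 : weakSup (X.val q s - X.val q' s) * ‖X.grad q s i‖ * ‖X.grad q s i - X.grad q' s i‖
        ≤ S * G s := by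
      rw [mul_assoc]
      refine mul_le_mul (hS s) ?_ (by positivity) hS0
      have h3 := mul_le_mul_of_nonneg_left (norm_sub_le (X.grad q s i) (X.grad q' s i))
        (norm_nonneg (X.grad q s i))
      simp only [G]
      nlinarith [sq_nonneg (‖X.grad q s i‖ - ‖X.grad q' s i‖)]
    have h4 := real_inner_le_norm (z s i - z' s i) (X.val q s i - X.val q' s i)
    have h5 : ‖z s i - z' s i‖ * ‖X.val q s i - X.val q' s i‖ ≤ Z s * W s :=
      mul_le_mul_of_nonneg_left (norm_apply_le (X.val q s - X.val q' s) i) (norm_nonneg _)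
    have h6 := (abs_le.1 h1).1
    change -(weakSup (X.val q s - X.val q' s) * _ * _) ≤
      tri ((ψ s i).toL2 - (ψ' s i).toL2) _ _ at h6
    linarith
  obtain ⟨hint, hen⟩ := (h.eq i).energy_sub hℓ (h'.eq i)
  have key : ∫ s in Iic t, (-ν * ‖X.grad q s i - X.grad q' s i‖ ^ 2
      - tri ((ψ s i).toL2 - (ψ' s i).toL2) (X.grad q s i) (X.grad q s i - X.grad q' s i)
      + inner ℝ (z s i - z' s i) (X.val q s i - X.val q' s i)) ∂(timeMeasure T)
      ≤ ∫ s in Iic t, (-ν * dg s ^ 2 + S * G s + Z s * W s) ∂(timeMeasure T) := by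
    refine integral_mono hint.integrableOn hmain.integrableOn fun s => ?_
    have := hpt s
    simp only [dg]
    linarith
  have e1 : ∫ s in Iic t, (-ν * dg s ^ 2 + S * G s + Z s * W s) ∂(timeMeasure T)
      = -ν * ∫ s in Iic t, dg s ^ 2 ∂(timeMeasure T) + S * ∫ s in Iic t, G s ∂(timeMeasure T)
        + ∫ s in Iic t, Z s * W s ∂(timeMeasure T) := by
    have h7 : Integrable (fun s => -ν * dg s ^ 2 + S * G s) (timeMeasure T) :=
      (hdg.const_mul (-ν)).add (hG.const_mul S)
    rw [integral_add h7.integrableOn hZW.integrableOn,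
      integral_add (hdg.const_mul (-ν)).integrableOn (hG.const_mul S).integrableOn,
      integral_const_mul, integral_const_mul]
  have e2 := hen t
  simp only at e2
  rw [e2]
  have h8 := mul_le_mul_of_nonneg_left hGN hS0
  change 2 * _ + 2 * ν * ∫ s in Iic t, dg s ^ 2 ∂(timeMeasure T) ≤
    6 * N * S + 4 * √N * √(∫ s, W s ^ 2 ∂(timeMeasure T))
  linarith

end Difference

/-! ### Solutions are determined by finitely many modes, up to a small error -/

section Modes

variable {ℓ T F₁ F₂ ν N : ℝ}

theorem norm_Lp_sq {E : Type*} [NormedAddCommGroup E] [InnerProductSpace ℝ E]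
    (f : Lp E 2 (timeMeasure T)) : ‖f‖ ^ 2 = ∫ s, ‖f s‖ ^ 2 ∂(timeMeasure T) := by
  rw [← real_inner_self_eq_norm_sq, L2.inner_def]
  simp only [real_inner_self_eq_norm_sq]

theorem X.norm_sub_sq (q q' : X ℓ T) : ‖q - q'‖ ^ 2 =
    ‖(q : WithLp 2 (C(Icc (0 : ℝ) T, HH ℓ) × Lp (GradHH ℓ) 2 (timeMeasure T))).fst
      - (q' : WithLp 2 (C(Icc (0 : ℝ) T, HH ℓ) × Lp (GradHH ℓ) 2 (timeMeasure T))).fst‖ ^ 2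
    + ∫ s, ‖X.grad q s - X.grad q' s‖ ^ 2 ∂(timeMeasure T) := by
  change ‖((q - q' : X ℓ T) : WithLp 2 (C(Icc (0 : ℝ) T, HH ℓ) ×
    Lp (GradHH ℓ) 2 (timeMeasure T)))‖ ^ 2 = _
  rw [WithLp.prod_norm_sq_eq_of_L2]
  congr 1
  rw [norm_Lp_sq]
  refine integral_congr_ae ?_
  filter_upwards [Lp.coeFn_sub
    (q : WithLp 2 (C(Icc (0 : ℝ) T, HH ℓ) × Lp (GradHH ℓ) 2 (timeMeasure T))).snd
    (q' : WithLp 2 (C(Icc (0 : ℝ) T, HH ℓ) × Lp (GradHH ℓ) 2 (timeMeasure T))).snd] with s hs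
  have : (((q - q' : X ℓ T) : WithLp 2 (C(Icc (0 : ℝ) T, HH ℓ) ×
    Lp (GradHH ℓ) 2 (timeMeasure T))).snd : Icc (0 : ℝ) T → GradHH ℓ) s
      = X.grad q s - X.grad q' s := hs
  rw [this]

theorem X.norm_val_sub_le (q q' : X ℓ T) (t : Icc (0 : ℝ) T) :
    ‖X.val q t - X.val q' t‖ ≤ ‖q - q'‖ := by
  have h1 := X.norm_sub_sq q q'
  have h2 := ((q : WithLp 2 (C(Icc (0 : ℝ) T, HH ℓ) × Lp (GradHH ℓ) 2 (timeMeasure T))).fst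
      - (q' : WithLp 2 (C(Icc (0 : ℝ) T, HH ℓ) × Lp (GradHH ℓ) 2
        (timeMeasure T))).fst).norm_coe_le_norm t
  have h3 : 0 ≤ ∫ s, ‖X.grad q s - X.grad q' s‖ ^ 2 ∂(timeMeasure T) :=
    integral_nonneg fun _ => sq_nonneg _
  refine le_trans h2 (abs_le_of_sq_le_sq' ?_ (norm_nonneg _)).2
  exact (le_add_of_nonneg_right h3).trans h1.ge

theorem X.integral_grad_sub_le (q q' : X ℓ T) :
    ∫ s, ‖X.grad q s - X.grad q' s‖ ^ 2 ∂(timeMeasure T) ≤ ‖q - q'‖ ^ 2 := by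
  rw [X.norm_sub_sq]
  exact le_add_of_nonneg_left (sq_nonneg _)

theorem X.norm_sub_sq_le {q q' : X ℓ T} {c d : ℝ} (hc : 0 ≤ c)
    (h : ∀ t, ‖X.val q t - X.val q' t‖ ^ 2 ≤ c)
    (hd : ∫ s, ‖X.grad q s - X.grad q' s‖ ^ 2 ∂(timeMeasure T) ≤ d) : ‖q - q'‖ ^ 2 ≤ c + d := by
  rw [X.norm_sub_sq]
  refine add_le_add ?_ hd
  rw [← Real.sq_sqrt hc]
  refine pow_le_pow_left₀ (norm_nonneg _) ?_ 2
  refine (ContinuousMap.norm_le _ (Real.sqrt_nonneg _)).2 fun t => ?_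
  exact Real.le_sqrt_of_sq_le (h t)

/-- A Poincaré inequality for the high modes. -/
theorem norm_sq_le_of_modes (hℓ : 0 < ℓ) {u : L2 ℓ} {g : L2Vec ℓ} (hu : (u, g) ∈ H10Graph ℓ)
    {F : Finset (ℕ × ℕ)} {Λ δ : ℝ} (hΛ : 0 < Λ) (hF : ∀ k ∉ F, Λ ≤ eig ℓ k)
    (hδ : ∀ k ∈ F, |sc k u| ≤ δ) : ‖u‖ ^ 2 ≤ F.card * δ ^ 2 + Λ⁻¹ * ‖g‖ ^ 2 := by
  have h1 : HasSum (fun k => if k ∈ F then δ ^ 2 else 0) (F.card * δ ^ 2) := by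
    have : HasSum (fun k => if k ∈ F then δ ^ 2 else 0) (∑ k ∈ F, if k ∈ F then δ ^ 2 else 0) :=
      hasSum_sum_of_ne_finset_zero fun k hk => if_neg hk
    rw [Finset.sum_ite_mem, Finset.inter_self, Finset.sum_const, nsmul_eq_mul] at this
    exact this
  refine hasSum_le (fun k => ?_) (hasSum_sc_sq hℓ u)
    (h1.add ((hasSum_norm_grad_sq hℓ hu).mul_left Λ⁻¹))
  have h0 := eig_pos hℓ k
  split_ifs with hk
  · have := sq_le_sq' (abs_le.1 (hδ k hk)).1 (abs_le.1 (hδ k hk)).2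
    have : 0 ≤ Λ⁻¹ * (eig ℓ k * sc k u ^ 2) := by positivity
    linarith
  · rw [zero_add, ← mul_assoc]
    refine le_mul_of_one_le_left (sq_nonneg _) ?_
    rw [inv_mul_eq_div, one_le_div hΛ]
    exact hF k hk

variable {ξ : HH ℓ}

/-- Closeness of the modes in `F` makes bounded solutions close in `weakSup`. -/
theorem exists_modes_weakSup_le (hℓ : 0 < ℓ) (N : ℝ) {η : ℝ} (hη : 0 < η) :
    ∃ (F : Finset (ℕ × ℕ)) (δ : ℝ), 0 < δ ∧ ∀ w : HH ℓ, ‖w‖ ≤ N →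
      (∀ k ∈ F, ∀ i, |sc k (w i)| ≤ δ) → weakSup w ≤ η := by
  have h1 : Tendsto (fun F : Finset (ℕ × ℕ) =>
      2 / ℓ * (2 * (√(∑' k : {k // k ∉ F}, (eig ℓ k ^ 2)⁻¹) * N))) atTop (𝓝 0) := by
    have h2 := tendsto_tsum_compl_atTop_zero fun k => (eig ℓ k ^ 2)⁻¹
    have h3 := ((((Real.continuous_sqrt.tendsto _).comp h2).mul_const N).const_mul 2).const_mul
      (2 / ℓ)
    rw [Real.sqrt_zero, zero_mul, mul_zero, mul_zero] at h3
    exact h3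
  -- The modes outside `F` are small for all bounded `w`; then `δ` is chosen in terms of `F`.
  obtain ⟨F, hF⟩ := (h1.eventually_lt_const (half_pos hη)).exists
  have h2 : Tendsto (fun δ : ℝ => 2 / ℓ * ∑ k ∈ F, (δ + δ) / eig ℓ k) (𝓝[>] 0) (𝓝 0) := by
    have hc : Continuous fun δ : ℝ => 2 / ℓ * ∑ k ∈ F, (δ + δ) / eig ℓ k := by fun_prop
    have := (hc.tendsto 0).mono_left (nhdsWithin_le_nhds (s := Ioi 0))
    simpa using this
  obtain ⟨δ, hδ, hδ0⟩ := ((h2.eventually_lt_const (half_pos hη)).and self_mem_nhdsWithin).exists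
  refine ⟨F, δ, hδ0, fun w hw hm => (weakSup_le hℓ w F).trans ?_⟩
  have h3 : ∑ k ∈ F, (|sc k (w 0)| + |sc k (w 1)|) / eig ℓ k ≤ ∑ k ∈ F, (δ + δ) / eig ℓ k := by
    refine Finset.sum_le_sum fun k hk => ?_
    have := eig_pos hℓ k
    gcongr
    exacts [hm k hk 0, hm k hk 1]
  have h4 : 2 / ℓ * (2 * (√(∑' k : {k // k ∉ F}, (eig ℓ k ^ 2)⁻¹) * ‖w‖))
      ≤ 2 / ℓ * (2 * (√(∑' k : {k // k ∉ F}, (eig ℓ k ^ 2)⁻¹) * N)) := by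
    gcongr
  have h5 := mul_le_mul_of_nonneg_left h3 (show 0 ≤ 2 / ℓ by positivity)
  rw [mul_add]
  linarith

/-- Closeness of the modes in `F` makes bounded solutions close in `L²`. -/
theorem exists_modes_integral_le (hℓ : 0 < ℓ) (T : ℝ) (hN : 0 ≤ N) {η : ℝ} (hη : 0 < η) :
    ∃ (F : Finset (ℕ × ℕ)) (δ : ℝ), 0 < δ ∧ ∀ w : X ℓ T,
      ∫ s, ‖X.grad w s‖ ^ 2 ∂(timeMeasure T) ≤ N →
      (∀ k ∈ F, ∀ i t, |sc k (X.val w t i)| ≤ δ) →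
      ∫ s, ‖X.val w s‖ ^ 2 ∂(timeMeasure T) ≤ η := by
  -- With `λ_k ≥ Λ` off `F`, the high modes contribute at most `N / Λ ≤ η / 2`.
  set Λ := 2 * N / η + 1
  have hΛ : 0 < Λ := by positivity
  have h1 := (summable_inv_eig_sq hℓ).tendsto_cofinite_zero.eventually_lt_const
    (show 0 < (Λ ^ 2)⁻¹ by positivity)
  set F := h1.toFinset
  have hF : ∀ k ∉ F, Λ ≤ eig ℓ k := by
    intro k hk
    have h2 : (eig ℓ k ^ 2)⁻¹ < (Λ ^ 2)⁻¹ := by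
      by_contra h
      exact hk (h1.mem_toFinset.2 h)
    have h3 := eig_pos hℓ k
    rw [inv_lt_inv₀ (by positivity) (by positivity)] at h2
    exact (lt_of_pow_lt_pow_left₀ 2 h3.le h2).le
  have h2 : Tendsto (fun δ : ℝ => 2 * (F.card * δ ^ 2) * (timeMeasure T).real univ)
      (𝓝[>] 0) (𝓝 0) := by
    have hc : Continuous fun δ : ℝ => 2 * (F.card * δ ^ 2) * (timeMeasure T).real univ := by
      fun_prop
    have := (hc.tendsto 0).mono_left (nhdsWithin_le_nhds (s := Ioi 0))
    simpa using this
  obtain ⟨δ, hδ, hδ0⟩ := ((h2.eventually_lt_const (half_pos hη)).and self_mem_nhdsWithin).exists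
  refine ⟨F, δ, hδ0, fun w hw hm => ?_⟩
  have hg : Integrable (fun s => ‖X.grad w s‖ ^ 2) (timeMeasure T) :=
    (X.memLp_grad w).norm.integrable_sq
  have h3 : ∫ s, ‖X.val w s‖ ^ 2 ∂(timeMeasure T) ≤
      ∫ s, (2 * (F.card * δ ^ 2) + Λ⁻¹ * ‖X.grad w s‖ ^ 2) ∂(timeMeasure T) := by
    refine integral_mono_ae
      (memLp_of_continuous (X.continuous_val w).norm (p := 2)).integrable_sq
      ((integrable_const _).add (hg.const_mul _)) ?_
    filter_upwards [X.mem_graph w] with s hs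
    have k0 := norm_sq_le_of_modes hℓ (hs 0) hΛ hF fun k hk => hm k hk 0 s
    have k1 := norm_sq_le_of_modes hℓ (hs 1) hΛ hF fun k hk => hm k hk 1 s
    rw [norm_HH_sq, norm_GradHH_sq]
    linarith
  rw [integral_add (integrable_const _) (hg.const_mul _), integral_const, smul_eq_mul,
    integral_const_mul] at h3
  have h4 : Λ⁻¹ * ∫ s, ‖X.grad w s‖ ^ 2 ∂(timeMeasure T) ≤ η / 2 := by
    refine (mul_le_mul_of_nonneg_left hw (by positivity)).trans ?_
    rw [inv_mul_eq_div, div_le_iff₀ hΛ]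
    have : η * (2 * N / η) = 2 * N := by field_simp
    simp only [Λ]
    nlinarith
  linarith

theorem X.val_sub (q q' : X ℓ T) (t : Icc (0 : ℝ) T) :
    X.val (q - q') t = X.val q t - X.val q' t := rfl

/-- Bounded solutions with finitely many modes close to each other are close in `X`. -/
theorem exists_modes_norm_sub_le (hℓ : 0 < ℓ) (hT : 0 ≤ T) (hF₁ : 0 < F₁) (hF₂ : 0 < F₂)
    (hν : 0 < ν) (hN : 0 ≤ N) (ξ : HH ℓ) {ε : ℝ} (hε : 0 < ε) :
    ∃ (F : Finset (ℕ × ℕ)) (δ : ℝ), 0 < δ ∧ ∀ (q q' : X ℓ T) (ψ ψ') (z z'),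
      BoundedSolution F₁ F₂ ν N ξ q ψ z → BoundedSolution F₁ F₂ ν N ξ q' ψ' z' →
      (∀ k ∈ F, ∀ i t, |sc k (X.val q t i) - sc k (X.val q' t i)| ≤ δ) → ‖q - q'‖ ≤ ε := by
  set c := 1 + (2 * ν)⁻¹
  have hc : 0 < c := by positivity
  have h1 : Tendsto (fun η : ℝ => c * (12 * N * η + 8 * √N * √η)) (𝓝[>] 0) (𝓝 0) := by
    have hc : Continuous fun η : ℝ => c * (12 * N * η + 8 * √N * √η) := by fun_prop
    have := (hc.tendsto 0).mono_left (nhdsWithin_le_nhds (s := Ioi 0))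
    simpa using this
  obtain ⟨η, hη, hη0⟩ :=
    ((h1.eventually_lt_const (show 0 < ε ^ 2 by positivity)).and self_mem_nhdsWithin).exists
  obtain ⟨F, δ, hδ, hS⟩ := exists_modes_weakSup_le hℓ (2 * N) hη0
  obtain ⟨F', δ', hδ', hV⟩ := exists_modes_integral_le hℓ T (by positivity : 0 ≤ 4 * N) hη0
  refine ⟨F ∪ F', min δ δ', lt_min hδ hδ', fun q q' ψ ψ' z z' h h' hm => ?_⟩
  have hS' : ∀ t, weakSup (X.val q t - X.val q' t) ≤ η := fun t => by
    refine hS _ ?_ fun k hk i => ?_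
    · exact (norm_sub_le _ _).trans (by linarith [h.norm_le t, h'.norm_le t])
    · rw [PiLp.sub_apply, sc_sub]
      exact (hm k (Finset.mem_union_left _ hk) i t).trans (min_le_left _ _)
  have hgr : ∫ s, ‖X.grad (q - q') s‖ ^ 2 ∂(timeMeasure T) =
      ∫ s, ‖X.grad q s - X.grad q' s‖ ^ 2 ∂(timeMeasure T) := by
    refine integral_congr_ae ?_
    filter_upwards [Lp.coeFn_sub
      (q : WithLp 2 (C(Icc (0 : ℝ) T, HH ℓ) × Lp (GradHH ℓ) 2 (timeMeasure T))).snd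
      (q' : WithLp 2 (C(Icc (0 : ℝ) T, HH ℓ) × Lp (GradHH ℓ) 2 (timeMeasure T))).snd] with s hs
    exact congrArg (fun x => ‖x‖ ^ 2) hs
  have hV' : ∫ s, ‖X.val q s - X.val q' s‖ ^ 2 ∂(timeMeasure T) ≤ η := by
    refine hV (q - q') ?_ fun k hk i t => ?_
    · rw [hgr]
      exact integral_norm_sub_sq_le (X.memLp_grad q) (X.memLp_grad q') h.grad_le h'.grad_le
    · rw [X.val_sub, PiLp.sub_apply, sc_sub]
      exact (hm k (Finset.mem_union_right _ hk) i t).trans (min_le_right _ _)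
  set E := 12 * N * η + 8 * √N * √η
  have hE : ∀ t, ‖X.val q t - X.val q' t‖ ^ 2
      + 2 * ν * ∫ s in Iic t, ‖X.grad q s - X.grad q' s‖ ^ 2 ∂(timeMeasure T) ≤ E := by
    intro t
    have e0 := h.layer_sub_le hℓ hF₁ hF₂ h' hS' 0 t
    have e1 := h.layer_sub_le hℓ hF₁ hF₂ h' hS' 1 t
    have hs : ∫ s in Iic t, ‖X.grad q s - X.grad q' s‖ ^ 2 ∂(timeMeasure T) =
        ∫ s in Iic t, ‖X.grad q s 0 - X.grad q' s 0‖ ^ 2 ∂(timeMeasure T)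
          + ∫ s in Iic t, ‖X.grad q s 1 - X.grad q' s 1‖ ^ 2 ∂(timeMeasure T) := by
      have hi : ∀ i, Integrable (fun s => ‖X.grad q s i - X.grad q' s i‖ ^ 2)
          (timeMeasure T) := fun i => ((X.memLp_grad_apply q i).sub
        (X.memLp_grad_apply q' i)).norm.integrable_sq
      rw [← integral_add (hi 0).integrableOn (hi 1).integrableOn]
      simp only [norm_GradHH_sq, PiLp.sub_apply]
    have hr : 4 * √N * √(∫ s, ‖X.val q s - X.val q' s‖ ^ 2 ∂(timeMeasure T))
        ≤ 4 * √N * √η := by gcongr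
    rw [hs, norm_HH_sq, PiLp.sub_apply, PiLp.sub_apply]
    linarith
  have hpos : ∀ t : Icc (0 : ℝ) T,
      0 ≤ ∫ s in Iic t, ‖X.grad q s - X.grad q' s‖ ^ 2 ∂(timeMeasure T) :=
    fun t => integral_nonneg fun _ => sq_nonneg _
  have hval : ∀ t, ‖X.val q t - X.val q' t‖ ^ 2 ≤ E := fun t => by
    have := mul_nonneg (show 0 ≤ 2 * ν by positivity) (hpos t)
    linarith [hE t]
  have hE0 : 0 ≤ E := (sq_nonneg _).trans (hval ⟨0, le_rfl, hT⟩)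
  have hgrad : ∫ s, ‖X.grad q s - X.grad q' s‖ ^ 2 ∂(timeMeasure T) ≤ (2 * ν)⁻¹ * E := by
    have h2 := hE ⟨T, hT, le_rfl⟩
    have huniv : Iic (⟨T, hT, le_rfl⟩ : Icc (0 : ℝ) T) = univ :=
      eq_univ_of_forall fun s => s.2.2
    rw [huniv, setIntegral_univ] at h2
    rw [inv_mul_eq_div, le_div_iff₀ (by positivity)]
    linarith [sq_nonneg ‖X.val q ⟨T, hT, le_rfl⟩ - X.val q' ⟨T, hT, le_rfl⟩‖]
  have hfin := X.norm_sub_sq_le hE0 hval hgrad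
  refine (abs_le_of_sq_le_sq' ?_ hε.le).2
  have : c * E = E + (2 * ν)⁻¹ * E := by simp only [c]; ring
  linarith

end Modes

/-! ### Completeness of the path space -/

section Complete

variable {ℓ T : ℝ}

/-- The condition `q(t) ∈ H¹₀(D)` for almost every `t` is closed: along a subsequence the gradients
converge almost everywhere, and the graph of the gradient is closed. -/
theorem isClosed_X : IsClosed (X ℓ T : Set (WithLp 2 (C(Icc (0 : ℝ) T, HH ℓ) ×
    Lp (GradHH ℓ) 2 (timeMeasure T)))) := by
  refine isSeqClosed_iff_isClosed.1 fun p p₀ hp hlim => ?_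
  have hc : Continuous fun p : WithLp 2 (C(Icc (0 : ℝ) T, HH ℓ) ×
      Lp (GradHH ℓ) 2 (timeMeasure T)) => WithLp.ofLp p := WithLp.prod_continuous_ofLp 2 _ _
  have h1 : Tendsto (fun n => (p n).fst) atTop (𝓝 p₀.fst) :=
    (continuous_fst.comp hc).continuousAt.tendsto.comp hlim
  have h2 : Tendsto (fun n => (p n).snd) atTop (𝓝 p₀.snd) :=
    (continuous_snd.comp hc).continuousAt.tendsto.comp hlim
  obtain ⟨ns, hns, hae⟩ := (tendstoInMeasure_of_tendsto_Lp h2).exists_seq_tendsto_ae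
  have h3 := ae_all_iff.2 fun n =>
    (hp n : ∀ᵐ t ∂(timeMeasure T), ∀ i, ((p n).fst t i, (p n).snd t i) ∈ H10Graph ℓ)
  change ∀ᵐ t ∂(timeMeasure T), ∀ i, (p₀.fst t i, p₀.snd t i) ∈ H10Graph ℓ
  filter_upwards [h3, hae] with t h4 h5 i
  have h6 : Tendsto (fun n => (p (ns n)).fst t) atTop (𝓝 (p₀.fst t)) :=
    ((ContinuousEvalConst.continuous_eval_const (F := C(Icc (0 : ℝ) T, HH ℓ)) t).tendsto _).comp (h1.comp hns.tendsto_atTop)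
  have h7 : Tendsto (fun n => (p (ns n)).fst t i) atTop (𝓝 (p₀.fst t i)) :=
    ((PiLp.continuous_apply 2 (fun _ : Fin 2 => L2 ℓ) i).tendsto _).comp h6
  have h8 : Tendsto (fun n => (p (ns n)).snd t i) atTop (𝓝 (p₀.snd t i)) :=
    ((PiLp.continuous_apply 2 (fun _ : Fin 2 => L2Vec ℓ) i).tendsto _).comp h5
  exact (Submodule.isClosed_topologicalClosure (testGraph ℓ)).mem_of_tendsto
    (h7.prodMk_nhds h8) (Eventually.of_forall fun n => h4 (ns n) i)

instance : CompleteSpace (X ℓ T) := isClosed_X.completeSpace_coe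

end Complete

/-! ### Precompactness of bounded sets of solutions -/

section Precompact

variable {ℓ T F₁ F₂ ν N : ℝ}

/-- The modes of bounded solutions are equicontinuous in time. -/
theorem exists_holder (hℓ : 0 < ℓ) (hF₁ : 0 < F₁) (hF₂ : 0 < F₂) (T ν N : ℝ) (ξ : HH ℓ)
    (k : ℕ × ℕ) : ∃ c, ∀ (q : X ℓ T) (ψ) (z), BoundedSolution F₁ F₂ ν N ξ q ψ z →
      ∀ i s t, |sc k (X.val q s i) - sc k (X.val q t i)| ≤ √(dist s t) * c := by
  obtain ⟨C, hC, hw⟩ := exists_weakSup_le hℓ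
  refine ⟨√(2 * (‖contL2 ℓ (eC ℓ k)‖ + ‖eGrad ℓ k‖) ^ 2 * ((|ν| + C * N) ^ 2 + 1) * N),
    fun q ψ z h i => ?_⟩
  have hN := h.nonneg
  have hψ : ∀ s, EssBdd (C * N) (ψ s i).toL2 := by
    intro s
    filter_upwards [(h.stream s).essBdd hℓ hF₁ hF₂ i] with x hx
    refine hx.trans ((hw _).trans ?_)
    gcongr
    exact h.norm_le s
  have key := fun {s t : Icc (0 : ℝ) T} (hst : s ≤ t) => (h.eq i).abs_sc_sub_le (by positivity) hψ
    (h.grad_apply_le i) (h.source_le i) k hst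
  have hd : ∀ {s t : Icc (0 : ℝ) T}, s ≤ t → dist s t = t - s := fun {s t} hst => by
    rw [Subtype.dist_eq, dist_comm, Real.dist_eq, abs_of_nonneg (sub_nonneg.2 (show (s : ℝ) ≤ t from hst))]
  intro s t
  rcases le_total s t with hst | hst
  · rw [abs_sub_comm, hd hst]
    exact key hst
  · rw [dist_comm, hd hst]
    exact key hst

/-- The path of a sine coefficient of the layer `i`. -/
def coefPath (k : ℕ × ℕ) (i : Fin 2) (q : X ℓ T) : BoundedContinuousFunction (Icc (0 : ℝ) T) ℝ :=
  BoundedContinuousFunction.mkOfCompact ⟨fun t => sc k (X.val q t i),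
    (continuous_sc k).comp ((PiLp.continuous_apply 2 (fun _ : Fin 2 => L2 ℓ) i).comp
      (X.continuous_val q))⟩

theorem coefPath_apply (k : ℕ × ℕ) (i : Fin 2) (q : X ℓ T) (t : Icc (0 : ℝ) T) :
    coefPath k i q t = sc k (X.val q t i) := rfl

/-- By the theorem of Arzelà and Ascoli, every single mode of bounded solutions is compact. -/
theorem exists_tendsto_coefPath (hℓ : 0 < ℓ) (hF₁ : 0 < F₁) (hF₂ : 0 < F₂) (ξ : HH ℓ)
    (U : Ultrafilter (X ℓ T))
    (hU : ∀ᶠ q in (U : Filter (X ℓ T)), ∃ ψ z, BoundedSolution F₁ F₂ ν N ξ q ψ z)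
    (k : ℕ × ℕ) (i : Fin 2) : ∃ c, Tendsto (coefPath k i) (U : Filter (X ℓ T)) (𝓝 c) := by
  set A := coefPath k i '' {q : X ℓ T | ∃ ψ z, BoundedSolution F₁ F₂ ν N ξ q ψ z}
  obtain ⟨c, hc⟩ := exists_holder hℓ hF₁ hF₂ T ν N ξ k
  have hA : IsCompact (closure A) := by
    refine BoundedContinuousFunction.arzela_ascoli (Icc (-N) N) isCompact_Icc A ?_ ?_
    · rintro _ t ⟨q, ⟨ψ, z, h⟩, rfl⟩
      rw [coefPath_apply]
      exact abs_le.1 ((abs_sc_le hℓ k _).trans ((norm_apply_le _ i).trans (h.norm_le t)))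
    · refine Metric.equicontinuous_of_continuity_modulus (fun x => √x * c) ?_ _ ?_
      · have h : Continuous fun x : ℝ => √x * c := by fun_prop
        simpa using h.tendsto 0
      · rintro s t ⟨_, q, ⟨ψ, z, h⟩, rfl⟩
        exact hc q ψ z h i s t
  obtain ⟨b, -, hb⟩ := isCompact_iff_ultrafilter_le_nhds.1 hA (U.map (coefPath k i)) (by
    rw [le_principal_iff]
    refine mem_of_superset ?_ subset_closure
    exact hU.mono fun q hq => mem_image_of_mem _ hq)
  exact ⟨b, hb⟩

/-- An ultrafilter of bounded solutions is Cauchy in `X`: the finitely many modes that matter for a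
given precision converge along it, uniformly in time. -/
theorem cauchy_of_boundedSolution (hℓ : 0 < ℓ) (hT : 0 ≤ T) (hF₁ : 0 < F₁) (hF₂ : 0 < F₂)
    (hν : 0 < ν) (hN : 0 ≤ N) (ξ : HH ℓ) (U : Ultrafilter (X ℓ T))
    (hU : ∀ᶠ q in (U : Filter (X ℓ T)), ∃ ψ z, BoundedSolution F₁ F₂ ν N ξ q ψ z) :
    Cauchy (U : Filter (X ℓ T)) := by
  refine Metric.cauchy_iff.2 ⟨U.neBot, fun ε hε => ?_⟩
  obtain ⟨F, δ, hδ, h⟩ := exists_modes_norm_sub_le (T := T) hℓ hT hF₁ hF₂ hν hN ξ (half_pos hε)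
  choose c hc using exists_tendsto_coefPath hℓ hF₁ hF₂ ξ U hU
  have h1 : ∀ᶠ q in (U : Filter (X ℓ T)), ∀ k ∈ F, ∀ i, dist (coefPath k i q) (c k i) < δ / 2 := by
    refine (Finset.eventually_all F).2 fun k _ => eventually_all.2 fun i => ?_
    exact (hc k i).eventually (Metric.ball_mem_nhds _ (half_pos hδ))
  refine ⟨_, hU.and h1, ?_⟩
  rintro q ⟨⟨ψ, z, hq⟩, hqc⟩ q' ⟨⟨ψ', z', hq'⟩, hqc'⟩
  rw [dist_eq_norm]
  refine (h q q' ψ ψ' z z' hq hq' fun k hk i t => ?_).trans_lt (half_lt_self hε)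
  have h2 : dist (coefPath k i q) (coefPath k i q') ≤ δ := by
    have := dist_triangle_right (coefPath k i q) (coefPath k i q') (c k i)
    linarith [hqc k hk i, hqc' k hk i]
  exact (BoundedContinuousFunction.dist_coe_le_dist t).trans h2

end Precompact

/-! ### Weak limits of the controls -/

section WeakLimit

/-- Bounded sets of a Hilbert space are weakly relatively compact. -/
theorem exists_weak_limit {α E : Type*} [NormedAddCommGroup E] [InnerProductSpace ℝ E]
    [CompleteSpace E] (U : Ultrafilter α) {a : α → E} {C : ℝ}
    (ha : ∀ᶠ x in (U : Filter α), ‖a x‖ ≤ C) :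
    ∃ b : E, ‖b‖ ≤ C ∧ ∀ y, Tendsto (fun x => inner ℝ (a x) y) U (𝓝 (inner ℝ b y)) := by
  have hC : 0 ≤ C := by
    obtain ⟨x, hx⟩ := ha.exists
    exact (norm_nonneg _).trans hx
  have hb : ∀ y, ∀ᶠ x in (U : Filter α), |inner ℝ (a x) y| ≤ C * ‖y‖ := fun y =>
    ha.mono fun x hx => (abs_real_inner_le_norm _ _).trans (by gcongr)
  have hlim : ∀ y, ∃ L, Tendsto (fun x => (inner ℝ (a x) y : ℝ)) U (𝓝 L) := by
    intro y
    obtain ⟨L, -, hL⟩ := isCompact_iff_ultrafilter_le_nhds.1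
      (isCompact_Icc (a := -(C * ‖y‖)) (b := C * ‖y‖)) (U.map fun x => (inner ℝ (a x) y : ℝ))
      (le_principal_iff.2 ((hb y).mono fun x hx => abs_le.1 hx))
    exact ⟨L, hL⟩
  -- The limits are linear and bounded in `y`, so that the Riesz representation gives the limit.
  choose L hL using hlim
  let Λ : E →ₗ[ℝ] ℝ :=
    { toFun := L
      map_add' := fun y y' => tendsto_nhds_unique (hL (y + y'))
        (((hL y).add (hL y')).congr fun x => (inner_add_right _ _ _).symm)
      map_smul' := fun c y => tendsto_nhds_unique (hL (c • y))
        (((hL y).const_mul c).congr fun x => (real_inner_smul_right _ _ _).symm) }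
  have hΛ : ∀ y, ‖Λ y‖ ≤ C * ‖y‖ := fun y => le_of_tendsto (hL y).norm (hb y)
  refine ⟨(InnerProductSpace.toDual ℝ E).symm (Λ.mkContinuous C hΛ), ?_, fun y => ?_⟩
  · rw [LinearIsometryEquiv.norm_map]
    exact Λ.mkContinuous_norm_le hC hΛ
  · rw [InnerProductSpace.toDual_symm_apply]
    exact hL y

/-- The functional `h ↦ ∫₀ᵗ (A(s) h(s), v) ds` is continuous on `L²`. -/
theorem exists_inner_eq_integral {T : ℝ} {E F : Type*} [NormedAddCommGroup E]
    [InnerProductSpace ℝ E] [CompleteSpace E] [NormedAddCommGroup F] [InnerProductSpace ℝ F]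
    [CompleteSpace F] {A : Icc (0 : ℝ) T → E →L[ℝ] F} (hA : Continuous A) (v : F)
    (t : Icc (0 : ℝ) T) : ∃ y : Lp E 2 (timeMeasure T), ∀ h : Lp E 2 (timeMeasure T),
      inner ℝ h y = ∫ s in Iic t, inner ℝ (A s (h s)) v ∂(timeMeasure T) := by
  have hc : Continuous fun s => ContinuousLinearMap.adjoint (A s) v :=
    ((ContinuousLinearMap.adjoint (𝕜 := ℝ) (E := E) (F := F)).continuous.comp hA).clm_apply
      continuous_const
  have hm : MemLp ((Iic t).indicator fun s => ContinuousLinearMap.adjoint (A s) v) 2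
      (timeMeasure T) := (memLp_of_continuous hc).indicator measurableSet_Iic
  refine ⟨hm.toLp _, fun h => ?_⟩
  rw [L2.inner_def, ← integral_indicator measurableSet_Iic]
  refine integral_congr_ae ?_
  filter_upwards [hm.coeFn_toLp] with s hs
  rw [hs]
  by_cases h1 : s ∈ Iic t
  · rw [indicator_of_mem h1, indicator_of_mem h1, ContinuousLinearMap.adjoint_inner_right]
  · rw [indicator_of_notMem h1, indicator_of_notMem h1, inner_zero_right]

end WeakLimit

/-! ### Passage to the limit in the weak formulation -/

section Limit

variable {ℓ T F₁ F₂ ν β r : ℝ}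

theorem abs_trip_sub_le {B : ℝ} {u : L2 ℓ} (hu : EssBdd B u) (v w v' w' : L2 ℓ) :
    |trip u v w - trip u v' w'| ≤ B * (‖v - v'‖ * ‖w‖ + ‖v'‖ * ‖w - w'‖) := by
  have e : trip u v w - trip u v' w' = trip u (v - v') w + trip u v' (w - w') := by
    simp only [trip_eq_inner hu, map_sub, inner_sub_left, inner_sub_right]
    ring
  rw [e]
  have h1 := abs_trip_le hu (v - v') w
  have h2 := abs_trip_le hu v' (w - w')
  have h3 := abs_add_le (trip u (v - v') w) (trip u v' (w - w'))
  linarith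

theorem abs_jacobi_sub_le {B : ℝ} (hB : 0 ≤ B) (β : ℝ) (ψ ψ' : H2H10 ℓ) (g g' : L2Vec ℓ)
    {φ : H2H10 ℓ} (hφ : EssBdd B φ.toL2) :
    |jacobi β ψ g φ - jacobi β ψ' g' φ| ≤
      2 * B * (‖(ψ - ψ').grad‖ * ‖g‖ + ‖ψ'.grad‖ * ‖g - g'‖)
        + |β| * ‖φ.toL2‖ * ‖(ψ - ψ').grad‖ := by
  rw [jacobi_eq β ψ g hφ, jacobi_eq β ψ' g' hφ]
  have key : ∀ i j : Fin 2,
      |trip φ.toL2 (ψ.grad i) (g j) - trip φ.toL2 (ψ'.grad i) (g' j)|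
        ≤ B * (‖(ψ - ψ').grad‖ * ‖g‖ + ‖ψ'.grad‖ * ‖g - g'‖) := by
    intro i j
    refine (abs_trip_sub_le hφ _ _ _ _).trans ?_
    have h1 : ‖ψ.grad i - ψ'.grad i‖ ≤ ‖(ψ - ψ').grad‖ := norm_apply_le (ψ - ψ').grad i
    have h2 : ‖g j - g' j‖ ≤ ‖g - g'‖ := norm_apply_le (g - g') j
    have h3 := norm_apply_le g j
    have h4 := norm_apply_le ψ'.grad i
    gcongr
  have h5 : |β * inner ℝ (ψ.grad 0) φ.toL2 - β * inner ℝ (ψ'.grad 0) φ.toL2|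
      ≤ |β| * ‖φ.toL2‖ * ‖(ψ - ψ').grad‖ := by
    rw [← mul_sub, ← inner_sub_left, abs_mul, mul_assoc]
    refine mul_le_mul_of_nonneg_left ((abs_real_inner_le_norm _ _).trans ?_) (abs_nonneg _)
    rw [mul_comm]
    exact mul_le_mul_of_nonneg_left (norm_apply_le (ψ - ψ').grad 0) (norm_nonneg _)
  have k1 := abs_le.1 (key 0 1)
  have k2 := abs_le.1 (key 1 0)
  have k3 := abs_le.1 h5
  exact abs_le.2 ⟨by linarith [k1.1, k2.2, k3.1], by linarith [k1.2, k2.1, k3.2]⟩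

/-- The integrand in the weak formulation, with a minus sign for the terms on the right-hand side of
the equation other than the control. -/
def weakForm (ν β r : ℝ) (φ ψ : Fin 2 → H2H10 ℓ) (g : GradHH ℓ) (fs : L2 ℓ) : ℝ :=
  ∑ i, (jacobi β (ψ i) (g i) (φ i) - ν * inner ℝ (ψ i).lap (φ i).lap)
    - inner ℝ fs (φ 0).toL2 + r * inner ℝ (ψ 1).lap (φ 1).toL2

theorem exists_weakForm_sub_le (hℓ : 0 < ℓ) (hF₁ : 0 < F₁) (hF₂ : 0 < F₂) (ν β r : ℝ)
    (φ : Fin 2 → H2H10 ℓ) : ∃ C, 0 ≤ C ∧ ∀ (q q' : HH ℓ) (ψ ψ') (g g' : GradHH ℓ) (fs : L2 ℓ),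
      IsStream F₁ F₂ q ψ → IsStream F₁ F₂ q' ψ' →
      |weakForm ν β r φ ψ g fs - weakForm ν β r φ ψ' g' fs|
        ≤ C * (‖q - q'‖ * (1 + ‖g‖) + ‖q'‖ * ‖g - g'‖) := by
  choose B hB hφ using fun i => (φ i).exists_essBdd hℓ
  have he := ellC_nonneg hℓ
  set c : Fin 2 → ℝ := fun i => 2 * B i * (ellC ℓ * 2) + |β| * ‖(φ i).toL2‖ * (ellC ℓ * 2)
    + |ν| * (2 * ‖(φ i).lap‖)
  have hc : ∀ i, 0 ≤ c i := fun i => by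
    have := hB i
    positivity
  refine ⟨c 0 + c 1 + |r| * (2 * ‖(φ 1).toL2‖),
    by have := hc 0; have := hc 1; positivity, fun q q' ψ ψ' g g' fs h h' => ?_⟩
  have hl := fun i => (h.sub h').norm_lap_le hℓ hF₁ hF₂ i
  have hg : ∀ i, ‖(ψ i - ψ' i).grad‖ ≤ ellC ℓ * 2 * ‖q - q'‖ := fun i =>
    ((ψ i - ψ' i).norm_grad_le hℓ).trans
      ((mul_le_mul_of_nonneg_left (hl i) he).trans_eq (by ring))
  have hg' : ∀ i, ‖(ψ' i).grad‖ ≤ ellC ℓ * 2 * ‖q'‖ := fun i =>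
    ((ψ' i).norm_grad_le hℓ).trans
      ((mul_le_mul_of_nonneg_left (h'.norm_lap_le hℓ hF₁ hF₂ i) he).trans_eq (by ring))
  set D := ‖q - q'‖ * (1 + ‖g‖) + ‖q'‖ * ‖g - g'‖
  have hD : ‖q - q'‖ ≤ D := by
    have h1 : 0 ≤ ‖q - q'‖ * ‖g‖ := by positivity
    have h2 : 0 ≤ ‖q'‖ * ‖g - g'‖ := by positivity
    simp only [D]
    linarith
  have hD' : ‖q - q'‖ * ‖g‖ + ‖q'‖ * ‖g - g'‖ ≤ D := by
    simp only [D]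
    linarith [norm_nonneg (q - q')]
  have hlap : ∀ i (v : L2 ℓ), |inner ℝ (ψ i).lap v - inner ℝ (ψ' i).lap v| ≤ 2 * ‖v‖ * D := by
    intro i v
    rw [← inner_sub_left, ← H2H10.sub_lap]
    refine (abs_real_inner_le_norm _ _).trans ?_
    calc _ ≤ (2 * ‖q - q'‖) * ‖v‖ := mul_le_mul_of_nonneg_right (hl i) (norm_nonneg _)
      _ ≤ (2 * D) * ‖v‖ := by gcongr
      _ = _ := by ring
  have hi : ∀ i, |jacobi β (ψ i) (g i) (φ i) - ν * inner ℝ (ψ i).lap (φ i).lap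
      - (jacobi β (ψ' i) (g' i) (φ i) - ν * inner ℝ (ψ' i).lap (φ i).lap)| ≤ c i * D := by
    intro i
    have hBi := hB i
    have h1 : |jacobi β (ψ i) (g i) (φ i) - jacobi β (ψ' i) (g' i) (φ i)| ≤
        (2 * B i * (ellC ℓ * 2) + |β| * ‖(φ i).toL2‖ * (ellC ℓ * 2)) * D := by
      refine (abs_jacobi_sub_le hBi β (ψ i) (ψ' i) (g i) (g' i) (hφ i)).trans ?_
      have h3 : ‖(ψ i - ψ' i).grad‖ * ‖g i‖ + ‖(ψ' i).grad‖ * ‖g i - g' i‖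
          ≤ ellC ℓ * 2 * D := by
        calc _ ≤ ellC ℓ * 2 * ‖q - q'‖ * ‖g‖ + ellC ℓ * 2 * ‖q'‖ * ‖g - g'‖ := by
              have h4 : ‖g i - g' i‖ ≤ ‖g - g'‖ := norm_GradHH_apply_le (g - g') i
              gcongr
              exacts [hg i, norm_GradHH_apply_le g i, hg' i]
          _ = ellC ℓ * 2 * (‖q - q'‖ * ‖g‖ + ‖q'‖ * ‖g - g'‖) := by ring
          _ ≤ _ := by gcongr
      have h4 : ‖(ψ i - ψ' i).grad‖ ≤ ellC ℓ * 2 * D := (hg i).trans (by gcongr)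
      calc _ ≤ 2 * B i * (ellC ℓ * 2 * D) + |β| * ‖(φ i).toL2‖ * (ellC ℓ * 2 * D) := by gcongr
        _ = _ := by ring
    have h2 : |ν * inner ℝ (ψ i).lap (φ i).lap - ν * inner ℝ (ψ' i).lap (φ i).lap|
        ≤ |ν| * (2 * ‖(φ i).lap‖) * D := by
      rw [← mul_sub, abs_mul, mul_assoc]
      exact mul_le_mul_of_nonneg_left (hlap i _) (abs_nonneg _)
    rw [sub_sub_sub_comm]
    refine (abs_sub _ _).trans ?_
    simp only [c]
    linarith
  have hr : |r * inner ℝ (ψ 1).lap (φ 1).toL2 - r * inner ℝ (ψ' 1).lap (φ 1).toL2|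
      ≤ |r| * (2 * ‖(φ 1).toL2‖) * D := by
    rw [← mul_sub, abs_mul, mul_assoc]
    exact mul_le_mul_of_nonneg_left (hlap 1 _) (abs_nonneg _)
  have k0 := abs_le.1 (hi 0)
  have k1 := abs_le.1 (hi 1)
  have k2 := abs_le.1 hr
  rw [weakForm, weakForm, Fin.sum_univ_two, Fin.sum_univ_two]
  exact abs_le.2 ⟨by linarith [k0.1, k1.1, k2.1], by linarith [k0.2, k1.2, k2.2]⟩

theorem aestronglyMeasurable_jacobi (hℓ : 0 < ℓ) (β : ℝ) {ψ : Icc (0 : ℝ) T → H2H10 ℓ}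
    (hψ : Continuous fun s => (ψ s).grad) {g : Icc (0 : ℝ) T → L2Vec ℓ}
    (hg : AEStronglyMeasurable g (timeMeasure T)) (φ : H2H10 ℓ) :
    AEStronglyMeasurable (fun s => jacobi β (ψ s) (g s) φ) (timeMeasure T) := by
  obtain ⟨B, hB, hφ⟩ := φ.exists_essBdd hℓ
  simp only [jacobi_eq β _ _ hφ, trip_eq_inner hφ]
  have hc : ∀ j, Continuous fun s => (ψ s).grad j := fun j =>
    (PiLp.continuous_apply 2 (fun _ : Fin 2 => L2 ℓ) j).comp hψ
  have hm : ∀ i j, AEStronglyMeasurable (fun s => (inner ℝ (mulBdd hφ ((ψ s).grad i)) (g s j) : ℝ))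
      (timeMeasure T) := fun i j =>
    ((mulBdd hφ).continuous.comp (hc i)).aestronglyMeasurable_of_compactSpace.inner
      (aestronglyMeasurable_apply hg j)
  exact ((hm 0 1).sub (hm 1 0)).add
    ((aestronglyMeasurable_inner_const (hc 0).aestronglyMeasurable_of_compactSpace
      φ.toL2).const_mul β)

variable {ψ : Icc (0 : ℝ) T → Fin 2 → H2H10 ℓ}

theorem integrable_weakForm (hℓ : 0 < ℓ) (hF₁ : 0 < F₁) (hF₂ : 0 < F₂) (ν β r : ℝ)
    (φ : Fin 2 → H2H10 ℓ) (f : Lp (L2 ℓ) 2 (timeMeasure T)) {q : X ℓ T}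
    (hψ : ∀ t, IsStream F₁ F₂ (X.val q t) (ψ t)) :
    Integrable (fun s => weakForm ν β r φ (ψ s) (X.grad q s) (f s)) (timeMeasure T) := by
  have hq := X.continuous_val q
  obtain ⟨C, hC, h⟩ := exists_weakForm_sub_le hℓ hF₁ hF₂ ν β r φ
  obtain ⟨D, hD, hqD⟩ := exists_norm_le_of_continuous hq
  have hzero : IsStream F₁ F₂ (0 : HH ℓ) fun _ => 0 := by
    constructor <;> simp [H2H10.zero_lap, H2H10.zero_toL2]
  have hl := continuous_stream_lap hℓ hF₁ hF₂ hq hψ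
  have hlm : ∀ i (v : L2 ℓ), AEStronglyMeasurable (fun s => (inner ℝ (ψ s i).lap v : ℝ))
      (timeMeasure T) := fun i v =>
    aestronglyMeasurable_inner_const (hl i).aestronglyMeasurable_of_compactSpace v
  have hj := fun i => aestronglyMeasurable_jacobi hℓ β
    (continuous_stream_grad hℓ hF₁ hF₂ hq hψ i) (X.memLp_grad_apply q i).1 (φ i)
  have hfm : Integrable (fun s => (inner ℝ (f s) (φ 0).toL2 : ℝ)) (timeMeasure T) :=
    ((Lp.memLp f).integrable one_le_two).inner_const _
  have hm : AEStronglyMeasurable (fun s => weakForm ν β r φ (ψ s) (X.grad q s) (f s))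
      (timeMeasure T) := by
    simp only [weakForm, Fin.sum_univ_two]
    exact ((((hj 0).sub ((hlm 0 _).const_mul ν)).add ((hj 1).sub ((hlm 1 _).const_mul ν))).sub
      hfm.1).add ((hlm 1 _).const_mul r)
  have hgi : Integrable (fun s => ‖X.grad q s‖) (timeMeasure T) :=
    (X.memLp_grad q).norm.integrable one_le_two
  have h0 : ∀ s, weakForm ν β r φ (fun _ => 0) 0 (f s)
      = weakForm ν β r φ (fun _ => 0) 0 0 - inner ℝ (f s) (φ 0).toL2 := fun s => by
    simp only [weakForm, inner_zero_left]
    ring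
  refine Integrable.mono' ((((integrable_const (1 : ℝ)).add hgi).const_mul (C * D)).add
    ((integrable_const (weakForm ν β r φ (fun _ => 0) 0 0)).sub hfm).norm) hm
    (Eventually.of_forall fun s => ?_)
  have h1 := h _ _ _ _ (X.grad q s) 0 (f s) (hψ s) hzero
  rw [sub_zero, norm_zero, zero_mul, add_zero, h0] at h1
  have h2 : C * (‖X.val q s‖ * (1 + ‖X.grad q s‖)) ≤ C * (D * (1 + ‖X.grad q s‖)) := by
    gcongr
    exact hqD s
  have h3 := abs_add_le (weakForm ν β r φ (ψ s) (X.grad q s) (f s)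
    - (weakForm ν β r φ (fun _ => 0) 0 0 - inner ℝ (f s) (φ 0).toL2))
    (weakForm ν β r φ (fun _ => 0) 0 0 - inner ℝ (f s) (φ 0).toL2)
  rw [sub_add_cancel] at h3
  simp only [Pi.add_apply, Pi.sub_apply, Real.norm_eq_abs] at h3 ⊢
  linarith

/-- The weak formulation depends on the path continuously. -/
theorem exists_integral_weakForm_sub_le (hℓ : 0 < ℓ) (hF₁ : 0 < F₁) (hF₂ : 0 < F₂) (ν β r : ℝ)
    (φ : Fin 2 → H2H10 ℓ) (f : Lp (L2 ℓ) 2 (timeMeasure T)) {q : X ℓ T}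
    (hψ : ∀ t, IsStream F₁ F₂ (X.val q t) (ψ t)) (N : ℝ) (t : Icc (0 : ℝ) T) :
    ∃ C, ∀ (q' : X ℓ T) (ψ' : Icc (0 : ℝ) T → Fin 2 → H2H10 ℓ), (∀ t, IsStream F₁ F₂ (X.val q' t) (ψ' t)) →
      (∀ t, ‖X.val q' t‖ ≤ N) →
      |∫ s in Iic t, weakForm ν β r φ (ψ' s) (X.grad q' s) (f s) ∂(timeMeasure T)
        - ∫ s in Iic t, weakForm ν β r φ (ψ s) (X.grad q s) (f s) ∂(timeMeasure T)|
      ≤ C * ‖q - q'‖ := by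
  obtain ⟨C, hC, h⟩ := exists_weakForm_sub_le hℓ hF₁ hF₂ ν β r φ
  set m := (timeMeasure T).real univ
  refine ⟨C * (∫ s, (1 + ‖X.grad q s‖) ∂(timeMeasure T) + N * √m), fun q' ψ' hψ' hN => ?_⟩
  have hN0 : 0 ≤ N := (norm_nonneg _).trans (hN t)
  have hgi : Integrable (fun s => 1 + ‖X.grad q s‖) (timeMeasure T) :=
    (integrable_const (1 : ℝ)).add ((X.memLp_grad q).norm.integrable one_le_two)
  have hdm : MemLp (fun s => ‖X.grad q s - X.grad q' s‖) 2 (timeMeasure T) :=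
    ((X.memLp_grad q).sub (X.memLp_grad q')).norm
  have hdi := hdm.integrable one_le_two
  have hI := integrable_weakForm hℓ hF₁ hF₂ ν β r φ f hψ
  have hI' := integrable_weakForm hℓ hF₁ hF₂ ν β r φ f hψ'
  have hd : ∫ s, ‖X.grad q s - X.grad q' s‖ ∂(timeMeasure T) ≤ √m * ‖q - q'‖ := by
    have h1 := integral_mul_le_sqrt (memLp_const (1 : ℝ)) hdm
    simp only [one_mul, one_pow, integral_const, smul_eq_mul, mul_one] at h1
    refine h1.trans (mul_le_mul_of_nonneg_left ?_ (Real.sqrt_nonneg _))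
    exact (Real.sqrt_le_sqrt (X.integral_grad_sub_le q q')).trans_eq
      (Real.sqrt_sq (norm_nonneg _))
  rw [abs_sub_comm, ← integral_sub hI.integrableOn hI'.integrableOn]
  calc _ ≤ ∫ s in Iic t, |weakForm ν β r φ (ψ s) (X.grad q s) (f s)
          - weakForm ν β r φ (ψ' s) (X.grad q' s) (f s)| ∂(timeMeasure T) :=
        abs_integral_le_integral_abs
    _ ≤ ∫ s, |weakForm ν β r φ (ψ s) (X.grad q s) (f s)
          - weakForm ν β r φ (ψ' s) (X.grad q' s) (f s)| ∂(timeMeasure T) :=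
        setIntegral_le_integral (hI.sub hI').abs (Eventually.of_forall fun _ => abs_nonneg _)
    _ ≤ ∫ s, C * (‖q - q'‖ * (1 + ‖X.grad q s‖) + N * ‖X.grad q s - X.grad q' s‖)
          ∂(timeMeasure T) := by
        refine integral_mono (hI.sub hI').abs
          (((hgi.const_mul ‖q - q'‖).add (hdi.const_mul N)).const_mul C) fun s => ?_
        refine (h _ _ _ _ (X.grad q s) (X.grad q' s) (f s) (hψ s) (hψ' s)).trans ?_
        gcongr
        exacts [X.norm_val_sub_le q q' s, hN s]
    _ = C * (‖q - q'‖ * ∫ s, (1 + ‖X.grad q s‖) ∂(timeMeasure T)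
          + N * ∫ s, ‖X.grad q s - X.grad q' s‖ ∂(timeMeasure T)) := by
        rw [integral_const_mul, integral_add (hgi.const_mul _) (hdi.const_mul _),
          integral_const_mul, integral_const_mul]
    _ ≤ C * (‖q - q'‖ * ∫ s, (1 + ‖X.grad q s‖) ∂(timeMeasure T) + N * (√m * ‖q - q'‖)) := by
        gcongr
    _ = _ := by ring

end Limit

/-! ### Limits of solutions along an ultrafilter -/

section Compactness

variable {ℓ T F₁ F₂ ν β r : ℝ}

theorem norm_le_of_mem_controlBall {H : Type} [NormedAddCommGroup H] [InnerProductSpace ℝ H]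
    [CompleteSpace H] {R : H →L[ℝ] H} {M : ℝ} {h : Lp (H0 R) 2 (timeMeasure T)}
    (hh : h ∈ controlBall R T M) : ‖h‖ ≤ √M :=
  Real.le_sqrt_of_sq_le ((norm_Lp_sq h).trans_le hh)

theorem integral_norm_control_le {H : Type} [NormedAddCommGroup H] [InnerProductSpace ℝ H]
    [CompleteSpace H] {R : H →L[ℝ] H} {M : ℝ} {h : Lp (H0 R) 2 (timeMeasure T)}
    (hh : h ∈ controlBall R T M) :
    ∫ s, ‖h s‖ ∂(timeMeasure T) ≤ √((timeMeasure T).real univ) * √M := by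
  have h1 := integral_mul_le_sqrt (memLp_const (1 : ℝ)) (Lp.memLp h).norm
  simp only [one_mul, one_pow, integral_const, smul_eq_mul, mul_one] at h1
  exact h1.trans (mul_le_mul_of_nonneg_left (Real.sqrt_le_sqrt hh) (Real.sqrt_nonneg _))

theorem tendsto_norm_sub_of_le_nhds {E : Type*} [NormedAddCommGroup E] {U : Filter E} {q : E}
    (h : U ≤ 𝓝 q) : Tendsto (fun p => ‖p - q‖) U (𝓝 0) :=
  tendsto_iff_norm_sub_tendsto_zero.1 (tendsto_id.mono_left h)

/-- The control term passes to the limit: `σ(q)` converges strongly, the control weakly. -/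
theorem tendsto_control {R : HH ℓ →L[ℝ] HH ℓ} {σ : HH ℓ → H0 R →L[ℝ] HH ℓ}
    (hσ : NoiseAssumption R σ) {M : ℝ} {q : X ℓ T} {U : Ultrafilter (X ℓ T)}
    (hU : (U : Filter (X ℓ T)) ≤ 𝓝 q) {a : X ℓ T → Lp (H0 R) 2 (timeMeasure T)}
    (ha : ∀ᶠ p in (U : Filter (X ℓ T)), a p ∈ controlBall R T M)
    {h : Lp (H0 R) 2 (timeMeasure T)}
    (hlim : ∀ y, Tendsto (fun p => inner ℝ (a p) y) (U : Filter (X ℓ T)) (𝓝 (inner ℝ h y)))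
    (v : HH ℓ) (t : Icc (0 : ℝ) T) :
    Tendsto (fun p => ∫ s in Iic t, inner ℝ (σ (X.val p s) (a p s)) v ∂(timeMeasure T))
      (U : Filter (X ℓ T)) (𝓝 (∫ s in Iic t, inner ℝ (σ (X.val q s) (h s)) v ∂(timeMeasure T))) := by
  have hq := X.continuous_val q
  obtain ⟨y, hy⟩ := exists_inner_eq_integral (A := fun s => σ (X.val q s))
    (hσ.continuous_op.comp hq) v t
  obtain ⟨L, hL, hlip⟩ := hσ.exists_lipschitz
  have hi : ∀ p p' : X ℓ T, Integrable (fun s => inner ℝ (σ (X.val p s) (a p' s)) v)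
      (timeMeasure T) := fun p p' =>
    ((memLp_control hσ (X.continuous_val p) (a p')).integrable one_le_two).inner_const v
  set m := √((timeMeasure T).real univ) * √M
  have hbound : ∀ᶠ p in (U : Filter (X ℓ T)),
      ‖∫ s in Iic t, inner ℝ (σ (X.val p s) (a p s)) v ∂(timeMeasure T) - inner ℝ (a p) y‖
        ≤ L * ‖p - q‖ * ‖v‖ * m := by
    filter_upwards [ha] with p hp
    rw [hy, ← integral_sub (hi p p).integrableOn (hi q p).integrableOn]
    have hn : Integrable (fun s => ‖a p s‖) (timeMeasure T) :=
      (Lp.memLp (a p)).norm.integrable one_le_two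
    calc _ ≤ ∫ s in Iic t, L * ‖p - q‖ * ‖v‖ * ‖a p s‖ ∂(timeMeasure T) := by
          refine norm_integral_le_of_norm_le (hn.const_mul _).integrableOn
            (Eventually.of_forall fun s => ?_)
          rw [← inner_sub_left, ← _root_.sub_apply]
          refine (norm_inner_le_norm _ _).trans ?_
          have h1 : ‖(σ (X.val p s) - σ (X.val q s)) (a p s)‖ ≤ L * ‖p - q‖ * ‖a p s‖ := by
            refine (ContinuousLinearMap.le_opNorm _ _).trans ?_
            gcongr
            exact (hlip _ _).trans (mul_le_mul_of_nonneg_left (X.norm_val_sub_le p q s) hL)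
          calc _ ≤ L * ‖p - q‖ * ‖a p s‖ * ‖v‖ := mul_le_mul_of_nonneg_right h1 (norm_nonneg _)
            _ = _ := by ring
      _ ≤ ∫ s, L * ‖p - q‖ * ‖v‖ * ‖a p s‖ ∂(timeMeasure T) :=
          setIntegral_le_integral (hn.const_mul _) (Eventually.of_forall fun s => by positivity)
      _ = L * ‖p - q‖ * ‖v‖ * ∫ s, ‖a p s‖ ∂(timeMeasure T) := integral_const_mul _ _
      _ ≤ _ := mul_le_mul_of_nonneg_left (integral_norm_control_le hp) (by positivity)
  have hp : Tendsto (fun p => L * ‖p - q‖ * ‖v‖ * m) (U : Filter (X ℓ T)) (𝓝 0) := by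
    have := (((tendsto_norm_sub_of_le_nhds hU).const_mul L).mul_const ‖v‖).mul_const m
    rwa [mul_zero, zero_mul, zero_mul] at this
  -- `(σ(p) a_p, v) = ((σ(p) - σ(q)) a_p, v) + (σ(q) a_p, v)`; the last term is the functional `y`.
  have h0 := squeeze_zero_norm' hbound hp
  have h2 := h0.add (hlim y)
  rw [zero_add, hy] at h2
  exact h2.congr fun p => sub_add_cancel _ _

/-- A limit in `X` of solutions with controls in a ball is a solution with a control in the ball. -/
theorem mem_solutionSet_of_le_nhds (hℓ : 0 < ℓ) (hF₁ : 0 < F₁) (hF₂ : 0 < F₂) {M N : ℝ}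
    (hM : 0 ≤ M) {f : Lp (L2 ℓ) 2 (timeMeasure T)} {R : HH ℓ →L[ℝ] HH ℓ}
    {σ : HH ℓ → H0 R →L[ℝ] HH ℓ} (hσ : NoiseAssumption R σ) {ξ : HH ℓ} {q : X ℓ T}
    {U : Ultrafilter (X ℓ T)} (hU : (U : Filter (X ℓ T)) ≤ 𝓝 q)
    (hN : ∀ᶠ p in (U : Filter (X ℓ T)), ∀ t, ‖X.val p t‖ ≤ N)
    (hS : ∀ᶠ p in (U : Filter (X ℓ T)), p ∈ solutionSet T M F₁ F₂ ν β r f R σ ξ) :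
    q ∈ solutionSet T M F₁ F₂ ν β r f R σ ξ := by
  have hex : ∀ p : X ℓ T, ∃ (h : Lp (H0 R) 2 (timeMeasure T))
      (ψ : Icc (0 : ℝ) T → Fin 2 → H2H10 ℓ), p ∈ solutionSet T M F₁ F₂ ν β r f R σ ξ →
        h ∈ controlBall R T M ∧ (∀ t, IsStream F₁ F₂ (X.val p t) (ψ t)) ∧
          WeakEq ν β r f R σ ξ h p ψ := by
    intro p
    by_cases hp : p ∈ solutionSet T M F₁ F₂ ν β r f R σ ξ
    · obtain ⟨h, hh, ψ, hψ, heq⟩ := hp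
      exact ⟨h, ψ, fun _ => ⟨hh, hψ, heq⟩⟩
    · exact ⟨0, fun _ _ => 0, fun h => absurd h hp⟩
  choose a ψ' hsol using hex
  obtain ⟨h, hhM, hlim⟩ := exists_weak_limit U
    (hS.mono fun p hp => norm_le_of_mem_controlBall (hsol p hp).1)
  choose ψ hψ using fun t => exists_isStream hℓ hF₁ hF₂ (X.val q t)
  refine ⟨h, ?_, ψ, hψ, fun φ t => ?_⟩
  · change ∫ s, ‖h s‖ ^ 2 ∂(timeMeasure T) ≤ M
    rw [← norm_Lp_sq, ← Real.sq_sqrt hM]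
    exact pow_le_pow_left₀ (norm_nonneg _) hhM 2
  have hsub : Tendsto (fun p => ‖q - p‖) (U : Filter (X ℓ T)) (𝓝 0) := by
    simp only [norm_sub_rev q]
    exact tendsto_norm_sub_of_le_nhds hU
  have h1 : Tendsto (fun p => (inner ℝ (X.val p t) (toHH φ) : ℝ)) (U : Filter (X ℓ T))
      (𝓝 (inner ℝ (X.val q t) (toHH φ))) := by
    have h2 : Tendsto (fun p => X.val p t) (U : Filter (X ℓ T)) (𝓝 (X.val q t)) := by
      rw [tendsto_iff_norm_sub_tendsto_zero]
      refine squeeze_zero (fun _ => norm_nonneg _) (fun p => ?_) hsub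
      rw [norm_sub_rev]
      exact X.norm_val_sub_le q p t
    exact h2.inner tendsto_const_nhds
  have h2 : Tendsto (fun p => ∫ s in Iic t, weakForm ν β r φ (ψ' p s) (X.grad p s) (f s)
      ∂(timeMeasure T)) (U : Filter (X ℓ T))
      (𝓝 (∫ s in Iic t, weakForm ν β r φ (ψ s) (X.grad q s) (f s) ∂(timeMeasure T))) := by
    obtain ⟨C, hC⟩ := exists_integral_weakForm_sub_le hℓ hF₁ hF₂ ν β r φ f hψ N t
    rw [tendsto_iff_norm_sub_tendsto_zero]
    refine squeeze_zero' (Eventually.of_forall fun _ => norm_nonneg _) (hN.mp (hS.mono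
      fun p hp hpN => hC p (ψ' p) (hsol p hp).2.1 hpN)) ?_
    have := hsub.const_mul C
    rwa [mul_zero] at this
  have h3 := tendsto_control hσ hU (hS.mono fun p hp => (hsol p hp).1) hlim (toHH φ) t
  refine tendsto_nhds_unique_of_eventuallyEq
    ((h1.sub (tendsto_const_nhds (x := inner ℝ ξ (toHH φ)))).add h2) h3 ?_
  filter_upwards [hS] with p hp
  exact (hsol p hp).2.2 φ t

end Compactness

/-- Solutions with controls in a ball form a compact set. -/
theorem isCompact_solutionSet {ℓ T F₁ F₂ ν : ℝ} (hℓ : 0 < ℓ) (hT : 0 ≤ T) (hF₁ : 0 < F₁)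
    (hF₂ : 0 < F₂) (hν : 0 < ν) (β r : ℝ) {M : ℝ} (hM : 0 ≤ M)
    (f : Lp (L2 ℓ) 2 (timeMeasure T)) {R : HH ℓ →L[ℝ] HH ℓ} {σ : HH ℓ → H0 R →L[ℝ] HH ℓ}
    (hσ : NoiseAssumption R σ) (ξ : HH ℓ) :
    IsCompact (solutionSet T M F₁ F₂ ν β r f R σ ξ) := by
  obtain ⟨N, hN, hb⟩ := exists_boundedSolution hℓ hT hF₁ hF₂ hν β r M f hσ ξ
  refine isCompact_iff_ultrafilter_le_nhds'.2 fun U hU => ?_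
  have hU' : ∀ᶠ q in (U : Filter (X ℓ T)), ∃ ψ z, BoundedSolution F₁ F₂ ν N ξ q ψ z := by
    filter_upwards [hU]
    rintro q ⟨h, hh, ψ, hψ, heq⟩
    exact ⟨ψ, _, hb h hh q ψ hψ heq⟩
  obtain ⟨q, hq⟩ := cauchy_iff_exists_le_nhds.1
    (cauchy_of_boundedSolution hℓ hT hF₁ hF₂ hν hN ξ U hU')
  refine ⟨q, mem_solutionSet_of_le_nhds hℓ hF₁ hF₂ hM hσ hq (N := N) ?_ hU, hq⟩
  filter_upwards [hU'] with p hp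
  obtain ⟨ψ, z, h⟩ := hp
  exact h.norm_le

end TwoLayerQG

end

/-- Compactness in `X` of the set `K_M` of the solutions of the two-layer quasi-geostrophic
controlled equation with controls in the ball `S_M`. -/
theorem lemma4p4
    (ℓ T F₁ F₂ ν β r : ℝ) (hℓ : 0 < ℓ) (hT : 0 < T) (hF₁ : 0 < F₁) (hF₂ : 0 < F₂) (hν : 0 < ν)
    (f : MeasureTheory.Lp (TwoLayerQG.L2 ℓ) 2 (TwoLayerQG.timeMeasure T))
    (Q Qhalf : TwoLayerQG.HH ℓ →L[ℝ] TwoLayerQG.HH ℓ)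
    (hQ : Q.IsPositive) (hQtr : TwoLayerQG.FiniteTrace Q)
    (hQhalf : Qhalf.IsPositive) (hQhalf_sq : Qhalf ∘L Qhalf = Q)
    (σ : TwoLayerQG.HH ℓ → TwoLayerQG.H0 Qhalf →L[ℝ] TwoLayerQG.HH ℓ)
    (hσ : TwoLayerQG.NoiseAssumption Qhalf σ)
    (ξ : TwoLayerQG.HH ℓ) (M : ℝ) (hM : 0 < M) :
    IsCompact (TwoLayerQG.solutionSet T M F₁ F₂ ν β r f Qhalf σ ξ) := by
  exact TwoLayerQG.isCompact_solutionSet hℓ hT.le hF₁ hF₂ hν β r hM.le f hσ ξ
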